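/- Let $0<\beta\le 1$, $\gamma>0$, $\mu>0$, $n\ge 0$. Let $A_0,\dots,A_n\in\mathbb R$ with $\sum_{j=0}^nA_j=1$, $\kappa_0,\dots,\kappa_n\in(0,1)$, $w_0=0$, $w_1,\dots,w_n>0$, and put $A_{-j}=A_j$, $\kappa_{-j}=\kappa_j$, $w_{-j}=-w_j$. Let $K_\nu(z)=\frac12\int_0^\infty s^{\nu-1}e^{-\frac12(s+\frac1s)z}\,ds$ and, with $\mathbf 1_{\{0\}}$ the indicator of $\{0\}$, let $$c_1(\kappa_j)=\frac{2^{\mathbf 1_{\{0\}}(j)}2^{(1-\kappa_j)/2}}{\sqrt\pi\,\Gamma(\kappa_j/2)},\qquad c_2(\kappa_j)=\Big(2^{1-\mathbf 1_{\{0\}}(j)}\,\Gamma(\kappa_j)\cos\tfrac{\kappa_j\pi}{2}\Big)^{-1},\qquad \theta_{\kappa_j}(|\lambda|)=1-\frac{c_1(\kappa_j)}{c_2(\kappa_j)}K_{\frac{\kappa_j-1}{2}}(|\lambda|)\,|\lambda|^{\frac{1-\kappa_j}{2}}.$$ For $-n\le j\le n$ let $L_j$ be slowly varying at infinity (that is,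 positive and measurable on some $[a,\infty)$, $a>0$, with $L_j(cx)/L_j(x)\to1$ as $x\to\infty$ for every $c>0$) and bounded on every interval $(0,a]$, $a<\infty$. Let $\xi(x)$, $x\in\mathbb R$, be a real zero-mean Gaussian process with spectral density $$f^{(L)}(\lambda)=\sum_{j=-n}^{n}\frac{c_2(\kappa_j)}{2}A_j\,\frac{1-\theta_{\kappa_j}(|\lambda+w_j|)}{|\lambda+w_j|^{1-\kappa_j}}\,L_j\!\Big(\frac1{|\lambda+w_j|}\Big),$$ i.e. $f^{(L)}$ is a.e. nonnegative and integrable, and $\mathrm{Cov}(\xi(x),\xi(y))=\int_{\mathbb R}e^{i\lambda(x-y)}f^{(L)}(\lambda)\,d\lambda$. Let $Z$ be its random spectral measure, so that $\xi(x)=\int e^{i\lambda x}Z(d\lambda)$ and $\mathbb E|Z(d\lambda)|^2=f^{(L)}(\lambda)d\lambda$. Let $u(t,x)$, $t\ge0$, $x\in\mathbb R$, be a mean-square solution of the fractional Riesz--Bessel equation $$\frac{\partial^\beta u}{\partial t^\beta}=-\mu(I-\Delta)^{\gamma/2}(-\Delta)^{\alpha/2}u,\quad t>0,\qquad u(0,x)=\xi(x).$$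 This means: $t\mapsto u(t,x)$ is continuous from $[0,\infty)$ to $L^2(\Omega)$ for every $x$; for each $t>0$ there is $g_t$ such that $u(t,x)=\int e^{i\lambda x}g_t(\lambda)Z(d\lambda)$ for all $x$ and $|\lambda|^\alpha(1+\lambda^2)^{\gamma/2}g_t(\lambda)$ is square integrable with respect to $f^{(L)}(\lambda)d\lambda$, and the operator on the right acts by multiplying $g_t(\lambda)$ by $|\lambda|^\alpha(1+\lambda^2)^{\gamma/2}$; the time derivative is taken in $L^2(\Omega)$, and is the ordinary one for $\beta=1$ and the regularized (Caputo--Djrbashian) one, $\frac{1}{\Gamma(1-\beta)}\big[\frac{\partial}{\partial t}\int_0^t(t-\tau)^{-\beta}u(\tau,x)\,d\tau-t^{-\beta}u(0,x)\big]$, for $\beta<1$. Suppose $A_0\ne0$ and $\alpha>\kappa_0/2$. Then, as $\varepsilon\downarrow0$, the finite-dimensional distributions of $$U_\varepsilon^{(L)}(t,x)=\frac{\varepsilon^{-\frac{\kappa_0\beta}{2\alpha}}}{\sqrt{L_0(\varepsilon^{-\beta/\alpha})}}\;u\Big(\frac t\varepsilon,\frac{x}{\varepsilon^{\beta/\alpha}}\Big),\qquad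 t>0,\ x\in\mathbb R,$$ converge weakly to those of the zero-mean Gaussian field $$U_0(t,x)=\sqrt{\frac{c_2(\kappa_0)A_0}{2}}\int_{\mathbb R}\frac{e^{i\lambda x}E_\beta(-\mu|\lambda|^\alpha t^\beta)}{|\lambda|^{(1-\kappa_0)/2}}\,W(d\lambda),$$ where $E_\beta(s)=\sum_{k\ge0}s^k/\Gamma(1+\beta k)$ is the Mittag-Leffler function and $W$ is a symmetric complex Gaussian white noise: $\mathbb E|W(d\lambda)|^2=d\lambda$, $W(-B)=\overline{W(B)}$. -/

import Mathlib

open MeasureTheory ProbabilityTheory Filter Topology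
open scoped ENNReal

noncomputable section

namespace RieszBessel

/-! ### Special functions and constants -/

/-- The Mittag-Leffler function `E_β(s) = ∑ s ^ k / Γ(1 + β k)`. -/
def mittagLefflerE (β s : ℝ) : ℝ := ∑' k : ℕ, s ^ k / Real.Gamma (1 + β * k)

/-- The modified Bessel function of the second kind,
`K_ν(z) = (1/2) ∫_0^∞ s ^ (ν - 1) exp(-(s + 1/s) z / 2) ds`. -/
def besselK (ν z : ℝ) : ℝ :=
  1 / 2 * ∫ s in Set.Ioi (0 : ℝ), s ^ (ν - 1) * Real.exp (-(1 / 2) * (s + 1 / s) * z)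

/-- `c₁(κ_j)`, with the extra factor `2` for `j = 0`. -/
def c1 (j : ℤ) (κ : ℝ) : ℝ :=
  2 ^ (if j = 0 then 1 else 0) * (2 : ℝ) ^ ((1 - κ) / 2) / (√Real.pi * Real.Gamma (κ / 2))

/-- `c₂(κ_j) = (2 ^ (1 - 1_{0}(j)) Γ(κ_j) cos(κ_j π / 2))⁻¹`. -/
def c2 (j : ℤ) (κ : ℝ) : ℝ :=
  (2 ^ (if j = 0 then 0 else 1) * Real.Gamma κ * Real.cos (κ * Real.pi / 2))⁻¹

/-- `θ_{κ_j}(s)`, to be evaluated at `s = |λ|`. -/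
def theta (j : ℤ) (κ s : ℝ) : ℝ :=
  1 - c1 j κ / c2 j κ * besselK ((κ - 1) / 2) s * s ^ ((1 - κ) / 2)

/-- `L` is slowly varying at infinity. -/
def IsSlowlyVarying (L : ℝ → ℝ) : Prop :=
  (∃ a : ℝ, 0 < a ∧ (∀ x, a ≤ x → 0 < L x) ∧ Measurable ((Set.Ici a).domRestrict L)) ∧
    ∀ c : ℝ, 0 < c → Tendsto (fun x => L (c * x) / L x) atTop (𝓝 1)

/-- `w_j` for `j ∈ ℤ`: `w_{-j} = -w_j` and `w_0 = 0`. -/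
def location (w : ℕ → ℝ) (j : ℤ) : ℝ := (j.sign : ℝ) * w j.natAbs

/-- The modulated spectral density
`∑_{j=-n}^n (c₂(κ_j)/2) A_j (1 - θ_{κ_j}(|s + w_j|)) |s + w_j| ^ (κ_j - 1) L_j(1 / |s + w_j|)`,
where `κ_{-j} = κ_j` and `A_{-j} = A_j`. -/
def modulatedDensity (n : ℕ) (A κ w : ℕ → ℝ) (L : ℤ → ℝ → ℝ) (s : ℝ) : ℝ :=
  ∑ j ∈ Finset.Icc (-(n : ℤ)) n,
    c2 j (κ j.natAbs) / 2 * A j.natAbs *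
      ((1 - theta j (κ j.natAbs) |s + location w j|) /
        |s + location w j| ^ (1 - κ j.natAbs)) *
      L j (1 / |s + location w j|)

/-! ### Mean-square stochastic integrals -/

/-- `η` is the mean-square integral of `g`, for the integral that sends the elementary integrand
`e k` to the random variable `X k`: in the mean square, `g` and `η` are simultaneously limits of
`∑ c_k e_k` and `∑ c_k X_k`. -/
def IsMeanSquareIntegral {Ω T : Type*} [MeasurableSpace Ω] (P : Measure Ω) (ν : Measure ℝ)
    (e : T → ℝ → ℂ) (X : T → Ω → ℂ) (g : ℝ → ℂ) (η : Ω → ℂ) : Prop :=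
  MemLp g 2 ν ∧ MemLp η 2 P ∧ ∀ δ : ℝ≥0∞, 0 < δ → ∃ c : T →₀ ℂ,
    eLpNorm (fun s => g s - c.sum fun k a => a * e k s) 2 ν < δ ∧
    eLpNorm (fun ω => η ω - c.sum fun k a => a * X k ω) 2 P < δ

/-- The character `s ↦ exp(i s x)`. -/
def character (x s : ℝ) : ℂ := Complex.exp (Complex.I * s * x)

/-- The spectral measure with density `f`. -/
def spectralMeasure (f : ℝ → ℝ) : Measure ℝ := volume.withDensity fun s => ENNReal.ofReal (f s)

/-- The process `ξ` is (second-order) stationary with spectral density `f`: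
`Cov(ξ(x), ξ(y)) = ∫ exp(i s (x - y)) f(s) ds`, with `f` nonnegative and integrable. -/
structure HasSpectralDensity {Ω : Type*} [MeasurableSpace Ω] (P : Measure Ω)
    (ξ : ℝ → Ω → ℝ) (f : ℝ → ℝ) : Prop where
  integrable : Integrable f
  nonneg : ∀ᵐ s, 0 ≤ f s
  covariance : ∀ x y : ℝ,
    ((cov[ξ x, ξ y; P] : ℝ) : ℂ) = ∫ s : ℝ, character (x - y) s * (f s : ℂ)

/-- `η = ∫ g(s) Z(ds)`, where `Z` is the random spectral measure of `ξ`, that is,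
`ξ(x) = ∫ exp(i s x) Z(ds)` and `E|Z(ds)|² = f(s) ds`. -/
def IsSpectralIntegral {Ω : Type*} [MeasurableSpace Ω] (P : Measure Ω) (ξ : ℝ → Ω → ℝ)
    (f : ℝ → ℝ) (g : ℝ → ℂ) (η : Ω → ℝ) : Prop :=
  IsMeanSquareIntegral P (spectralMeasure f) character (fun x ω => (ξ x ω : ℂ)) g
    (fun ω => (η ω : ℂ))

/-- Borel sets of finite Lebesgue measure. -/
abbrev FiniteBorel : Type := {B : Set ℝ // MeasurableSet B ∧ volume B < ∞}

/-- A symmetric (Hermitian) complex Gaussian white noise on `ℝ`: `E|W(ds)|² = ds` and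
`W(-B)` is the complex conjugate of `W(B)`. -/
structure IsSymmetricWhiteNoise {Ω : Type*} [MeasurableSpace Ω] (P : Measure Ω)
    (W : FiniteBorel → Ω → ℂ) : Prop where
  gaussian : IsGaussianProcess W P
  mean_zero : ∀ B, ∫ ω, W B ω ∂P = 0
  covariance : ∀ B C : FiniteBorel,
    ∫ ω, W B ω * (starRingEnd ℂ) (W C ω) ∂P =
      (((volume ((B : Set ℝ) ∩ (C : Set ℝ))).toReal : ℝ) : ℂ)
  symmetric : ∀ B C : FiniteBorel, (C : Set ℝ) = (fun s => -s) ⁻¹' (B : Set ℝ) →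
    ∀ᵐ ω ∂P, W C ω = (starRingEnd ℂ) (W B ω)

/-- `η = ∫ g(s) W(ds)`. -/
def IsWienerIntegral {Ω : Type*} [MeasurableSpace Ω] (P : Measure Ω) (W : FiniteBorel → Ω → ℂ)
    (g : ℝ → ℂ) (η : Ω → ℝ) : Prop :=
  IsMeanSquareIntegral P volume
    (fun B : FiniteBorel => (B : Set ℝ).indicator fun _ => (1 : ℂ)) W g (fun ω => (η ω : ℂ))

/-! ### The fractional Riesz-Bessel equation -/

/-- The vector `d` is the time derivative of order `β ∈ (0, 1]` of `v` at `t`: the ordinary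
derivative for `β = 1` and the regularized (Caputo-Djrbashian) derivative for `β < 1`. -/
def HasFractionalDerivAt {E : Type*} [NormedAddCommGroup E] [NormedSpace ℝ E]
    (β : ℝ) (v : ℝ → E) (d : E) (t : ℝ) : Prop :=
  (β = 1 ∧ HasDerivAt v d t) ∨
  (β < 1 ∧ ∃ d' : E, HasDerivAt (fun s => ∫ τ in (0 : ℝ)..s, (s - τ) ^ (-β) • v τ) d' t ∧
    d = (Real.Gamma (1 - β))⁻¹ • (d' - (t ^ β)⁻¹ • v 0))

open Classical in
/-- The class in `L²(P)` of a square-integrable random variable. -/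
def toL2 {Ω : Type*} [MeasurableSpace Ω] (P : Measure Ω) (X : Ω → ℝ) : Lp ℝ 2 P :=
  if h : MemLp X 2 P then h.toLp X else 0

/-- The Fourier symbol `|s| ^ α (1 + s²) ^ (γ/2)` of `(I - Δ) ^ (γ/2) (-Δ) ^ (α/2)`, which is the
inverse of the product of the symbols of the Riesz and Bessel potentials. -/
def symbol (α γ s : ℝ) : ℝ := |s| ^ α * (1 + s ^ 2) ^ (γ / 2)

/-- For random fields `η`, `ζ` on `ℝ` that are linear functionals of `ξ`:
`ζ = (I - Δ) ^ (γ/2) (-Δ) ^ (α/2) η` in the mean-square sense, i.e.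
`η(x) = ∫ exp(i s x) g(s) Z(ds)` and `ζ(x) = ∫ exp(i s x) symbol(s) g(s) Z(ds)`. -/
def IsRieszBesselImage {Ω : Type*} [MeasurableSpace Ω] (P : Measure Ω) (ξ : ℝ → Ω → ℝ)
    (f : ℝ → ℝ) (α γ : ℝ) (η ζ : ℝ → Ω → ℝ) : Prop :=
  ∃ g : ℝ → ℂ, ∀ x : ℝ,
    IsSpectralIntegral P ξ f (fun s => character x s * g s) (η x) ∧
    IsSpectralIntegral P ξ f (fun s => character x s * ((symbol α γ s : ℂ) * g s)) (ζ x)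

/-- `u(t, x)`, `t ≥ 0`, is a mean-square solution of
`∂^β u / ∂t^β = -μ (I - Δ) ^ (γ/2) (-Δ) ^ (α/2) u` for `t > 0`, with `u(0, x) = ξ(x)`,
where `ξ` has the spectral density `f`. -/
structure IsMeanSquareSolution {Ω : Type*} [MeasurableSpace Ω] (P : Measure Ω)
    (ξ : ℝ → Ω → ℝ) (f : ℝ → ℝ) (α β γ μ : ℝ) (u : ℝ → ℝ → Ω → ℝ) : Prop where
  memLp : ∀ t x, 0 ≤ t → MemLp (u t x) 2 P
  initial : ∀ x, ∀ᵐ ω ∂P, u 0 x ω = ξ x ω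
  continuous : ∀ x, ContinuousOn (fun t => toL2 P (u t x)) (Set.Ici 0)
  equation : ∀ t, 0 < t → ∃ ζ : ℝ → Ω → ℝ,
    IsRieszBesselImage P ξ f α γ (u t) ζ ∧
    ∀ x, HasFractionalDerivAt β (fun τ => toL2 P (u τ x)) (-μ • toL2 P (ζ x)) t

/-- The rescaled field
`ε ^ (-κ₀β/(2α)) L₀(ε ^ (-β/α)) ^ (-1/2) u(t / ε, x / ε ^ (β/α))`. -/
def rescaled {Ω : Type*} (α β κ₀ : ℝ) (L₀ : ℝ → ℝ) (u : ℝ → ℝ → Ω → ℝ)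
    (ε t x : ℝ) (ω : Ω) : ℝ :=
  ε ^ (-(κ₀ * β / (2 * α))) / √(L₀ (ε ^ (-(β / α)))) * u (t / ε) (x / ε ^ (β / α)) ω

/-- The integrand of the limit field,
`(c₂(κ₀) A₀ / 2) ^ (1/2) exp(i s x) E_β(-μ |s| ^ α t ^ β) / |s| ^ ((1 - κ₀)/2)`. -/
def limitKernel (α β μ κ₀ A₀ t x s : ℝ) : ℂ :=
  (√(c2 0 κ₀ * A₀ / 2) : ℂ) * (character x s *
    ((mittagLefflerE β (-μ * |s| ^ α * t ^ β) / |s| ^ ((1 - κ₀) / 2) : ℝ) : ℂ))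

end RieszBessel

end

noncomputable section

namespace RieszBessel

/-! ### The Mittag-Leffler series -/

/-! In the spectral domain the equation becomes, frequency by frequency, a fractional relaxation
equation, so with `σ = symbol α γ` the solution must be `u(t,x) = ∫ e^{iλx} E_β(-μ σ(λ) t^β) Z(dλ)`.
It lies in the closed linear span of the centered Gaussian process `ξ`, and the limit field in that
of `W`. All vectors involved are therefore centered Gaussian, and convergence of covariances is
enough.

Put `δ = ε^{β/α}`. A covariance of the rescaled field is `δ^{-κ₀} / L₀(1/δ)` times the integral of
`f(s) e^{is(x₁-x₂)/δ}` against two relaxation factors evaluated at `σ(s) δ^{-α}`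
(`integral_rescaled_mul`). After `s = δr` one has `σ(δr) δ^{-α} = |r|^α (1 + δ²r²)^{γ/2} → |r|^α`,
so the Bessel operator disappears. Near zero `f` is its `j = 0` term up to a bounded function
(`modulatedDensity_local`). Slow variation turns that term into a multiple of `|r|^{κ₀-1}`, while
everything else is of order `δ^{p-κ₀} / L₀(1/δ)` for some `p > κ₀` and vanishes
(`tendsto_scaled_integral`). The limit is the covariance computed in `integral_limit_mul`.

Three ingredients carry this. The first is the bound `0 < E_β(-s) ≤ 1 / (1 + s/Γ(1+β))` for `s ≥ 0`,
obtained from a positivity principle for Volterra equations (`pos_of_volterra`). Two such factors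
decay like `|r|^{-2α}`, which is where `α > κ₀/2` enters; with Potter's bounds for `L₀` this gives
an integrable majorant.

The second is the identification of an arbitrary mean-square solution
(`IsMeanSquareSolution.mem_graph`). The integrands `g_t` are given separately for each `t`, so no
equation can be solved pointwise in `λ`. Instead `g_t` is paired with test functions supported where
`σ` is bounded; the pairings with `σ^k φ` form a hierarchy of scalar fractional equations, summed by
`hasSum_of_hasFractionalDerivAt`.

The third is the isometry between integrands and integrals (`IsIsometricFamily`), under which inner
products and Gaussian characteristic functions pass to mean-square limits. -/

lemma rpow_mul_exp_le_Gamma {T x : ℝ} (hT : 0 < T) (hx : 0 ≤ x) :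
    T ^ x * Real.exp (-(T + 1)) ≤ Real.Gamma (1 + x) := by
  rw [Real.Gamma_eq_integral (by linarith)]
  have hint : IntegrableOn (fun y : ℝ => Real.exp (-y) * y ^ (1 + x - 1)) (Set.Ioi 0) :=
    Real.GammaIntegral_convergent (by linarith)
  -- Of the Gamma integral only `(T, T + 1]` is kept, where `y^x ≥ T^x` and `e^{-y} ≥ e^{-(T+1)}`.
  have hsub : Set.Ioc T (T + 1) ⊆ Set.Ioi 0 := fun y hy => hT.trans hy.1
  calc T ^ x * Real.exp (-(T + 1))
      = ∫ _ in Set.Ioc T (T + 1), T ^ x * Real.exp (-(T + 1)) := by simp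
    _ ≤ ∫ y in Set.Ioc T (T + 1), Real.exp (-y) * y ^ (1 + x - 1) := by
        refine setIntegral_mono_on (integrableOn_const (by simp)) (hint.mono_set hsub) measurableSet_Ioc
          fun y hy => ?_
        rw [mul_comm, add_sub_cancel_left]
        have h1 := hy.1
        have h2 := hy.2
        gcongr
    _ ≤ ∫ y in Set.Ioi 0, Real.exp (-y) * y ^ (1 + x - 1) := by
        refine setIntegral_mono_set hint ?_ hsub.eventuallyLE
        refine (ae_restrict_mem measurableSet_Ioi).mono fun y hy => ?_
        have : (0 : ℝ) < y := hy
        positivity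

lemma Gamma_one_add_pos {β : ℝ} (hβ : 0 < β) (k : ℕ) : 0 < Real.Gamma (1 + β * k) :=
  Real.Gamma_pos_of_pos (by positivity)

lemma summable_mittagLeffler {β : ℝ} (hβ : 0 < β) (s : ℝ) :
    Summable fun k : ℕ => s ^ k / Real.Gamma (1 + β * k) := by
  set r : ℝ := 2 * (|s| + 1) with hr
  have hr0 : 0 < r := by positivity
  -- With `T^β = 2(|s| + 1)` the Gamma bound makes the `k`-th term at most a constant times
  -- `2^{-k}`.
  set T : ℝ := r ^ β⁻¹
  have hT : 0 < T := Real.rpow_pos_of_pos hr0 _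
  have hTβ : T ^ β = r := by rw [← Real.rpow_mul hr0.le, inv_mul_cancel₀ hβ.ne', Real.rpow_one]
  refine Summable.of_norm_bounded (g := fun k : ℕ => Real.exp (T + 1) * (1 / 2 : ℝ) ^ k)
    ((summable_geometric_of_lt_one (by norm_num) (by norm_num)).mul_left _) fun k => ?_
  have h1 := rpow_mul_exp_le_Gamma (x := β * k) hT (by positivity)
  rw [Real.rpow_mul hT.le, hTβ, Real.rpow_natCast] at h1
  rw [norm_div, norm_pow, Real.norm_eq_abs, Real.norm_of_nonneg (Gamma_one_add_pos hβ k).le,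
    div_le_iff₀ (Gamma_one_add_pos hβ k)]
  have h2 : |s| ^ k ≤ (1 / 2 : ℝ) ^ k * r ^ k := by
    rw [← mul_pow]
    gcongr
    rw [hr]; linarith
  calc |s| ^ k ≤ (1 / 2 : ℝ) ^ k * r ^ k := h2
    _ = Real.exp (T + 1) * (1 / 2) ^ k * (r ^ k * Real.exp (-(T + 1))) := by
        rw [Real.exp_neg]; field_simp
    _ ≤ _ := by gcongr

lemma hasSum_mittagLefflerE {β : ℝ} (hβ : 0 < β) (s : ℝ) :
    HasSum (fun k : ℕ => s ^ k / Real.Gamma (1 + β * k)) (mittagLefflerE β s) :=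
  (summable_mittagLeffler hβ s).hasSum

lemma continuous_mittagLefflerE {β : ℝ} (hβ : 0 < β) : Continuous (mittagLefflerE β) := by
  rw [continuous_iff_continuousAt]
  intro s
  have : ContinuousOn (mittagLefflerE β) (Set.Ioo (-(|s| + 1)) (|s| + 1)) := by
    refine continuousOn_tsum (fun k => by fun_prop) (summable_mittagLeffler hβ (|s| + 1)) ?_
    intro k x hx
    rw [norm_div, norm_pow, Real.norm_of_nonneg (Gamma_one_add_pos hβ k).le, Real.norm_eq_abs]
    have := Gamma_one_add_pos hβ k
    have := abs_lt.2 hx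
    gcongr
  refine this.continuousAt (Ioo_mem_nhds ?_ ?_)
  · linarith [neg_abs_le s]
  · linarith [le_abs_self s]

lemma mittagLefflerE_zero (β : ℝ) : mittagLefflerE β 0 = 1 := by
  rw [mittagLefflerE, tsum_eq_single 0]
  · simp
  · intro k hk; simp [hk]

/-! ### Fractional integrals -/

/-- The Riemann-Liouville fractional integral of order `a`. -/
def fracInt (a : ℝ) (h : ℝ → ℝ) (t : ℝ) : ℝ :=
  (Real.Gamma a)⁻¹ * ∫ τ in (0 : ℝ)..t, (t - τ) ^ (a - 1) * h τ

lemma intervalIntegrable_sub_rpow {a : ℝ} (ha : 0 < a) (c s t : ℝ) :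
    IntervalIntegrable (fun τ => (c - τ) ^ (a - 1)) volume s t := by
  have := (intervalIntegral.intervalIntegrable_rpow' (a := c - s) (b := c - t)
    (r := a - 1) (by linarith)).comp_sub_left c
  simpa using this

lemma intervalIntegrable_sub_rpow_mul {a : ℝ} (ha : 0 < a) {h : ℝ → ℝ} (hh : Continuous h)
    (c s t : ℝ) : IntervalIntegrable (fun τ => (c - τ) ^ (a - 1) * h τ) volume s t :=
  (intervalIntegrable_sub_rpow ha c s t).mul_continuousOn hh.continuousOn

lemma integral_sub_rpow {a : ℝ} (ha : 0 < a) (c s : ℝ) :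
    ∫ τ in s..c, (c - τ) ^ (a - 1) = (c - s) ^ a / a := by
  rw [intervalIntegral.integral_comp_sub_left (fun x => x ^ (a - 1)) c,
    integral_rpow (Or.inl (by linarith))]
  simp [Real.zero_rpow ha.ne']

/-- Rescaling to `[0, 1]` removes `t` from the endpoint and from the singular kernel, so that
continuity in `t` follows by dominated convergence. -/
lemma fracInt_eq_scaled {a : ℝ} (ha : 0 < a) (h : ℝ → ℝ) {t : ℝ} (ht : 0 ≤ t) :
    fracInt a h t =
      (Real.Gamma a)⁻¹ * (t ^ a * ∫ u in (0 : ℝ)..1, (1 - u) ^ (a - 1) * h (t * u)) := by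
  rw [fracInt]
  congr 1
  rcases ht.eq_or_lt with rfl | ht
  · simp [Real.zero_rpow ha.ne']
  have h1 := intervalIntegral.integral_comp_mul_left (a := 0) (b := 1)
    (fun τ => (t - τ) ^ (a - 1) * h τ) ht.ne'
  rw [mul_zero, mul_one, smul_eq_mul, eq_inv_mul_iff_mul_eq₀ ht.ne'] at h1
  rw [← h1, ← intervalIntegral.integral_const_mul, ← intervalIntegral.integral_const_mul]
  refine intervalIntegral.integral_congr fun u hu => ?_
  rw [Set.uIcc_of_le zero_le_one] at hu
  rw [show t - t * u = t * (1 - u) by ring, Real.mul_rpow ht.le (by linarith [hu.2]),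
    Real.rpow_sub_one ht.ne']
  field_simp

lemma continuousOn_fracInt {a : ℝ} (ha : 0 < a) {h : ℝ → ℝ} (hh : Continuous h) :
    ContinuousOn (fracInt a h) (Set.Ici 0) := by
  have key : Continuous fun t : ℝ => ∫ u in (0 : ℝ)..1, (1 - u) ^ (a - 1) * h (t * u) := by
    rw [continuous_iff_continuousAt]
    intro t₀
    obtain ⟨C, hC⟩ := (isCompact_Icc (a := -(|t₀| + 1)) (b := |t₀| + 1)).exists_bound_of_continuousOn
      hh.continuousOn
    refine intervalIntegral.continuousAt_of_dominated_interval
      (bound := fun u => (1 - u) ^ (a - 1) * C) ?_ ?_ ?_ ?_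
    · refine Eventually.of_forall fun t => ?_
      exact (Measurable.aestronglyMeasurable (by fun_prop))
    · have : Set.Ioo (-(|t₀| + 1)) (|t₀| + 1) ∈ 𝓝 t₀ :=
        Ioo_mem_nhds (by linarith [neg_abs_le t₀]) (by linarith [le_abs_self t₀])
      filter_upwards [this] with t ht
      refine Eventually.of_forall fun u hu => ?_
      rw [Set.uIoc_of_le zero_le_one] at hu
      have h1 : 0 ≤ (1 - u) ^ (a - 1) := Real.rpow_nonneg (by linarith [hu.2]) _
      rw [norm_mul, Real.norm_of_nonneg h1]
      refine mul_le_mul_of_nonneg_left (hC _ ?_) h1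
      have h3 : |t * u| ≤ |t₀| + 1 := by
        rw [abs_mul, abs_of_pos hu.1]
        have := (abs_lt.2 ht).le
        nlinarith [abs_nonneg t, hu.1, hu.2]
      exact ⟨(abs_le.1 h3).1, (abs_le.1 h3).2⟩
    · exact (intervalIntegrable_sub_rpow ha 1 0 1).mul_const C
    · exact Eventually.of_forall fun u _ => by fun_prop
  have h2 : Continuous fun t : ℝ => (Real.Gamma a)⁻¹ *
      (t ^ a * ∫ u in (0 : ℝ)..1, (1 - u) ^ (a - 1) * h (t * u)) :=
    continuous_const.mul ((Real.continuous_rpow_const ha.le).mul key)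
  exact h2.continuousOn.congr fun t ht => fracInt_eq_scaled ha h ht

lemma integral_rpow_mul_sub_rpow {a b c : ℝ} (ha : 0 < a) (hb : 0 < b) (hc : 0 < c) :
    ∫ x in (0 : ℝ)..c, x ^ (b - 1) * (c - x) ^ (a - 1) =
      c ^ (a + b - 1) * (Real.Gamma a * Real.Gamma b / Real.Gamma (a + b)) := by
  have h1 := Complex.betaIntegral_scaled (b : ℂ) (a : ℂ) hc
  rw [Complex.betaIntegral_eq_Gamma_mul_div _ _ (by simpa) (by simpa)] at h1
  have h2 : (∫ x in (0 : ℝ)..c, (x : ℂ) ^ ((b : ℂ) - 1) * ((c : ℂ) - x) ^ ((a : ℂ) - 1)) =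
      ((∫ x in (0 : ℝ)..c, x ^ (b - 1) * (c - x) ^ (a - 1) : ℝ) : ℂ) := by
    rw [← intervalIntegral.integral_ofReal]
    refine intervalIntegral.integral_congr fun x hx => ?_
    rw [Set.uIcc_of_le hc.le] at hx
    rw [Complex.ofReal_mul, Complex.ofReal_cpow hx.1, Complex.ofReal_cpow (by linarith [hx.2])]
    push_cast
    rfl
  rw [h2] at h1
  apply_fun Complex.re at h1
  rw [Complex.ofReal_re] at h1
  rw [h1, ← Complex.ofReal_add, Complex.Gamma_ofReal, Complex.Gamma_ofReal, Complex.Gamma_ofReal,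
    ← Complex.ofReal_one, ← Complex.ofReal_sub, ← Complex.ofReal_cpow hc.le, ← Complex.ofReal_mul,
    ← Complex.ofReal_div, ← Complex.ofReal_mul, Complex.ofReal_re]
  ring_nf

lemma fracInt_rpow {a p : ℝ} (ha : 0 < a) (hp : 0 ≤ p) {t : ℝ} (ht : 0 ≤ t) :
    fracInt a (fun τ => τ ^ p) t = Real.Gamma (1 + p) / Real.Gamma (1 + (p + a)) * t ^ (p + a) := by
  rw [fracInt]
  rcases ht.eq_or_lt with rfl | ht
  · simp [Real.zero_rpow (by positivity : p + a ≠ 0)]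
  have h1 := integral_rpow_mul_sub_rpow (b := p + 1) ha (by linarith) ht
  rw [add_sub_cancel_right] at h1
  simp_rw [mul_comm _ (_ ^ p)]
  rw [h1, show a + (p + 1) - 1 = p + a by ring, show a + (p + 1) = 1 + (p + a) by ring,
    add_comm p 1]
  have := (Real.Gamma_pos_of_pos ha).ne'
  field_simp

lemma fracInt_mono {a : ℝ} (ha : 0 < a) {g h : ℝ → ℝ} (hg : Continuous g) (hh : Continuous h)
    {t : ℝ} (ht : 0 ≤ t) (hgh : ∀ s ∈ Set.Icc 0 t, g s ≤ h s) : fracInt a g t ≤ fracInt a h t := by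
  have := Real.Gamma_pos_of_pos ha
  rw [fracInt, fracInt]
  gcongr
  refine intervalIntegral.integral_mono_on ht (intervalIntegrable_sub_rpow_mul ha hg _ _ _)
    (intervalIntegrable_sub_rpow_mul ha hh _ _ _) fun s hs => ?_
  exact mul_le_mul_of_nonneg_left (hgh s hs) (Real.rpow_nonneg (by linarith [hs.2]) _)

lemma fracInt_add {a : ℝ} (ha : 0 < a) {g h : ℝ → ℝ} (hg : Continuous g) (hh : Continuous h)
    (t : ℝ) : fracInt a (fun s => g s + h s) t = fracInt a g t + fracInt a h t := by
  simp_rw [fracInt, mul_add]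
  rw [intervalIntegral.integral_add (intervalIntegrable_sub_rpow_mul ha hg _ _ _)
    (intervalIntegrable_sub_rpow_mul ha hh _ _ _), mul_add]

lemma fracInt_const_mul (a c : ℝ) (h : ℝ → ℝ) (t : ℝ) :
    fracInt a (fun s => c * h s) t = c * fracInt a h t := by
  simp_rw [fracInt, mul_left_comm _ c]
  rw [intervalIntegral.integral_const_mul]
  ring

lemma fracInt_congr (a : ℝ) {g h : ℝ → ℝ} {t : ℝ} (ht : 0 ≤ t) (hgh : ∀ s ∈ Set.Icc 0 t, g s = h s) :
    fracInt a g t = fracInt a h t := by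
  rw [fracInt, fracInt]
  congr 1
  refine intervalIntegral.integral_congr fun s hs => ?_
  rw [Set.uIcc_of_le ht] at hs
  simp only [hgh s hs]

lemma fracInt_one (h : ℝ → ℝ) (t : ℝ) : fracInt 1 h t = ∫ τ in (0 : ℝ)..t, h τ := by
  simp [fracInt]

lemma integral_sub_rpow_mul_sub_rpow {a b r t : ℝ} (ha : 0 < a) (hb : 0 < b) (hrt : r < t) :
    ∫ s in r..t, (t - s) ^ (a - 1) * (s - r) ^ (b - 1) =
      (t - r) ^ (a + b - 1) * (Real.Gamma a * Real.Gamma b / Real.Gamma (a + b)) := by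
  rw [← integral_rpow_mul_sub_rpow ha hb (sub_pos.2 hrt)]
  have := intervalIntegral.integral_comp_sub_right (a := r) (b := t)
    (fun x => x ^ (b - 1) * (t - r - x) ^ (a - 1)) r
  rw [sub_self] at this
  rw [← this]
  refine intervalIntegral.integral_congr fun s _ => ?_
  simp only [sub_sub_sub_cancel_right]
  ring

/-- The integrand of the iterated fractional integral on the square. -/
def fracIntKernel (a b : ℝ) (h : ℝ → ℝ) (t : ℝ) (p : ℝ × ℝ) : ℝ :=
  (t - p.1) ^ (a - 1) * {q : ℝ × ℝ | q.2 ≤ q.1}.indicator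
    (fun q => (q.1 - q.2) ^ (b - 1) * h q.2) p

lemma fracIntKernel_eq_left (a b : ℝ) (h : ℝ → ℝ) (t s : ℝ) :
    (fun r => fracIntKernel a b h t (s, r)) =
      (Set.Iic s).indicator fun r => (t - s) ^ (a - 1) * ((s - r) ^ (b - 1) * h r) := by
  ext r
  by_cases hr : r ≤ s <;> simp [fracIntKernel, Set.indicator, hr]

lemma fracIntKernel_eq_right (a b : ℝ) (h : ℝ → ℝ) (t r : ℝ) :
    (fun s => fracIntKernel a b h t (s, r)) =
      (Set.Ici r).indicator fun s => (t - s) ^ (a - 1) * (s - r) ^ (b - 1) * h r := by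
  ext s
  by_cases hr : r ≤ s <;> simp [fracIntKernel, Set.indicator, hr, mul_assoc]

lemma setIntegral_fracIntKernel_left (a b : ℝ) (h : ℝ → ℝ) {t s : ℝ} (hs : s ∈ Set.Ioc 0 t) :
    ∫ r in Set.Ioc 0 t, fracIntKernel a b h t (s, r) =
      (t - s) ^ (a - 1) * ∫ r in (0 : ℝ)..s, (s - r) ^ (b - 1) * h r := by
  rw [fracIntKernel_eq_left, setIntegral_indicator measurableSet_Iic, Set.Ioc_inter_Iic,
    min_eq_right hs.2, integral_const_mul, intervalIntegral.integral_of_le hs.1.le]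

lemma setIntegral_fracIntKernel_right {a b : ℝ} (ha : 0 < a) (hb : 0 < b) (h : ℝ → ℝ) {t r : ℝ}
    (hr : r ∈ Set.Ioo 0 t) :
    ∫ s in Set.Ioc 0 t, fracIntKernel a b h t (s, r) =
      Real.Gamma a * Real.Gamma b / Real.Gamma (a + b) * ((t - r) ^ (a + b - 1) * h r) := by
  have h1 : Set.Ioc 0 t ∩ Set.Ici r = Set.Icc r t := by
    ext s
    simp only [Set.mem_inter_iff, Set.mem_Ioc, Set.mem_Ici, Set.mem_Icc]
    constructor
    · rintro ⟨h1, h2⟩; exact ⟨h2, h1.2⟩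
    · rintro ⟨h1, h2⟩; exact ⟨⟨hr.1.trans_le h1, h2⟩, h1⟩
  rw [fracIntKernel_eq_right, setIntegral_indicator measurableSet_Ici, h1,
    integral_Icc_eq_integral_Ioc, integral_mul_const, ← intervalIntegral.integral_of_le hr.2.le,
    integral_sub_rpow_mul_sub_rpow ha hb hr.2]
  ring

/-- Bounding `h` on `[0, t]` by a constant leaves a product of powers whose iterated integral is
explicit; this justifies Fubini for the semigroup property. -/
lemma integrable_fracIntKernel {a b : ℝ} (ha : 0 < a) (hb : 0 < b) {h : ℝ → ℝ}
    (hh : Continuous h) {t : ℝ} (ht : 0 ≤ t) :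
    Integrable (fracIntKernel a b h t)
      ((volume.restrict (Set.Ioc 0 t)).prod (volume.restrict (Set.Ioc 0 t))) := by
  have hm : Measurable (fracIntKernel a b h t) := by
    have := hh.measurable
    refine Measurable.mul (by fun_prop) (Measurable.indicator (by fun_prop) ?_)
    exact measurableSet_le measurable_snd measurable_fst
  obtain ⟨C, hC⟩ := (isCompact_Icc (a := 0) (b := t)).exists_bound_of_continuousOn
    hh.continuousOn
  have hC0 : 0 ≤ C := (norm_nonneg _).trans (hC 0 ⟨le_rfl, ht⟩)
  have hleft : ∀ s ∈ Set.Ioc 0 t, IntegrableOn (fun r => fracIntKernel a b h t (s, r))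
      (Set.Ioc 0 t) := by
    intro s hs
    rw [fracIntKernel_eq_left, integrableOn_indicator_iff measurableSet_Iic, Set.inter_comm,
      Set.Ioc_inter_Iic, min_eq_right hs.2]
    exact ((intervalIntegrable_sub_rpow_mul hb hh s 0 s).const_mul _).1
  rw [integrable_prod_iff hm.aestronglyMeasurable]
  refine ⟨(ae_restrict_mem measurableSet_Ioc).mono hleft, ?_⟩
  refine Integrable.mono' (g := fun s => (t - s) ^ (a - 1) * (C * (t ^ b / b)))
    ((intervalIntegrable_sub_rpow ha t 0 t).mul_const _).1
    hm.aestronglyMeasurable.norm.integral_prod_right' ?_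
  refine (ae_restrict_mem measurableSet_Ioc).mono fun s hs => ?_
  have hts : 0 ≤ (t - s) ^ (a - 1) := Real.rpow_nonneg (by linarith [hs.2]) _
  rw [Real.norm_of_nonneg (integral_nonneg fun _ => norm_nonneg _)]
  calc ∫ r in Set.Ioc 0 t, ‖fracIntKernel a b h t (s, r)‖
      ≤ ∫ r in Set.Ioc 0 t, (Set.Iic s).indicator
          (fun r => (t - s) ^ (a - 1) * ((s - r) ^ (b - 1) * C)) r := by
        refine setIntegral_mono_on (hleft s hs).norm ?_ measurableSet_Ioc fun r hr => ?_
        · rw [integrableOn_indicator_iff measurableSet_Iic, Set.inter_comm,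
            Set.Ioc_inter_Iic, min_eq_right hs.2]
          exact (((intervalIntegrable_sub_rpow hb s 0 s).mul_const C).const_mul _).1
        · rw [congrFun (fracIntKernel_eq_left a b h t s) r, norm_indicator_eq_indicator_norm]
          refine Set.indicator_le_indicator' fun hrs => ?_
          have hsr : 0 ≤ (s - r) ^ (b - 1) := Real.rpow_nonneg (sub_nonneg.2 hrs) _
          rw [norm_mul, norm_mul, Real.norm_of_nonneg hts, Real.norm_of_nonneg hsr]
          have := hC r ⟨hr.1.le, hr.2⟩
          gcongr
    _ = (t - s) ^ (a - 1) * ((s ^ b / b) * C) := by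
        rw [setIntegral_indicator measurableSet_Iic, Set.Ioc_inter_Iic, min_eq_right hs.2,
          integral_const_mul, integral_mul_const, ← intervalIntegral.integral_of_le hs.1.le,
          integral_sub_rpow hb, sub_zero]
    _ ≤ (t - s) ^ (a - 1) * (C * (t ^ b / b)) := by
        rw [mul_comm C]
        have := hs.1.le
        have := hs.2
        gcongr

/-- The semigroup property of fractional integrals. -/
lemma fracInt_fracInt {a b : ℝ} (ha : 0 < a) (hb : 0 < b) {h : ℝ → ℝ} (hh : Continuous h)
    {t : ℝ} (ht : 0 ≤ t) : fracInt a (fracInt b h) t = fracInt (a + b) h t := by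
  -- On the triangle `r ≤ s`, integrating in `r` first gives the iterated fractional integral;
  -- integrating in `s` first gives a Beta integral times the kernel of order `a + b`.
  have hswap : ∫ s in Set.Ioc 0 t, ∫ r in Set.Ioc 0 t, fracIntKernel a b h t (s, r) =
      ∫ r in Set.Ioc 0 t, ∫ s in Set.Ioc 0 t, fracIntKernel a b h t (s, r) :=
    integral_integral_swap (integrable_fracIntKernel ha hb hh ht)
  rw [setIntegral_congr_fun measurableSet_Ioc
    fun s hs => setIntegral_fracIntKernel_left a b h hs] at hswap
  have h2 : ∫ r in Set.Ioc 0 t, ∫ s in Set.Ioc 0 t, fracIntKernel a b h t (s, r) =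
      Real.Gamma a * Real.Gamma b / Real.Gamma (a + b) *
        ∫ r in (0 : ℝ)..t, (t - r) ^ (a + b - 1) * h r := by
    rw [integral_Ioc_eq_integral_Ioo, setIntegral_congr_fun measurableSet_Ioo
      fun r hr => setIntegral_fracIntKernel_right ha hb h hr, integral_const_mul,
      ← integral_Ioc_eq_integral_Ioo, intervalIntegral.integral_of_le ht]
  rw [h2] at hswap
  have ha' := (Real.Gamma_pos_of_pos ha).ne'
  have hb' := (Real.Gamma_pos_of_pos hb).ne'
  have hab' := (Real.Gamma_pos_of_pos (add_pos ha hb)).ne'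
  simp_rw [fracInt, mul_left_comm _ (Real.Gamma b)⁻¹]
  rw [intervalIntegral.integral_const_mul, intervalIntegral.integral_of_le ht, hswap]
  field_simp

lemma fracInt_comm {a b : ℝ} (ha : 0 < a) (hb : 0 < b) {h : ℝ → ℝ} (hh : Continuous h)
    {t : ℝ} (ht : 0 ≤ t) : fracInt a (fracInt b h) t = fracInt b (fracInt a h) t := by
  rw [fracInt_fracInt ha hb hh ht, fracInt_fracInt hb ha hh ht, add_comm]

/-! ### The fractional relaxation equation -/

/-- A fractional integral of order `β` shifts the Mittag-Leffler series by one term, so the partial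
sums satisfy `S (N+1) = 1 - I^β (S N)`. Dominated convergence gives the equation `y = 1 - I^β y`. -/
lemma mittagLefflerE_neg_rpow_eq {β : ℝ} (hβ : 0 < β) {t : ℝ} (ht : 0 ≤ t) :
    mittagLefflerE β (-t ^ β) = 1 - fracInt β (fun s => mittagLefflerE β (-s ^ β)) t := by
  set S : ℕ → ℝ → ℝ := fun N s =>
    ∑ k ∈ Finset.range N, (-s ^ β) ^ k / Real.Gamma (1 + β * k) with hS
  have hcont : Continuous fun s : ℝ => s ^ β := Real.continuous_rpow_const hβ.le
  have hScont : ∀ N, Continuous (S N) := fun N => by fun_prop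
  have hrec : ∀ N, S (N + 1) t = 1 - fracInt β (S N) t := by
    intro N
    induction N with
    | zero => simp [hS, fracInt]
    | succ N ih =>
      have h1 : S (N + 1) = fun s => S N s + (-s ^ β) ^ N / Real.Gamma (1 + β * N) := by
        ext s; simp [hS, Finset.sum_range_succ]
      have h2 : fracInt β (fun s => (-s ^ β) ^ N / Real.Gamma (1 + β * N)) t =
          (-1) ^ N * t ^ (β * N + β) / Real.Gamma (1 + (β * N + β)) := by
        have h3 := fracInt_rpow (p := β * N) hβ (by positivity) ht
        have h4 : fracInt β (fun s => (-s ^ β) ^ N / Real.Gamma (1 + β * N)) t =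
            fracInt β (fun s => (-1) ^ N / Real.Gamma (1 + β * N) * s ^ (β * N)) t := by
          refine fracInt_congr β ht fun s hs => ?_
          rw [neg_pow, ← Real.rpow_natCast (s ^ β), ← Real.rpow_mul hs.1]
          ring
        rw [h4, fracInt_const_mul, h3]
        have := (Gamma_one_add_pos hβ N).ne'
        field_simp
      have h5 : S (N + 2) t = S (N + 1) t +
          (-t ^ β) ^ (N + 1) / Real.Gamma (1 + β * (N + 1 : ℕ)) := by
        simp only [hS]; rw [Finset.sum_range_succ _ (N + 1)]
      rw [h5, ih, h1, fracInt_add hβ (hScont N) (by fun_prop), h2, neg_pow, ← Real.rpow_natCast,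
        ← Real.rpow_natCast (t ^ β), ← Real.rpow_mul ht]
      push_cast
      rw [show β * (N + 1 : ℝ) = β * N + β by ring, Real.rpow_add_one (by norm_num : (-1 : ℝ) ≠ 0),
        Real.rpow_natCast]
      ring
  have hlim : ∀ s, Tendsto (fun N => S N s) atTop (𝓝 (mittagLefflerE β (-s ^ β))) :=
    fun s => (hasSum_mittagLefflerE hβ _).tendsto_sum_nat
  have hint : Tendsto (fun N => fracInt β (S N) t) atTop
      (𝓝 (fracInt β (fun s => mittagLefflerE β (-s ^ β)) t)) := by
    refine Tendsto.const_mul _ ?_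
    refine intervalIntegral.tendsto_integral_filter_of_dominated_convergence
      (fun s => (t - s) ^ (β - 1) * mittagLefflerE β (t ^ β)) ?_ ?_ ?_ ?_
    · exact Eventually.of_forall fun N =>
        (intervalIntegrable_iff.1
          (intervalIntegrable_sub_rpow_mul hβ (hScont N) t 0 t)).aestronglyMeasurable
    · refine Eventually.of_forall fun N => Eventually.of_forall fun s hs => ?_
      rw [Set.uIoc_of_le ht] at hs
      have h1 : 0 ≤ (t - s) ^ (β - 1) := Real.rpow_nonneg (by linarith [hs.2]) _
      rw [norm_mul, Real.norm_of_nonneg h1]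
      refine mul_le_mul_of_nonneg_left ?_ h1
      have h2 : ∀ k : ℕ, 0 ≤ (t ^ β) ^ k / Real.Gamma (1 + β * k) := fun k =>
        div_nonneg (by positivity) (Gamma_one_add_pos hβ k).le
      refine (norm_sum_le _ _).trans (le_trans (Finset.sum_le_sum fun k _ => ?_)
        ((summable_mittagLeffler hβ (t ^ β)).sum_le_tsum (Finset.range N) fun k _ => h2 k))
      have h3 := Gamma_one_add_pos hβ k
      rw [norm_div, norm_pow, norm_neg, Real.norm_of_nonneg h3.le,
        Real.norm_of_nonneg (Real.rpow_nonneg hs.1.le _)]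
      have := hs.1.le
      have := hs.2
      gcongr
    · exact (intervalIntegrable_sub_rpow hβ t 0 t).mul_const _
    · exact Eventually.of_forall fun s _ => (hlim s).const_mul _
  refine tendsto_nhds_unique ((tendsto_add_atTop_iff_nat 1).2 (hlim t)) ?_
  simp_rw [hrec]
  exact tendsto_const_nhds.sub hint

/-- A solution of the Abel-Volterra equation `z + c ∫ (t - s) ^ (β - 1) z = F` is positive if the
forcing term `F` is positive and dominates the kernel in the monotone likelihood ratio order. -/
lemma pos_of_volterra {β c : ℝ} (hβ0 : 0 < β) (hc : 0 < c) {z F : ℝ → ℝ}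
    (hz : Continuous z) (hz0 : 0 < z 0) (hF : ∀ t, 0 ≤ t → 0 < F t)
    (heq : ∀ t, 0 ≤ t → z t + c * ∫ s in (0 : ℝ)..t, (t - s) ^ (β - 1) * z s = F t)
    (hratio : ∀ s t t₀, 0 ≤ s → s < t → t < t₀ →
      (t₀ - s) ^ (β - 1) * F t ≤ (t - s) ^ (β - 1) * F t₀)
    {t : ℝ} (ht : 0 ≤ t) : 0 < z t := by
  -- Let `t₀` be the first zero of `z`. The equation at `t₀` is compared with the one at a slightly
  -- earlier point `t₁`, where `z` is maximal on `[t₀ - δ, t₀]`.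
  by_contra! hneg
  set Z : Set ℝ := Set.Ici 0 ∩ {x | z x ≤ 0} with hZ
  have hZc : IsClosed Z := isClosed_Ici.inter (isClosed_le hz continuous_const)
  have hZb : BddBelow Z := ⟨0, fun x hx => hx.1⟩
  set t₀ := sInf Z with ht₀
  have hmem : t₀ ∈ Z := hZc.csInf_mem ⟨t, ht, hneg⟩ hZb
  have hpos : ∀ s, 0 ≤ s → s < t₀ → 0 < z s := fun s hs hst => by
    by_contra! h
    exact absurd (csInf_le hZb (show s ∈ Z from ⟨hs, h⟩)) (not_le.2 hst)
  have ht₀pos : 0 < t₀ := by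
    rcases (show 0 ≤ t₀ from hmem.1).eq_or_lt with h | h
    · have := hmem.2
      rw [← h] at this
      exact absurd this (not_le.2 hz0)
    · exact h
  have hzt₀ : z t₀ = 0 := by
    refine le_antisymm hmem.2 ?_
    have h1 : Set.Icc 0 t₀ ⊆ {x | 0 ≤ z x} := by
      rw [← closure_Ico ht₀pos.ne]
      exact closure_minimal (fun s hs => (hpos s hs.1 hs.2).le) (isClosed_le continuous_const hz)
    exact h1 ⟨ht₀pos.le, le_rfl⟩
  have hFt₀ := hF t₀ ht₀pos.le
  -- The kernel has mass `δ^β / β` on an interval of length `δ` ending at its singularity. The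
  -- factor `2` pays for `F t₁ ≤ 2 F t₀`, which holds because `t₁ ≥ t₀ / 2`.
  obtain ⟨δ, hδ0, hδt, hδ⟩ : ∃ δ : ℝ, 0 < δ ∧ δ ≤ t₀ / 2 ∧ 2 * c * (δ ^ β / β) < 1 := by
    have h1 : Tendsto (fun δ : ℝ => 2 * c * (δ ^ β / β)) (𝓝[>] 0) (𝓝 0) := by
      have : Continuous fun δ : ℝ => 2 * c * (δ ^ β / β) :=
        continuous_const.mul ((Real.continuous_rpow_const hβ0.le).div_const _)
      have h := (this.tendsto 0).mono_left (nhdsWithin_le_nhds (s := Set.Ioi 0))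
      simpa [Real.zero_rpow hβ0.ne'] using h
    have h2 : ∀ᶠ δ in 𝓝[>] (0 : ℝ), δ ≤ t₀ / 2 :=
      (eventually_le_nhds (by linarith : (0 : ℝ) < t₀ / 2)).filter_mono nhdsWithin_le_nhds
    obtain ⟨δ, h3, h4, h5⟩ := ((h1.eventually (gt_mem_nhds one_pos)).and
      (h2.and self_mem_nhdsWithin)).exists
    exact ⟨δ, h5, h4, h3⟩
  obtain ⟨t₁, ht₁, hmax⟩ := (isCompact_Icc (a := t₀ - δ) (b := t₀)).exists_isMaxOn
    ⟨t₀, by constructor <;> linarith⟩ hz.continuousOn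
  have ht₁0 : t₀ / 2 ≤ t₁ := by linarith [ht₁.1]
  have ht₁pos : 0 < t₁ := by linarith
  have hzt₁ : 0 < z t₁ := (hpos (t₀ - δ) (by linarith) (by linarith)).trans_le
    (hmax ⟨le_rfl, by linarith⟩)
  have ht₁lt : t₁ < t₀ := by
    refine lt_of_le_of_ne ht₁.2 fun h => ?_
    rw [h, hzt₀] at hzt₁
    exact lt_irrefl _ hzt₁
  have hFt₁ := hF t₁ ht₁pos.le
  have hFle : F t₁ ≤ 2 * F t₀ := by
    have h1 := hratio 0 t₁ t₀ le_rfl ht₁pos ht₁lt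
    rw [sub_zero, sub_zero, Real.rpow_sub_one ht₀pos.ne', Real.rpow_sub_one ht₁pos.ne'] at h1
    have h2 : t₁ ^ β ≤ t₀ ^ β := by gcongr
    have h3 : 0 < t₀ ^ β := by positivity
    have h4 : t₀ ^ β * (t₁ * F t₁) ≤ t₀ ^ β * (t₀ * F t₀) := by
      calc t₀ ^ β * (t₁ * F t₁) = t₀ ^ β / t₀ * F t₁ * (t₀ * t₁) := by field_simp
        _ ≤ t₁ ^ β / t₁ * F t₀ * (t₀ * t₁) := by gcongr
        _ = t₁ ^ β * (t₀ * F t₀) := by field_simp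
        _ ≤ _ := by gcongr
    have h5 := le_of_mul_le_mul_left h4 h3
    nlinarith
  have hi := fun c' s t => intervalIntegrable_sub_rpow_mul hβ0 hz c' s t
  have e0 := heq t₀ ht₀pos.le
  have e1 := heq t₁ ht₁pos.le
  rw [hzt₀, zero_add, ← intervalIntegral.integral_add_adjacent_intervals (hi t₀ 0 t₁) (hi t₀ t₁ t₀)]
    at e0
  have b1 : F t₁ * ∫ s in (0 : ℝ)..t₁, (t₀ - s) ^ (β - 1) * z s ≤
      F t₀ * ∫ s in (0 : ℝ)..t₁, (t₁ - s) ^ (β - 1) * z s := by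
    rw [← intervalIntegral.integral_const_mul, ← intervalIntegral.integral_const_mul]
    refine intervalIntegral.integral_mono_on_of_le_Ioo ht₁pos.le ((hi _ _ _).const_mul _)
      ((hi _ _ _).const_mul _) fun s hs => ?_
    have h1 := hratio s t₁ t₀ hs.1.le hs.2 ht₁lt
    have h2 := (hpos s hs.1.le (hs.2.trans ht₁lt)).le
    nlinarith
  have b2 : ∫ s in t₁..t₀, (t₀ - s) ^ (β - 1) * z s ≤ δ ^ β / β * z t₁ := by
    calc ∫ s in t₁..t₀, (t₀ - s) ^ (β - 1) * z s
        ≤ ∫ s in t₁..t₀, (t₀ - s) ^ (β - 1) * z t₁ := by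
          refine intervalIntegral.integral_mono_on ht₁lt.le (hi _ _ _)
            ((intervalIntegrable_sub_rpow hβ0 _ _ _).mul_const _) fun s hs => ?_
          exact mul_le_mul_of_nonneg_left (hmax ⟨ht₁.1.trans hs.1, hs.2⟩)
            (Real.rpow_nonneg (by linarith [hs.2]) _)
      _ = (t₀ - t₁) ^ β / β * z t₁ := by
          rw [intervalIntegral.integral_mul_const, integral_sub_rpow hβ0]
      _ ≤ _ := by
          have : 0 ≤ t₀ - t₁ := by linarith
          have : t₀ - t₁ ≤ δ := by linarith [ht₁.1]
          gcongr
  set I1 := ∫ s in (0 : ℝ)..t₁, (t₀ - s) ^ (β - 1) * z s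
  set I2 := ∫ s in t₁..t₀, (t₀ - s) ^ (β - 1) * z s
  set I3 := ∫ s in (0 : ℝ)..t₁, (t₁ - s) ^ (β - 1) * z s
  -- Multiplying the equation at `t₁` by `F t₀` and the one at `t₀` by `F t₁` gives two expressions
  -- for `F t₀ * F t₁`. The integrals over `[0, t₁]` compare by `hratio`, so `z t₁` is controlled by
  -- the short piece `I2`, which is too small.
  have h1 : F t₀ * z t₁ ≤ c * F t₁ * I2 := by
    have h2 : c * (F t₁ * I1) ≤ c * (F t₀ * I3) := by gcongr
    have h3 : F t₀ * F t₁ = c * (F t₁ * I1) + c * F t₁ * I2 := by rw [← e0]; ring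
    have h4 : F t₀ * F t₁ = F t₀ * z t₁ + c * (F t₀ * I3) := by rw [← e1]; ring
    linarith
  have h5 : c * F t₁ * I2 ≤ c * (2 * F t₀) * (δ ^ β / β * z t₁) := by
    have : 0 ≤ δ ^ β / β * z t₁ := by positivity
    calc c * F t₁ * I2 ≤ c * F t₁ * (δ ^ β / β * z t₁) := by gcongr
      _ ≤ _ := by gcongr
  have h6 : F t₀ * z t₁ * 1 ≤ F t₀ * z t₁ * (2 * c * (δ ^ β / β)) := by
    linarith [h1, h5]
  have := le_of_mul_le_mul_left h6 (by positivity)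
  linarith

section Relaxation

variable {β : ℝ}

lemma continuous_relaxation (hβ : 0 < β) : Continuous fun t : ℝ => mittagLefflerE β (-t ^ β) :=
  (continuous_mittagLefflerE hβ).comp (Real.continuous_rpow_const hβ.le).neg

lemma relaxation_zero (hβ : 0 < β) : mittagLefflerE β (-(0 : ℝ) ^ β) = 1 := by
  rw [Real.zero_rpow hβ.ne', neg_zero, mittagLefflerE_zero]

lemma relaxation_pos (hβ0 : 0 < β) (hβ1 : β ≤ 1) {t : ℝ} (ht : 0 ≤ t) :
    0 < mittagLefflerE β (-t ^ β) := by
  refine pos_of_volterra (z := fun t => mittagLefflerE β (-t ^ β)) (F := fun _ => 1) hβ0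
    (inv_pos.2 (Real.Gamma_pos_of_pos hβ0)) (continuous_relaxation hβ0)
    (by simp [relaxation_zero hβ0]) (by simp) (fun t ht => ?_) (fun s t t₀ hs hst htt => ?_) ht
  · have := mittagLefflerE_neg_rpow_eq hβ0 ht
    rw [fracInt] at this
    linarith
  · rw [mul_one, mul_one]
    exact Real.rpow_le_rpow_of_nonpos (by linarith) (by linarith) (by linarith)

/-- The difference `y(t) - y(t + h)` solves the same Volterra equation, with forcing the part of the
memory integral at `t + h` that comes from `[0, h]`. This forcing is positive because `y` is, and
`pos_of_volterra` applies. -/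
lemma relaxation_antitone (hβ0 : 0 < β) (hβ1 : β ≤ 1) {t h : ℝ} (ht : 0 ≤ t) (hh : 0 < h) :
    mittagLefflerE β (-(t + h) ^ β) < mittagLefflerE β (-t ^ β) := by
  set y : ℝ → ℝ := fun t => mittagLefflerE β (-t ^ β) with hy
  have hyc : Continuous y := continuous_relaxation hβ0
  set c := (Real.Gamma β)⁻¹
  have hc : 0 < c := inv_pos.2 (Real.Gamma_pos_of_pos hβ0)
  have hi := fun c' s t => intervalIntegrable_sub_rpow_mul hβ0 hyc c' s t
  set F : ℝ → ℝ := fun t => c * ∫ s in (0 : ℝ)..h, (t + h - s) ^ (β - 1) * y s with hFdef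
  have hF : ∀ t, 0 ≤ t → 0 < F t := fun t ht => by
    refine mul_pos hc (intervalIntegral.intervalIntegral_pos_of_pos_on (hi _ _ _) ?_ hh)
    exact fun s hs => mul_pos (Real.rpow_pos_of_pos (by linarith [hs.2]) _)
      (relaxation_pos hβ0 hβ1 hs.1.le)
  have heq : ∀ t, 0 ≤ t → (y t - y (t + h)) +
      c * ∫ s in (0 : ℝ)..t, (t - s) ^ (β - 1) * (y s - y (s + h)) = F t := by
    intro t ht
    have h1 : y t = 1 - c * ∫ s in (0 : ℝ)..t, (t - s) ^ (β - 1) * y s :=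
      mittagLefflerE_neg_rpow_eq hβ0 ht
    have h2 : y (t + h) = 1 - c * ∫ s in (0 : ℝ)..(t + h), (t + h - s) ^ (β - 1) * y s :=
      mittagLefflerE_neg_rpow_eq hβ0 (by linarith)
    rw [← intervalIntegral.integral_add_adjacent_intervals (hi _ 0 h) (hi _ h (t + h))] at h2
    have h3 : ∫ s in h..(t + h), (t + h - s) ^ (β - 1) * y s =
        ∫ s in (0 : ℝ)..t, (t - s) ^ (β - 1) * y (s + h) := by
      have := intervalIntegral.integral_comp_add_right (a := 0) (b := t)
        (fun s => (t + h - s) ^ (β - 1) * y s) h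
      rw [zero_add] at this
      rw [← this]
      refine intervalIntegral.integral_congr fun s _ => ?_
      simp
    have h4 : ∫ s in (0 : ℝ)..t, (t - s) ^ (β - 1) * (y s - y (s + h)) =
        (∫ s in (0 : ℝ)..t, (t - s) ^ (β - 1) * y s) -
          ∫ s in (0 : ℝ)..t, (t - s) ^ (β - 1) * y (s + h) := by
      rw [← intervalIntegral.integral_sub (hi _ _ _) (intervalIntegrable_sub_rpow_mul hβ0
        (by fun_prop : Continuous fun s => y (s + h)) _ _ _)]
      simp_rw [mul_sub]
    rw [h4, h1, h2, h3, hFdef]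
    ring
  have hz : Continuous fun t => y t - y (t + h) := by fun_prop
  have := pos_of_volterra hβ0 hc hz ?_ hF heq ?_ ht
  · exact sub_pos.1 this
  · have h1 := heq 0 le_rfl
    rw [intervalIntegral.integral_same, mul_zero, add_zero] at h1
    rw [h1]
    exact hF 0 le_rfl
  · intro s t t₀ hs hst htt
    simp only [hFdef]
    have key : ∀ u v : ℝ, u * (c * ∫ r in (0 : ℝ)..h, (v + h - r) ^ (β - 1) * y r) =
        c * ∫ r in (0 : ℝ)..h, u * ((v + h - r) ^ (β - 1) * y r) := fun u v => by
      rw [intervalIntegral.integral_const_mul, mul_left_comm]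
    rw [key, key]
    refine mul_le_mul_of_nonneg_left ?_ hc.le
    refine intervalIntegral.integral_mono_on hh.le ((hi _ _ _).const_mul _)
      ((hi _ _ _).const_mul _) fun r hr => ?_
    rw [← mul_assoc, ← mul_assoc, ← Real.mul_rpow (by linarith) (by linarith [hr.2]),
      ← Real.mul_rpow (by linarith) (by linarith [hr.2])]
    refine mul_le_mul_of_nonneg_right ?_ (relaxation_pos hβ0 hβ1 hr.1).le
    refine Real.rpow_le_rpow_of_nonpos (mul_pos (by linarith) (by linarith [hr.2])) ?_
      (by linarith)
    -- The difference of the two products is `(t₀ - t) * (s + h - r) ≥ 0`.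
    nlinarith [hr.2]

lemma mittagLefflerE_neg_pos (hβ0 : 0 < β) (hβ1 : β ≤ 1) {s : ℝ} (hs : 0 ≤ s) :
    0 < mittagLefflerE β (-s) := by
  have := relaxation_pos hβ0 hβ1 (Real.rpow_nonneg hs β⁻¹)
  rwa [← Real.rpow_mul hs, inv_mul_cancel₀ hβ0.ne', Real.rpow_one] at this

/-- The hyperbolic bound for the Mittag-Leffler function on the negative half-line. -/
lemma mittagLefflerE_neg_le (hβ0 : 0 < β) (hβ1 : β ≤ 1) {s : ℝ} (hs : 0 ≤ s) :
    mittagLefflerE β (-s) ≤ 1 / (1 + s / Real.Gamma (1 + β)) := by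
  set t := s ^ β⁻¹
  have ht : 0 ≤ t := Real.rpow_nonneg hs _
  have hts : t ^ β = s := by
    rw [← Real.rpow_mul hs, inv_mul_cancel₀ hβ0.ne', Real.rpow_one]
  have hG : 0 < Real.Gamma (1 + β) := Real.Gamma_pos_of_pos (by linarith)
  rw [le_div_iff₀ (by positivity), ← hts]
  have h1 := mittagLefflerE_neg_rpow_eq hβ0 ht
  -- Since the relaxation function `y` decreases, replacing it on `[0, t]` by its final value lowers
  -- the fractional integral to `y(t) t^β / Γ(1+β)`. Inserting this in `y = 1 - I^β y` gives the
  -- bound.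
  have h2 : fracInt β (fun s => mittagLefflerE β (-t ^ β) * s ^ (0 : ℝ)) t ≤
      fracInt β (fun s => mittagLefflerE β (-s ^ β)) t := by
    refine fracInt_mono hβ0 (by simpa using continuous_const) (continuous_relaxation hβ0) ht
      fun s hs => ?_
    rw [Real.rpow_zero, mul_one]
    rcases hs.2.eq_or_lt with rfl | h
    · exact le_rfl
    · have := (relaxation_antitone hβ0 hβ1 hs.1 (sub_pos.2 h)).le
      rwa [add_sub_cancel] at this
  rw [fracInt_const_mul, fracInt_rpow hβ0 le_rfl ht] at h2
  simp only [add_zero, zero_add, Real.Gamma_one] at h2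
  rw [mul_add, mul_one]
  have : mittagLefflerE β (-t ^ β) * (t ^ β / Real.Gamma (1 + β)) =
    mittagLefflerE β (-t ^ β) * (1 / Real.Gamma (1 + β) * t ^ β) := by ring
  linarith

end Relaxation

/-! ### Fractional differential equations -/

/-- Extending a function by its value at `0` to the negative axis makes it continuous on the line
and changes no integral over `[0, t]`. -/
lemma continuous_max_zero {h : ℝ → ℝ} (hh : ContinuousOn h (Set.Ici 0)) :
    Continuous fun t => h (max t 0) :=
  hh.comp_continuous (by fun_prop) fun t => le_max_right t 0

lemma eq_zero_of_integral_eq_zero {φ : ℝ → ℝ} (hφ : ContinuousOn φ (Set.Ici 0))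
    (h0 : ∀ t, 0 ≤ t → ∫ s in (0 : ℝ)..t, φ s = 0) {t : ℝ} (ht : 0 < t) : φ t = 0 := by
  have hc := continuous_max_zero hφ
  have h1 : HasDerivAt (fun t => ∫ s in (0 : ℝ)..t, φ (max s 0)) (φ (max t 0)) t :=
    (hc.integral_hasStrictDerivAt 0 t).hasDerivAt
  have h2 : (fun t => ∫ s in (0 : ℝ)..t, φ (max s 0)) =ᶠ[𝓝 t] fun _ => 0 := by
    filter_upwards [lt_mem_nhds ht] with r hr
    refine Eq.trans (intervalIntegral.integral_congr fun s hs => ?_) (h0 r hr.le)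
    rw [Set.uIcc_of_le hr.le] at hs
    simp only [max_eq_left hs.1]
  have h3 : φ (max t 0) = 0 :=
    (h1.congr_of_eventuallyEq h2.symm).unique (hasDerivAt_const t (0 : ℝ))
  rwa [max_eq_left ht.le] at h3

lemma eq_sub_fracInt_of_continuous {β μ : ℝ} (hβ0 : 0 < β) {h g : ℝ → ℝ}
    (hh : Continuous h) (hg : Continuous g)
    (hode : ∀ t, 0 < t → HasFractionalDerivAt β h (-μ * g t) t) {t : ℝ} (ht : 0 ≤ t) :
    h t = h 0 - μ * fracInt β g t := by
  rcases ht.eq_or_lt with rfl | ht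
  · simp [fracInt]
  rcases eq_or_ne β 1 with rfl | hβ1
  · have hd : ∀ s ∈ Set.Ioo 0 t, HasDerivAt h (-μ * g s) s := fun s hs => by
      rcases hode s hs.1 with h1 | h1
      · exact h1.2
      · exact absurd h1.1 (lt_irrefl _)
    have h2 := intervalIntegral.integral_eq_sub_of_hasDerivAt_of_le ht.le hh.continuousOn hd
      ((continuous_const.mul hg).intervalIntegrable _ _)
    rw [intervalIntegral.integral_const_mul] at h2
    rw [fracInt_one]
    linarith
  have hβ1' : β < 1 := by
    rcases hode t ht with h1 | h1
    · exact absurd h1.1 hβ1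
    · exact h1.1
  have hβ' : 0 < 1 - β := sub_pos.2 hβ1'
  have hG : 0 < Real.Gamma (1 - β) := Real.Gamma_pos_of_pos hβ'
  have hG' : Real.Gamma (1 + (1 - β)) = (1 - β) * Real.Gamma (1 - β) := by
    rw [add_comm, Real.Gamma_add_one hβ'.ne']
  have hhc : Continuous fun s => h s + -h 0 := by fun_prop
  -- The regularizing term of the Caputo derivative is the derivative of `I^{1-β}` of the constant
  -- `h 0`, so the equation says that `I^{1-β}(h - h 0)` has derivative `-μ g`.
  have e1 : ∀ s, 0 ≤ s → fracInt (1 - β) (fun r => h r + -h 0) s =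
      (Real.Gamma (1 - β))⁻¹ * ((∫ τ in (0 : ℝ)..s, (s - τ) ^ (-β) • h τ) -
        h 0 * (s ^ (1 - β) / (1 - β))) := by
    intro s hs
    rw [fracInt_add hβ' hh continuous_const]
    have h1 := fracInt_const_mul (1 - β) (-h 0) (fun r => r ^ (0 : ℝ)) s
    rw [fracInt_rpow hβ' le_rfl hs] at h1
    simp only [Real.rpow_zero, mul_one, add_zero, zero_add, Real.Gamma_one] at h1
    rw [h1, hG', fracInt]
    simp only [smul_eq_mul, show 1 - β - 1 = -β by ring]
    field_simp
    ring
  have e2 : ∀ s, 0 ≤ s → fracInt (1 - β) (fun r => h r + -h 0) s = -μ * fracInt 1 g s := by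
    intro s hs
    have hd : ∀ r ∈ Set.Ioo 0 s,
        HasDerivAt (fracInt (1 - β) (fun r => h r + -h 0)) (-μ * g r) r := by
      intro r hr
      rcases hode r hr.1 with h1 | ⟨-, d', h1, h2⟩
      · exact absurd h1.1 hβ1
      have h3 := ((Real.hasDerivAt_rpow_const (p := 1 - β) (Or.inl hr.1.ne')).div_const
        (1 - β)).const_mul (h 0)
      have h4 := (h1.sub h3).const_mul (Real.Gamma (1 - β))⁻¹
      have h5 : (Real.Gamma (1 - β))⁻¹ *
          (d' - h 0 * ((1 - β) * r ^ (1 - β - 1) / (1 - β))) = -μ * g r := by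
        rw [h2, smul_eq_mul, smul_eq_mul, show 1 - β - 1 = -β by ring, Real.rpow_neg hr.1.le]
        field_simp
      rw [h5] at h4
      refine h4.congr_of_eventuallyEq ?_
      filter_upwards [lt_mem_nhds hr.1] with q hq
      rw [e1 q hq.le]
      rfl
    have h2 := intervalIntegral.integral_eq_sub_of_hasDerivAt_of_le hs
      ((continuousOn_fracInt hβ' hhc).mono Set.Icc_subset_Ici_self) hd
      ((continuous_const.mul hg).intervalIntegrable _ _)
    rw [intervalIntegral.integral_const_mul] at h2
    rw [fracInt_one, h2]
    simp [fracInt]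
  -- Applying `I^β` to `I^{1-β}(h - h 0) = -μ I^1 g` and commuting gives `I^1(h - h 0) = -μ I^1 (I^β
  -- g)`; both integrands are continuous, hence equal.
  have e3 : ∀ s, 0 ≤ s → ∫ r in (0 : ℝ)..s, ((h r + -h 0) + μ * fracInt β g r) = 0 := by
    intro s hs
    have h1 : fracInt 1 (fun r => h r + -h 0) s = -μ * fracInt 1 (fracInt β g) s := by
      rw [← fracInt_comm hβ0 one_pos hg hs, ← fracInt_const_mul]
      rw [show (1 : ℝ) = β + (1 - β) by ring, ← fracInt_fracInt hβ0 hβ' hhc hs]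
      simp only [add_sub_cancel]
      exact fracInt_congr β hs fun r hr => e2 r hr.1
    rw [fracInt_one, fracInt_one] at h1
    have hci : IntervalIntegrable (fracInt β g) volume 0 s :=
      ((continuousOn_fracInt hβ0 hg).mono (by
        rw [Set.uIcc_of_le hs]; exact Set.Icc_subset_Ici_self)).intervalIntegrable
    rw [intervalIntegral.integral_add (hhc.intervalIntegrable _ _) (hci.const_mul _), h1,
      intervalIntegral.integral_const_mul]
    ring
  have e4 : h t + -h 0 + μ * fracInt β g t = 0 := eq_zero_of_integral_eq_zero
    (hhc.continuousOn.add ((continuousOn_fracInt hβ0 hg).const_mul μ)) e3 ht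
  linarith

/-- A fractional differential equation in integrated form. -/
lemma eq_sub_fracInt_of_hasFractionalDerivAt {β μ : ℝ} (hβ0 : 0 < β) {h g : ℝ → ℝ}
    (hh : ContinuousOn h (Set.Ici 0)) (hg : ContinuousOn g (Set.Ici 0))
    (hode : ∀ t, 0 < t → HasFractionalDerivAt β h (-μ * g t) t) {t : ℝ} (ht : 0 ≤ t) :
    h t = h 0 - μ * fracInt β g t := by
  have h1 := eq_sub_fracInt_of_continuous (μ := μ) hβ0 (continuous_max_zero hh)
    (continuous_max_zero hg) (fun s hs => ?_) ht
  · simp only [max_eq_left ht, max_self] at h1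
    rw [h1, fracInt_congr β ht fun s hs => ?_]
    simp only [max_eq_left hs.1]
  · simp only [max_eq_left hs.le]
    have hev : (fun r => h (max r 0)) =ᶠ[𝓝 s] h := by
      filter_upwards [lt_mem_nhds hs] with r hr
      rw [max_eq_left hr.le]
    rcases hode s hs with ⟨h1, h2⟩ | ⟨h1, d', h2, h3⟩
    · exact Or.inl ⟨h1, h2.congr_of_eventuallyEq hev⟩
    · refine Or.inr ⟨h1, d', h2.congr_of_eventuallyEq ?_, by simpa using h3⟩
      filter_upwards [lt_mem_nhds hs] with r hr
      refine intervalIntegral.integral_congr fun q hq => ?_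
      rw [Set.uIcc_of_le hr.le] at hq
      simp only [max_eq_left hq.1]

lemma abs_fracInt_le {a : ℝ} (ha : 0 < a) {g h : ℝ → ℝ} (hg : Continuous g) (hh : Continuous h)
    {t : ℝ} (ht : 0 ≤ t) (hgh : ∀ s ∈ Set.Icc 0 t, |g s| ≤ h s) :
    |fracInt a g t| ≤ fracInt a h t := by
  rw [abs_le]
  constructor
  · have := fracInt_mono ha (hh.neg) hg ht fun s hs => (abs_le.1 (hgh s hs)).1
    have h1 := fracInt_const_mul a (-1) h t
    simp only [neg_mul, one_mul] at h1
    rw [← h1]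
    exact this
  · exact fracInt_mono ha hg hh ht fun s hs => (abs_le.1 (hgh s hs)).2

/-- Iterating `h k = h k 0 - μ I^β (h (k+1))` produces a fractional Taylor polynomial. Its remainder
is an `N`-fold fractional integral of `h (k+N)`, bounded by `C R^{k+N}`; the induction therefore
runs over all `k` at once. -/
lemma abs_sub_sum_le_of_volterra {β μ R C T : ℝ} (hβ : 0 < β) (hμ : 0 ≤ μ) {h : ℕ → ℝ → ℝ}
    (hc : ∀ k, Continuous (h k))
    (heq : ∀ k t, 0 ≤ t → h k t = h k 0 - μ * fracInt β (h (k + 1)) t)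
    (hb : ∀ k, ∀ t ∈ Set.Icc 0 T, |h k t| ≤ C * R ^ k) (N : ℕ) :
    ∀ k, ∀ t ∈ Set.Icc 0 T,
      |h k t - ∑ j ∈ Finset.range N, (-μ) ^ j * h (k + j) 0 / Real.Gamma (1 + β * j) * t ^ (β * j)|
        ≤ C * R ^ k * (μ * R) ^ N / Real.Gamma (1 + β * N) * t ^ (β * N) := by
  induction N with
  | zero => intro k t ht; simpa using hb k t ht
  | succ N ih =>
    intro k t ht
    have hcr : ∀ j : ℕ, Continuous fun s : ℝ => s ^ (β * j) := fun j =>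
      Real.continuous_rpow_const (by positivity)
    have hfr : ∀ (j : ℕ) (c : ℝ), fracInt β (fun s => c / Real.Gamma (1 + β * j) * s ^ (β * j)) t =
        c / Real.Gamma (1 + β * (j + 1 : ℕ)) * t ^ (β * (j + 1 : ℕ)) := fun j c => by
      rw [fracInt_const_mul, fracInt_rpow hβ (by positivity) ht.1]
      push_cast
      rw [show β * (j + 1 : ℝ) = β * j + β by ring]
      have := (Gamma_one_add_pos hβ j).ne'
      field_simp
    have hsum : ∀ M : ℕ, fracInt β (fun s => ∑ j ∈ Finset.range M,
        (-μ) ^ j * h (k + 1 + j) 0 / Real.Gamma (1 + β * j) * s ^ (β * j)) t =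
        ∑ j ∈ Finset.range M, (-μ) ^ j * h (k + 1 + j) 0 / Real.Gamma (1 + β * (j + 1 : ℕ)) *
          t ^ (β * (j + 1 : ℕ)) := by
      intro M
      induction M with
      | zero => simp [fracInt]
      | succ M ihM =>
        simp_rw [Finset.sum_range_succ]
        rw [fracInt_add hβ (by fun_prop) (by fun_prop), ihM, hfr]
    have h1 : h k t - ∑ j ∈ Finset.range (N + 1),
        (-μ) ^ j * h (k + j) 0 / Real.Gamma (1 + β * j) * t ^ (β * j) =
        -μ * fracInt β (fun s => h (k + 1) s + -1 * ∑ j ∈ Finset.range N,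
        (-μ) ^ j * h (k + 1 + j) 0 / Real.Gamma (1 + β * j) * s ^ (β * j)) t := by
      rw [fracInt_add hβ (hc _) (by fun_prop), fracInt_const_mul, hsum, Finset.sum_range_succ',
        heq k t ht.1, mul_add, neg_one_mul, mul_neg, neg_mul, neg_mul, neg_neg, Finset.mul_sum]
      have h2 : ∑ j ∈ Finset.range N, (-μ) ^ (j + 1) * h (k + (j + 1)) 0 /
          Real.Gamma (1 + β * (j + 1 : ℕ)) * t ^ (β * (j + 1 : ℕ)) =
          -∑ j ∈ Finset.range N, μ * ((-μ) ^ j * h (k + 1 + j) 0 /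
            Real.Gamma (1 + β * (j + 1 : ℕ)) * t ^ (β * (j + 1 : ℕ))) := by
        rw [← Finset.sum_neg_distrib]
        refine Finset.sum_congr rfl fun j _ => ?_
        rw [show k + (j + 1) = k + 1 + j by ring]
        ring
      rw [h2]
      simp
      ring
    rw [h1, abs_mul, abs_neg, abs_of_nonneg hμ]
    have h2 := abs_fracInt_le (h := fun s => C * R ^ (k + 1) * (μ * R) ^ N /
      Real.Gamma (1 + β * N) * s ^ (β * N)) hβ
      (g := fun s => h (k + 1) s + -1 * ∑ j ∈ Finset.range N,
        (-μ) ^ j * h (k + 1 + j) 0 / Real.Gamma (1 + β * j) * s ^ (β * j))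
      ((hc _).add (by fun_prop)) (by fun_prop) ht.1 fun s hs => by
        have := ih (k + 1) s ⟨hs.1, hs.2.trans ht.2⟩
        rwa [neg_one_mul, ← sub_eq_add_neg]
    rw [hfr] at h2
    calc _ ≤ μ * _ := mul_le_mul_of_nonneg_left h2 hμ
      _ = _ := by ring

/-- A hierarchy of fractional differential equations is solved by its Mittag-Leffler series. -/
lemma hasSum_of_hasFractionalDerivAt {β μ R : ℝ} (hβ : 0 < β) (hμ : 0 ≤ μ)
    {h : ℕ → ℝ → ℝ} (hc : ∀ k, ContinuousOn (h k) (Set.Ici 0))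
    (hode : ∀ k t, 0 < t → HasFractionalDerivAt β (h k) (-μ * h (k + 1) t) t)
    (hb : ∀ T, ∃ C, ∀ k, ∀ t ∈ Set.Icc 0 T, |h k t| ≤ C * R ^ k) {t : ℝ} (ht : 0 ≤ t) :
    HasSum (fun j : ℕ => (-μ) ^ j * h j 0 / Real.Gamma (1 + β * j) * t ^ (β * j)) (h 0 t) := by
  obtain ⟨C, hC⟩ := hb t
  have hpow : ∀ j : ℕ, t ^ (β * j) = (t ^ β) ^ j := fun j => by
    rw [Real.rpow_mul ht, Real.rpow_natCast]
  have hs0 : Summable fun j : ℕ => C * ((μ * R * t ^ β) ^ j / Real.Gamma (1 + β * j)) :=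
    (summable_mittagLeffler hβ (μ * R * t ^ β)).mul_left C
  have hsum : Summable fun j : ℕ =>
      (-μ) ^ j * h j 0 / Real.Gamma (1 + β * j) * t ^ (β * j) := by
    refine Summable.of_norm_bounded hs0 fun j => ?_
    have h1 := hC j 0 ⟨le_rfl, ht⟩
    have h2 := Gamma_one_add_pos hβ j
    rw [hpow, norm_mul, norm_div, norm_mul, norm_pow, norm_pow, norm_neg,
      Real.norm_of_nonneg hμ, Real.norm_of_nonneg h2.le,
      Real.norm_of_nonneg (Real.rpow_nonneg ht β)]
    calc μ ^ j * ‖h j 0‖ / Real.Gamma (1 + β * j) * (t ^ β) ^ j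
        ≤ μ ^ j * (C * R ^ j) / Real.Gamma (1 + β * j) * (t ^ β) ^ j := by
          gcongr
          exact h1
      _ = _ := by rw [mul_pow, mul_pow]; ring
  rw [hsum.hasSum_iff_tendsto_nat]
  have hkey := abs_sub_sum_le_of_volterra (T := t) (C := C) (R := R) (μ := μ) hβ hμ
    (h := fun k s => h k (max s 0))
    (fun k => continuous_max_zero (hc k)) (fun k s hs => by
      simp only [max_self, max_eq_left hs]
      rw [eq_sub_fracInt_of_hasFractionalDerivAt hβ (hc k) (hc (k + 1)) (hode k) hs]
      congr 2
      exact fracInt_congr β hs fun r hr => by simp only [max_eq_left hr.1])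
    (fun k s hs => by simpa only [max_eq_left hs.1] using hC k s hs)
  rw [tendsto_iff_norm_sub_tendsto_zero]
  -- The remainder is bounded by the `N`-th term of a convergent Mittag-Leffler series.
  refine squeeze_zero (fun _ => norm_nonneg _) (fun N => ?_) hs0.tendsto_atTop_zero
  have h1 := hkey N 0 t ⟨ht, le_rfl⟩
  simp only [max_self, max_eq_left ht, zero_add] at h1
  rw [norm_sub_rev]
  refine h1.trans_eq ?_
  rw [hpow, mul_pow _ (t ^ β)]
  ring

/-! ### Slowly varying functions -/

/-- The uniform convergence theorem in logarithmic scale. -/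
lemma exists_forall_abs_add_sub_le {h : ℝ → ℝ} (hm : Measurable h)
    (hlim : ∀ c : ℝ, Tendsto (fun u => h (u + c) - h u) atTop (𝓝 0)) {η : ℝ} (hη : 0 < η) :
    ∃ u₀ : ℝ, ∀ u, u₀ ≤ u → ∀ c ∈ Set.Icc (0 : ℝ) 1, |h (u + c) - h u| ≤ η := by
  -- `A u` is the set of bad increments; pointwise convergence on a bounded interval makes its
  -- measure tend to `0`.
  set A : ℝ → Set ℝ := fun u => Set.Icc 0 2 ∩ {s | η / 2 ≤ |h (u + s) - h u|} with hA
  have hAm : ∀ u, MeasurableSet (A u) := fun u =>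
    measurableSet_Icc.inter (measurableSet_le measurable_const (by fun_prop))
  have hAlim : Tendsto (fun u => volume (A u)) atTop (𝓝 (volume (∅ : Set ℝ))) := by
    refine tendsto_measure_of_ae_tendsto_indicator atTop MeasurableSet.empty hAm
      (measurableSet_Icc (a := (0 : ℝ)) (b := 2)) (by simp)
      (Eventually.of_forall fun u => Set.inter_subset_left) (Eventually.of_forall fun s => ?_)
    filter_upwards [(hlim s).abs.eventually (gt_mem_nhds
      (show |(0 : ℝ)| < η / 2 by simpa using hη))] with u hu
    simp only [Set.mem_empty_iff_false, iff_false]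
    exact fun hs => not_le.2 hu hs.2
  rw [measure_empty] at hAlim
  obtain ⟨u₀, hu₀⟩ := eventually_atTop.1
    (hAlim.eventually (gt_mem_nhds (show (0 : ℝ≥0∞) < 2⁻¹ by simp)))
  refine ⟨u₀, fun u hu c hc => ?_⟩
  by_contra! hneg
  -- If the increment `c` were bad, any `s` in `[c, 2]` would be bad as seen from `u`, or `s - c`
  -- would be bad as seen from `u + c`. But `[c, 2]` has length at least `1`, and the two bad sets
  -- have total measure less than `1`.
  have hsub : Set.Icc c 2 ⊆ A u ∪ (fun s => s + -c) ⁻¹' (A (u + c)) := by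
    intro s hs
    by_contra hns
    rw [Set.mem_union, not_or] at hns
    have h1 : |h (u + s) - h u| < η / 2 := by
      by_contra! h1
      exact hns.1 ⟨⟨hc.1.trans hs.1, hs.2⟩, h1⟩
    have h2 : |h (u + c + (s + -c)) - h (u + c)| < η / 2 := by
      by_contra! h2
      exact hns.2 ⟨⟨by linarith [hs.1], by linarith [hs.2, hc.1]⟩, h2⟩
    rw [show u + c + (s + -c) = u + s by ring] at h2
    have h3 : |h (u + c) - h u| ≤ |h (u + s) - h u| + |h (u + s) - h (u + c)| := by
      rw [abs_sub_comm (h (u + s)) (h (u + c)), add_comm |h (u + s) - h u|]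
      exact abs_sub_le _ _ _
    linarith
  have h1 : volume (Set.Icc c 2) ≤ volume (A u) + volume (A (u + c)) := by
    refine (measure_mono hsub).trans ((measure_union_le _ _).trans_eq ?_)
    rw [measure_preimage_add_right]
  have h2 := ENNReal.add_lt_add (hu₀ u hu) (hu₀ (u + c) (by linarith [hc.1]))
  rw [ENNReal.inv_two_add_inv_two] at h2
  have h3 : (1 : ℝ≥0∞) ≤ volume (Set.Icc c 2) := by
    rw [Real.volume_Icc, ENNReal.one_le_ofReal]
    linarith [hc.2]
  exact absurd (h3.trans h1) (not_le.2 h2)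

/-- Unit steps are chained, each costing at most `η`; the extra `1` covers the last fractional step.
-/
lemma exists_forall_abs_sub_le {h : ℝ → ℝ} (hm : Measurable h)
    (hlim : ∀ c : ℝ, Tendsto (fun u => h (u + c) - h u) atTop (𝓝 0)) {η : ℝ} (hη : 0 < η) :
    ∃ u₀ : ℝ, ∀ u v, u₀ ≤ u → u₀ ≤ v → |h v - h u| ≤ η * (|v - u| + 1) := by
  obtain ⟨u₀, hu₀⟩ := exists_forall_abs_add_sub_le hm hlim hη
  have key : ∀ (n : ℕ) (u c : ℝ), u₀ ≤ u → c ∈ Set.Icc (0 : ℝ) 1 →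
      |h (u + n + c) - h u| ≤ η * (n + 1) := by
    intro n
    induction n with
    | zero => intro u c hu hc; simpa using hu₀ u hu c hc
    | succ n ih =>
      intro u c hu hc
      have h1 := ih (u + 1) c (by linarith) hc
      have h2 := hu₀ u hu 1 (by simp)
      push_cast
      rw [show u + 1 + n + c = u + (n + 1 : ℝ) + c by ring] at h1
      have := abs_sub_le (h (u + (n + 1 : ℝ) + c)) (h (u + 1)) (h u)
      linarith
  have key2 : ∀ u v, u₀ ≤ u → u ≤ v → |h v - h u| ≤ η * (|v - u| + 1) := by
    intro u v hu huv
    have h0 : 0 ≤ v - u := by linarith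
    have h1 := Nat.floor_le h0
    have h2 := key ⌊v - u⌋₊ u (v - u - ⌊v - u⌋₊) hu
      ⟨by linarith, by linarith [Nat.lt_floor_add_one (v - u)]⟩
    rw [show u + ⌊v - u⌋₊ + (v - u - ⌊v - u⌋₊) = v by ring] at h2
    rw [abs_of_nonneg h0]
    refine h2.trans ?_
    gcongr
  refine ⟨u₀, fun u v hu hv => ?_⟩
  rcases le_total u v with huv | huv
  · exact key2 u v hu huv
  · rw [abs_sub_comm, abs_sub_comm v u]
    exact key2 v u hv huv

lemma measurable_indicator_of_domRestrict {s : Set ℝ} (hs : MeasurableSet s) {f : ℝ → ℝ}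
    (hf : Measurable (s.domRestrict f)) : Measurable (s.indicator f) := by
  refine measurable_of_restrict_of_restrict_compl hs ?_ ?_
  · convert hf using 1
    ext x
    simp
  · convert measurable_const (a := (0 : ℝ)) using 1
    ext x
    exact Set.indicator_of_notMem x.2 f

/-- Potter's bounds for slowly varying functions. -/
lemma IsSlowlyVarying.potter {L : ℝ → ℝ} (hL : IsSlowlyVarying L) {η : ℝ} (hη : 0 < η) :
    ∃ X : ℝ, 0 < X ∧ (∀ x, X ≤ x → 0 < L x) ∧ Measurable ((Set.Ici X).indicator L) ∧
      ∀ x y, X ≤ x → X ≤ y →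
        L y / L x ≤ Real.exp η * ((y / x) ^ η + (y / x) ^ (-η)) := by
  obtain ⟨⟨a, ha, hpos, hmeas⟩, hlim⟩ := hL
  have hLm := measurable_indicator_of_domRestrict measurableSet_Ici hmeas
  -- In logarithmic coordinates slow variation says that increments of `h` vanish at infinity. `L`
  -- is cut off below `a` because it is only known to be measurable on `[a, ∞)`.
  set h : ℝ → ℝ := fun u => Real.log ((Set.Ici a).indicator L (Real.exp u)) with hh
  have hval : ∀ x, a ≤ x → h (Real.log x) = Real.log (L x) := fun x hx => by
    rw [hh]
    simp only
    rw [Real.exp_log (ha.trans_le hx), Set.indicator_of_mem (show x ∈ Set.Ici a from hx)]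
  have hm : Measurable h := Real.measurable_log.comp (hLm.comp Real.measurable_exp)
  have hlim' : ∀ c : ℝ, Tendsto (fun u => h (u + c) - h u) atTop (𝓝 0) := by
    intro c
    have h1 := ((hlim (Real.exp c) (Real.exp_pos c)).comp Real.tendsto_exp_atTop)
    have h2 := (Real.continuousAt_log one_ne_zero).tendsto.comp h1
    rw [Real.log_one] at h2
    refine h2.congr' ?_
    filter_upwards [eventually_ge_atTop (Real.log a), eventually_ge_atTop (Real.log a - c)]
      with u hu1 hu2
    have e1 : a ≤ Real.exp u := (Real.log_le_iff_le_exp ha).1 hu1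
    have e2 : a ≤ Real.exp (u + c) := (Real.log_le_iff_le_exp ha).1 (by linarith)
    have e3 := hval _ e1
    have e4 := hval _ e2
    rw [Real.log_exp] at e3 e4
    rw [e3, e4]
    simp only [Function.comp]
    rw [mul_comm, ← Real.exp_add, Real.log_div (hpos _ e2).ne' (hpos _ e1).ne']
  obtain ⟨u₀, hu₀⟩ := exists_forall_abs_sub_le hm hlim' hη
  have hXa : ∀ x, max a (Real.exp u₀) ≤ x → a ≤ x ∧ u₀ ≤ Real.log x := fun x hx => by
    have h1 := (le_max_left _ _).trans hx
    exact ⟨h1, (Real.le_log_iff_exp_le (ha.trans_le h1)).2 ((le_max_right _ _).trans hx)⟩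
  refine ⟨max a (Real.exp u₀), lt_max_of_lt_left ha, fun x hx => hpos x (hXa x hx).1, ?_, ?_⟩
  · have : (Set.Ici (max a (Real.exp u₀))).indicator L =
        (Set.Ici (max a (Real.exp u₀))).indicator ((Set.Ici a).indicator L) := by
      rw [Set.indicator_indicator, Set.inter_eq_left.2
        (Set.Ici_subset_Ici.2 (le_max_left _ _))]
    rw [this]
    exact hLm.indicator measurableSet_Ici
  · intro x y hx hy
    obtain ⟨hx1, hx2⟩ := hXa x hx
    obtain ⟨hy1, hy2⟩ := hXa y hy
    have hx0 := ha.trans_le hx1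
    have hy0 := ha.trans_le hy1
    have hLx := hpos x hx1
    have hLy := hpos y hy1
    have h1 := hu₀ _ _ hx2 hy2
    rw [hval x hx1, hval y hy1, ← Real.log_div hLy.ne' hLx.ne',
      ← Real.log_div hy0.ne' hx0.ne'] at h1
    have hyx : 0 < y / x := div_pos hy0 hx0
    rw [← Real.exp_log (div_pos hLy hLx), Real.rpow_def_of_pos hyx, Real.rpow_def_of_pos hyx]
    calc Real.exp (Real.log (L y / L x))
        ≤ Real.exp (η + |Real.log (y / x)| * η) :=
          Real.exp_le_exp.2 ((le_abs_self _).trans (h1.trans_eq (by ring)))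
      _ = Real.exp η * Real.exp (|Real.log (y / x)| * η) := Real.exp_add _ _
      _ ≤ _ := by
          gcongr
          rcases abs_choice (Real.log (y / x)) with h | h <;> rw [h]
          · linarith [Real.exp_pos (Real.log (y / x) * -η)]
          · rw [neg_mul, mul_neg]
            linarith [Real.exp_pos (Real.log (y / x) * η)]

/-! ### The Bessel factor -/

/-- The function `z ↦ K_ν(z) z ^ (-ν)`, continued to `z = 0`. -/
def besselB (ν z : ℝ) : ℝ :=
  1 / 2 * ∫ r in Set.Ioi (0 : ℝ), r ^ (ν - 1) * Real.exp (-(1 / 2) * (r * z ^ 2 + 1 / r))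

/-- The substitution `r ↦ 1/r` turns this into a Gamma integral; it is also the majorant for all
`besselB ν z`. -/
lemma integral_rpow_mul_exp_inv {ν : ℝ} (hν : ν < 0) :
    IntegrableOn (fun r : ℝ => r ^ (ν - 1) * Real.exp (-(1 / 2) * (1 / r))) (Set.Ioi 0) ∧
    ∫ r in Set.Ioi (0 : ℝ), r ^ (ν - 1) * Real.exp (-(1 / 2) * (1 / r)) =
      2 ^ (-ν) * Real.Gamma (-ν) := by
  have hcongr : ∀ r ∈ Set.Ioi (0 : ℝ), r ^ (ν - 1) * Real.exp (-(1 / 2) * (1 / r)) =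
      (|(-1 : ℝ)| * r ^ ((-1 : ℝ) - 1)) •
        (fun y : ℝ => y ^ (-ν - 1) * Real.exp (-((1 / 2) * y))) (r ^ (-1 : ℝ)) := by
    intro r hr
    have hr : (0 : ℝ) < r := hr
    simp only [abs_neg, abs_one, one_mul, smul_eq_mul]
    rw [← Real.rpow_mul hr.le, ← mul_assoc, ← Real.rpow_add hr, Real.rpow_neg_one]
    congr 2
    · ring
    · field_simp
  constructor
  · rw [integrableOn_congr_fun hcongr measurableSet_Ioi,
      integrableOn_Ioi_comp_rpow_iff
        (fun y : ℝ => y ^ (-ν - 1) * Real.exp (-((1 / 2) * y))) (p := -1) (by norm_num)]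
    have := integrableOn_rpow_mul_exp_neg_mul_rpow (p := 1) (s := -ν - 1) (b := 1 / 2)
      (by linarith) one_pos (by norm_num)
    simpa using this
  · rw [setIntegral_congr_fun measurableSet_Ioi hcongr, integral_comp_rpow_Ioi
        (fun y : ℝ => y ^ (-ν - 1) * Real.exp (-((1 / 2) * y))) (p := -1) (by norm_num),
      Real.integral_rpow_mul_exp_neg_mul_Ioi (by linarith) (by norm_num)]
    norm_num

lemma besselB_integrand_le {ν z r : ℝ} (hr : 0 < r) :
    r ^ (ν - 1) * Real.exp (-(1 / 2) * (r * z ^ 2 + 1 / r)) ≤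
      r ^ (ν - 1) * Real.exp (-(1 / 2) * (1 / r)) := by
  refine mul_le_mul_of_nonneg_left (Real.exp_le_exp.2 ?_) (by positivity)
  have : 0 ≤ r * z ^ 2 := by positivity
  linarith

lemma besselB_zero {ν : ℝ} (hν : ν < 0) : besselB ν 0 = 1 / 2 * (2 ^ (-ν) * Real.Gamma (-ν)) := by
  rw [← (integral_rpow_mul_exp_inv hν).2, besselB]
  simp

lemma besselB_zero_pos {ν : ℝ} (hν : ν < 0) : 0 < besselB ν 0 := by
  rw [besselB_zero hν]
  have := Real.Gamma_pos_of_pos (neg_pos.2 hν)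
  positivity

lemma besselB_nonneg (ν z : ℝ) : 0 ≤ besselB ν z := by
  refine mul_nonneg (by norm_num) (setIntegral_nonneg measurableSet_Ioi fun r hr => ?_)
  have : (0 : ℝ) < r := hr
  positivity

lemma continuous_besselB {ν : ℝ} (hν : ν < 0) : Continuous (besselB ν) := by
  refine continuous_const.mul (continuous_of_dominated
    (bound := fun r : ℝ => r ^ (ν - 1) * Real.exp (-(1 / 2) * (1 / r))) ?_ ?_
    (integral_rpow_mul_exp_inv hν).1 ?_)
  · exact fun z => Measurable.aestronglyMeasurable (by fun_prop)
  · refine fun z => (ae_restrict_mem measurableSet_Ioi).mono fun r hr => ?_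
    have hr : (0 : ℝ) < r := hr
    rw [Real.norm_of_nonneg (by positivity)]
    exact besselB_integrand_le hr
  · exact Eventually.of_forall fun r => by fun_prop

lemma besselB_le {ν : ℝ} (hν : ν < 0) (z : ℝ) : besselB ν z ≤ besselB ν 0 := by
  have hi := (integral_rpow_mul_exp_inv hν).1
  rw [besselB, besselB]
  refine mul_le_mul_of_nonneg_left ?_ (by norm_num)
  have hle := fun (r : ℝ) (hr : r ∈ Set.Ioi (0 : ℝ)) => besselB_integrand_le (ν := ν) (z := z) hr
  refine setIntegral_mono_on ?_ (by simpa using hi) measurableSet_Ioi (by simpa using hle)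
  refine Integrable.mono' hi (Measurable.aestronglyMeasurable (by fun_prop)) ?_
  refine (ae_restrict_mem measurableSet_Ioi).mono fun r hr => ?_
  have hr' : (0 : ℝ) < r := hr
  rw [Real.norm_of_nonneg (by positivity)]
  exact hle r hr

/-- Substituting `s = z r` moves `z` into one exponential, which shows that the singularity of `K_ν`
at zero is exactly `z^ν` when `ν < 0`. -/
lemma besselK_mul_rpow {ν z : ℝ} (hz : 0 < z) : besselK ν z * z ^ (-ν) = besselB ν z := by
  have h1 := integral_comp_mul_left_Ioi
    (fun s : ℝ => s ^ (ν - 1) * Real.exp (-(1 / 2) * (s + 1 / s) * z)) 0 hz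
  rw [mul_zero, smul_eq_mul, eq_inv_mul_iff_mul_eq₀ hz.ne'] at h1
  rw [besselK, besselB, ← h1, ← integral_const_mul]
  have h2 : ∀ r ∈ Set.Ioi (0 : ℝ), z * ((z * r) ^ (ν - 1) *
      Real.exp (-(1 / 2) * (z * r + 1 / (z * r)) * z)) =
      z ^ ν * (r ^ (ν - 1) * Real.exp (-(1 / 2) * (r * z ^ 2 + 1 / r))) := by
    intro r hr
    have hr : (0 : ℝ) < r := hr
    rw [Real.mul_rpow hz.le hr.le, Real.rpow_sub_one hz.ne',
      show -(1 / 2) * (z * r + 1 / (z * r)) * z = -(1 / 2) * (r * z ^ 2 + 1 / r) by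
        field_simp]
    field_simp
  rw [setIntegral_congr_fun measurableSet_Ioi h2, integral_const_mul, Real.rpow_neg hz.le]
  have : z ^ ν ≠ 0 := (Real.rpow_pos_of_pos hz _).ne'
  rw [mul_left_comm, mul_comm _ (z ^ ν)⁻¹, inv_mul_cancel_left₀ this]

/-- The constants normalize `1 - θ` to be `1` at the origin. This is the duplication formula for
`Γ(κ/2) Γ(κ/2 + 1/2)` combined with the reflection formula; the factors depending on `j` multiply to
`2`. -/
lemma c1_div_c2_mul {κ : ℝ} (h0 : 0 < κ) (h1 : κ < 1) (j : ℤ) :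
    c1 j κ / c2 j κ * besselB ((κ - 1) / 2) 0 = 1 := by
  have hG1 := Real.Gamma_pos_of_pos (half_pos h0)
  have hd := Real.Gamma_mul_Gamma_add_half (κ / 2)
  have hr := Real.Gamma_mul_Gamma_one_sub (κ / 2 + 1 / 2)
  rw [show 1 - (κ / 2 + 1 / 2) = (1 - κ) / 2 by ring,
    show Real.pi * (κ / 2 + 1 / 2) = κ * Real.pi / 2 + Real.pi / 2 by ring,
    Real.sin_add_pi_div_two] at hr
  rw [show 2 * (κ / 2) = κ by ring] at hd
  have hcos : 0 < Real.cos (κ * Real.pi / 2) :=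
    Real.cos_pos_of_mem_Ioo ⟨by nlinarith [Real.pi_pos], by nlinarith [Real.pi_pos]⟩
  have hpi : √Real.pi * √Real.pi = Real.pi := Real.mul_self_sqrt Real.pi_pos.le
  have hsp : 0 < √Real.pi := Real.sqrt_pos.2 Real.pi_pos
  have h2 : (2 : ℝ) ^ ((1 - κ) / 2) * 2 ^ ((1 - κ) / 2) = 2 ^ (1 - κ) := by
    rw [← Real.rpow_add two_pos]; ring_nf
  have hj : (2 : ℝ) ^ (if j = 0 then 1 else 0) * 2 ^ (if j = 0 then 0 else 1) = 2 := by
    split_ifs <;> norm_num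
  rw [besselB_zero (by linarith), c1, c2, div_inv_eq_mul,
    show -((κ - 1) / 2) = (1 - κ) / 2 by ring]
  rw [eq_div_iff hcos.ne'] at hr
  calc _ = ((2 : ℝ) ^ (if j = 0 then 1 else 0) * 2 ^ (if j = 0 then 0 else 1)) *
        ((2 : ℝ) ^ ((1 - κ) / 2) * 2 ^ ((1 - κ) / 2)) * Real.Gamma κ *
        Real.cos (κ * Real.pi / 2) * Real.Gamma ((1 - κ) / 2) /
          (2 * (√Real.pi * Real.Gamma (κ / 2))) := by ring
    _ = (Real.Gamma κ * 2 ^ (1 - κ) * √Real.pi) * Real.cos (κ * Real.pi / 2) *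
        Real.Gamma ((1 - κ) / 2) / (√Real.pi * √Real.pi * Real.Gamma (κ / 2)) := by
        rw [hj, h2]; field_simp
    _ = (Real.Gamma (κ / 2 + 1 / 2) * Real.Gamma ((1 - κ) / 2) * Real.cos (κ * Real.pi / 2)) *
        Real.Gamma (κ / 2) / (√Real.pi * √Real.pi * Real.Gamma (κ / 2)) := by rw [← hd]; ring
    _ = 1 := by
        rw [hr, hpi]
        have := Real.pi_pos
        field_simp

/-- The continuous extension of `1 - θ_κ` to the real line. -/
def besselRatio (κ z : ℝ) : ℝ := besselB ((κ - 1) / 2) z / besselB ((κ - 1) / 2) 0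

section BesselRatio

variable {κ : ℝ}

lemma one_sub_theta (h0 : 0 < κ) (h1 : κ < 1) (j : ℤ) {z : ℝ} (hz : 0 < z) :
    1 - theta j κ z = besselRatio κ z := by
  have hB := besselB_zero_pos (ν := (κ - 1) / 2) (by linarith)
  rw [theta, sub_sub_cancel, mul_assoc, show (1 - κ) / 2 = -((κ - 1) / 2) by ring,
    besselK_mul_rpow hz, besselRatio, eq_div_iff hB.ne', mul_right_comm, c1_div_c2_mul h0 h1,
    one_mul]

lemma continuous_besselRatio (h1 : κ < 1) : Continuous (besselRatio κ) :=
  (continuous_besselB (by linarith)).div_const _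

lemma besselRatio_zero (h1 : κ < 1) : besselRatio κ 0 = 1 :=
  div_self (besselB_zero_pos (by linarith)).ne'

lemma besselRatio_nonneg (h1 : κ < 1) (z : ℝ) : 0 ≤ besselRatio κ z :=
  div_nonneg (besselB_nonneg _ _) (besselB_zero_pos (by linarith)).le

lemma besselRatio_le_one (h1 : κ < 1) (z : ℝ) : besselRatio κ z ≤ 1 :=
  (div_le_one (besselB_zero_pos (by linarith))).2 (besselB_le (by linarith) z)

end BesselRatio

/-! ### The isometry of mean-square integrals -/

/-- The elementary integrands `e k` and the random variables `X k` are square integrable, with the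
same inner products. -/
structure IsIsometricFamily {Ω T : Type*} [MeasurableSpace Ω] (P : Measure Ω) (ν : Measure ℝ)
    (e : T → ℝ → ℂ) (X : T → Ω → ℂ) : Prop where
  memLp_left : ∀ k, MemLp (e k) 2 ν
  memLp_right : ∀ k, MemLp (X k) 2 P
  integral_eq : ∀ k l, ∫ ω, X k ω * (starRingEnd ℂ) (X l ω) ∂P =
    ∫ s, e k s * (starRingEnd ℂ) (e l s) ∂ν

lemma coeFn_linearCombination_toLp {α T : Type*} [MeasurableSpace α] {ν : Measure α}
    {e : T → α → ℂ} (he : ∀ k, MemLp (e k) 2 ν) (c : T →₀ ℂ) :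
    (Finsupp.linearCombination ℂ (fun k => (he k).toLp (e k)) c : Lp ℂ 2 ν) =ᵐ[ν]
      fun s => c.sum fun k a => a * e k s := by
  induction c using Finsupp.induction_linear with
  | zero => rw [map_zero]; exact (Lp.coeFn_zero ℂ 2 ν).trans (by simp; rfl)
  | add c d hc hd =>
    rw [map_add]
    filter_upwards [Lp.coeFn_add (Finsupp.linearCombination ℂ (fun k => (he k).toLp (e k)) c)
      (Finsupp.linearCombination ℂ (fun k => (he k).toLp (e k)) d), hc, hd] with s h1 h2 h3
    rw [h1, Pi.add_apply, h2, h3, Finsupp.sum_add_index']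
    · simp
    · intro k a b; ring
  | single k a =>
    rw [Finsupp.linearCombination_single]
    filter_upwards [Lp.coeFn_smul a ((he k).toLp (e k)), (he k).coeFn_toLp] with s h1 h2
    rw [h1, Pi.smul_apply, h2, Finsupp.sum_single_index (by simp), smul_eq_mul]

lemma inner_toLp {α : Type*} [MeasurableSpace α] {ν : Measure α} {f g : α → ℂ}
    (hf : MemLp f 2 ν) (hg : MemLp g 2 ν) :
    inner ℂ (hf.toLp f) (hg.toLp g) = ∫ s, g s * (starRingEnd ℂ) (f s) ∂ν := by
  rw [L2.inner_def]
  refine integral_congr_ae ?_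
  filter_upwards [hf.coeFn_toLp, hg.coeFn_toLp] with s h1 h2
  rw [h1, h2, RCLike.inner_apply]

namespace IsIsometricFamily

variable {Ω T : Type*} [MeasurableSpace Ω] {P : Measure Ω} {ν : Measure ℝ}
  {e : T → ℝ → ℂ} {X : T → Ω → ℂ}

/-- The map from coefficients to elementary integrands. -/
def left (h : IsIsometricFamily P ν e X) : (T →₀ ℂ) →ₗ[ℂ] Lp ℂ 2 ν :=
  Finsupp.linearCombination ℂ fun k => (h.memLp_left k).toLp (e k)

/-- The map from coefficients to integrals of elementary integrands. -/
def right (h : IsIsometricFamily P ν e X) : (T →₀ ℂ) →ₗ[ℂ] Lp ℂ 2 P :=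
  Finsupp.linearCombination ℂ fun k => (h.memLp_right k).toLp (X k)

/-- The graph of the mean-square integral. -/
def graph (h : IsIsometricFamily P ν e X) : Submodule ℂ (Lp ℂ 2 ν × Lp ℂ 2 P) :=
  (LinearMap.range (h.left.prod h.right)).topologicalClosure

lemma inner_right_right (h : IsIsometricFamily P ν e X) (c d : T →₀ ℂ) :
    inner ℂ (h.right c) (h.right d) = inner ℂ (h.left c) (h.left d) := by
  simp only [left, right, Finsupp.linearCombination_apply, Finsupp.sum_inner, Finsupp.inner_sum,
    inner_smul_left, inner_smul_right, inner_toLp, h.integral_eq]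

lemma norm_right (h : IsIsometricFamily P ν e X) (c : T →₀ ℂ) : ‖h.right c‖ = ‖h.left c‖ := by
  rw [@norm_eq_sqrt_re_inner ℂ, @norm_eq_sqrt_re_inner ℂ, h.inner_right_right]

/-- A closed property of the mean-square integrals holds if it holds for the elementary ones. -/
lemma closure_induction (h : IsIsometricFamily P ν e X) {p : Lp ℂ 2 ν × Lp ℂ 2 P → Prop}
    (hp : IsClosed {q | p q}) (h0 : ∀ c, p (h.left c, h.right c)) {q : Lp ℂ 2 ν × Lp ℂ 2 P}
    (hq : q ∈ h.graph) : p q := by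
  have h1 : closure (LinearMap.range (h.left.prod h.right) : Set (Lp ℂ 2 ν × Lp ℂ 2 P)) ⊆
      {q | p q} := by
    refine closure_minimal ?_ hp
    rintro _ ⟨c, rfl⟩
    exact h0 c
  exact h1 hq

lemma inner_eq (h : IsIsometricFamily P ν e X) {q r : Lp ℂ 2 ν × Lp ℂ 2 P}
    (hq : q ∈ h.graph) (hr : r ∈ h.graph) : inner ℂ q.2 r.2 = inner ℂ q.1 r.1 := by
  refine h.closure_induction (p := fun q => inner ℂ q.2 r.2 = inner ℂ q.1 r.1)
    (isClosed_eq (by fun_prop) (by fun_prop)) (fun c => ?_) hq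
  refine h.closure_induction
    (p := fun r => inner ℂ (h.right c) r.2 = inner ℂ (h.left c) r.1)
    (isClosed_eq (by fun_prop) (by fun_prop)) (fun d => ?_) hr
  exact h.inner_right_right c d

lemma norm_eq (h : IsIsometricFamily P ν e X) {q : Lp ℂ 2 ν × Lp ℂ 2 P}
    (hq : q ∈ h.graph) : ‖q.2‖ = ‖q.1‖ := by
  rw [@norm_eq_sqrt_re_inner ℂ, @norm_eq_sqrt_re_inner ℂ, h.inner_eq hq hq]

/-- Simultaneous approximation of integrand and integral by the same coefficients is membership in
the closure of the graph. -/
lemma mem_graph (h : IsIsometricFamily P ν e X) {g : ℝ → ℂ} {η : Ω → ℂ}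
    (hI : IsMeanSquareIntegral P ν e X g η) :
    (hI.1.toLp g, hI.2.1.toLp η) ∈ h.graph := by
  refine EMetric.mem_closure_iff.2 fun δ hδ => ?_
  obtain ⟨c, h1, h2⟩ := hI.2.2 δ hδ
  refine ⟨(h.left c, h.right c), ⟨c, rfl⟩, ?_⟩
  rw [Prod.edist_eq, max_lt_iff]
  constructor
  · rw [Lp.edist_def]
    refine lt_of_eq_of_lt (eLpNorm_congr_ae ?_) h1
    exact hI.1.coeFn_toLp.sub (coeFn_linearCombination_toLp h.memLp_left c)
  · rw [Lp.edist_def]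
    refine lt_of_eq_of_lt (eLpNorm_congr_ae ?_) h2
    exact hI.2.1.coeFn_toLp.sub (coeFn_linearCombination_toLp h.memLp_right c)

/-- Every continuous functional of the integrand is a continuous functional of the integral. -/
lemma exists_dual (h : IsIsometricFamily P ν e X) (φ : Lp ℂ 2 ν) :
    ∃ ℓ : Lp ℂ 2 P →L[ℂ] ℂ, ∀ q ∈ h.graph, ℓ q.2 = inner ℂ φ q.1 := by
  -- A linear choice of coefficients for each finite combination of the `X k`. By the isometry,
  -- combinations with the same integral have the same integrand, so the choice does not matter; the
  -- functional is then extended by Hahn–Banach.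
  obtain ⟨s, hs⟩ := h.right.rangeRestrict.exists_rightInverse_of_surjective
    h.right.range_rangeRestrict
  have hs' : ∀ v, h.right (s v) = v := fun v => by
    have := LinearMap.congr_fun hs v
    exact congrArg Subtype.val this
  set f : LinearMap.range h.right →ₗ[ℂ] ℂ := (innerₛₗ ℂ φ) ∘ₗ h.left ∘ₗ s with hf
  have hfb : ∀ v, ‖f v‖ ≤ ‖φ‖ * ‖v‖ := fun v => by
    calc ‖f v‖ ≤ ‖φ‖ * ‖h.left (s v)‖ := norm_inner_le_norm (𝕜 := ℂ) φ (h.left (s v))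
      _ = ‖φ‖ * ‖v‖ := by rw [← h.norm_right, hs']; rfl
  obtain ⟨ℓ, hℓ, -⟩ := exists_extension_norm_eq _ (f.mkContinuous ‖φ‖ hfb)
  refine ⟨ℓ, fun q hq => ?_⟩
  refine h.closure_induction (p := fun q => ℓ q.2 = inner ℂ φ q.1)
    (isClosed_eq (by fun_prop) (by fun_prop)) (fun c => ?_) hq
  have h1 := hℓ ⟨h.right c, c, rfl⟩
  simp only at h1 ⊢
  rw [h1]
  have h2 : h.left (s ⟨h.right c, c, rfl⟩) = h.left c := by
    rw [← sub_eq_zero, ← map_sub, ← norm_eq_zero, ← h.norm_right, map_sub, hs', sub_self,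
      norm_zero]
  change inner ℂ φ (h.left (s ⟨h.right c, c, rfl⟩)) = _
  rw [h2]

end IsIsometricFamily

/-! ### Gaussian limits -/

lemma continuous_integral_re_sq {Ω : Type*} [MeasurableSpace Ω] {P : Measure Ω} :
    Continuous fun η : Lp ℂ 2 P => ∫ ω, (η ω).re ^ 2 ∂P := by
  have h1 : ∀ η : Lp ℂ 2 P, ∫ ω, (η ω).re ^ 2 ∂P =
      inner ℝ (Complex.reCLM.compLpL 2 P η) (Complex.reCLM.compLpL 2 P η) := fun η => by
    rw [L2.inner_def]
    refine integral_congr_ae ?_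
    filter_upwards [Complex.reCLM.coeFn_compLpL η] with ω hω
    rw [hω, real_inner_self_eq_norm_sq, Complex.reCLM_apply, Real.norm_eq_abs, sq_abs]
  simp_rw [h1]
  fun_prop

section GaussianLimits

variable {Ω : Type*} [MeasurableSpace Ω] {P : Measure Ω} [IsProbabilityMeasure P]

lemma integrable_Lp_two (η : Lp ℂ 2 P) : Integrable η P :=
  (Lp.memLp η).integrable (by norm_num)

lemma integral_norm_sub_le_dist (η ζ : Lp ℂ 2 P) : ∫ ω, ‖η ω - ζ ω‖ ∂P ≤ dist η ζ := by
  have h1 : MemLp (⇑η - ⇑ζ) 2 P := (Lp.memLp η).sub (Lp.memLp ζ)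
  rw [Lp.dist_def]
  calc ∫ ω, ‖η ω - ζ ω‖ ∂P = (eLpNorm (⇑η - ⇑ζ) 1 P).toReal := by
        rw [eLpNorm_one_eq_lintegral_enorm]
        exact integral_norm_eq_lintegral_enorm h1.1
    _ ≤ (eLpNorm (⇑η - ⇑ζ) 2 P).toReal :=
        ENNReal.toReal_mono h1.2.ne (eLpNorm_le_eLpNorm_of_exponent_le (by norm_num) h1.1)

/-- Integration of a Lipschitz function of a square-integrable random variable is continuous in
the mean square. -/
lemma continuous_integral_comp_of_lipschitz {F : ℂ → ℂ} (hF : ∀ a b, ‖F a - F b‖ ≤ ‖a - b‖) :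
    Continuous fun η : Lp ℂ 2 P => ∫ ω, F (η ω) ∂P := by
  have hFc : Continuous F := by
    have : LipschitzWith 1 F := LipschitzWith.of_dist_le_mul fun a b => by
      simpa [dist_eq_norm] using hF a b
    exact this.continuous
  have hFi : ∀ η : Lp ℂ 2 P, Integrable (fun ω => F (η ω)) P := fun η => by
    refine Integrable.mono' ((integrable_Lp_two η).norm.add (integrable_const ‖F 0‖))
      (hFc.comp_aestronglyMeasurable (Lp.aestronglyMeasurable η)) (Eventually.of_forall fun ω => ?_)
    have h1 := hF (η ω) 0
    have h2 := norm_sub_norm_le (F (η ω)) (F 0)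
    rw [sub_zero] at h1
    simp only [Pi.add_apply]
    linarith
  refine LipschitzWith.continuous (K := 1) (LipschitzWith.of_dist_le_mul fun η ζ => ?_)
  rw [NNReal.coe_one, one_mul, dist_eq_norm, ← integral_sub (hFi η) (hFi ζ)]
  refine (norm_integral_le_integral_norm _).trans (le_trans ?_ (integral_norm_sub_le_dist η ζ))
  exact integral_mono ((hFi η).sub (hFi ζ)).norm
    ((integrable_Lp_two η).sub (integrable_Lp_two ζ)).norm fun ω => hF _ _

lemma continuous_integral_exp_re :
    Continuous fun η : Lp ℂ 2 P => ∫ ω, Complex.exp (Complex.I * ((η ω).re : ℂ)) ∂P := by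
  refine continuous_integral_comp_of_lipschitz
    (F := fun z => Complex.exp (Complex.I * (z.re : ℂ))) fun a b => ?_
  have h1 := Real.norm_exp_I_mul_ofReal_sub_one_le (x := a.re - b.re)
  have h2 : Complex.exp (Complex.I * (a.re : ℂ)) - Complex.exp (Complex.I * (b.re : ℂ)) =
      Complex.exp (Complex.I * (b.re : ℂ)) *
        (Complex.exp (Complex.I * ((a.re - b.re : ℝ) : ℂ)) - 1) := by
    rw [mul_sub, ← Complex.exp_add, mul_one, ← mul_add]
    push_cast
    ring_nf
  rw [h2, norm_mul, mul_comm Complex.I, Complex.norm_exp_ofReal_mul_I, one_mul]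
  refine h1.trans ?_
  rw [← Complex.sub_re, Real.norm_eq_abs]
  exact Complex.abs_re_le_norm _

namespace IsIsometricFamily

variable {T : Type*} {ν : Measure ℝ} {e : T → ℝ → ℂ} {X : T → Ω → ℂ}

lemma integral_eq_zero (h : IsIsometricFamily P ν e X) (h0 : ∀ k, ∫ ω, X k ω ∂P = 0)
    {q : Lp ℂ 2 ν × Lp ℂ 2 P} (hq : q ∈ h.graph) : ∫ ω, q.2 ω ∂P = 0 := by
  refine h.closure_induction (p := fun q => ∫ ω, q.2 ω ∂P = 0) ?_ (fun c => ?_) hq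
  · exact isClosed_eq ((continuous_integral_comp_of_lipschitz (F := id) fun a b => le_rfl).comp
      continuous_snd) continuous_const
  · change ∫ ω, h.right c ω ∂P = 0
    rw [right, integral_congr_ae (coeFn_linearCombination_toLp h.memLp_right c)]
    simp only [Finsupp.sum]
    rw [integral_finsetSum _ fun k _ => ((h.memLp_right k).integrable (by norm_num)).const_mul _]
    simp [integral_const_mul, h0]

/-- Both sides are continuous for the mean-square norm, so the Gaussian identity passes from finite
combinations to the closure. A general integral is complex, hence the real parts. -/
lemma integral_exp_re (h : IsIsometricFamily P ν e X) (hX : IsGaussianProcess X P)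
    (h0 : ∀ k, ∫ ω, X k ω ∂P = 0) {q : Lp ℂ 2 ν × Lp ℂ 2 P} (hq : q ∈ h.graph) :
    ∫ ω, Complex.exp (Complex.I * ((q.2 ω).re : ℂ)) ∂P =
      Complex.exp (-((∫ ω, (q.2 ω).re ^ 2 ∂P : ℝ) : ℂ) / 2) := by
  refine h.closure_induction (p := fun q => ∫ ω, Complex.exp (Complex.I * ((q.2 ω).re : ℂ)) ∂P =
      Complex.exp (-((∫ ω, (q.2 ω).re ^ 2 ∂P : ℝ) : ℂ) / 2)) ?_ (fun c => ?_) hq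
  · refine isClosed_eq (continuous_integral_exp_re.comp continuous_snd) ?_
    have := (continuous_integral_re_sq (P := P)).comp
      (continuous_snd (X := Lp ℂ 2 ν) (Y := Lp ℂ 2 P))
    exact Complex.continuous_exp.comp ((Complex.continuous_ofReal.comp this).neg.div_const _)
  · have hae := coeFn_linearCombination_toLp h.memLp_right c
    set Y : Ω → ℝ := fun ω => (c.sum fun k a => a * X k ω).re with hY
    have hre : (fun ω => (h.right c ω).re) =ᵐ[P] Y := hae.fun_comp Complex.re
    have e1 : ∫ ω, Complex.exp (Complex.I * ((h.right c ω).re : ℂ)) ∂P =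
        ∫ ω, Complex.exp (Complex.I * (Y ω : ℂ)) ∂P :=
      integral_congr_ae (hre.fun_comp fun x => Complex.exp (Complex.I * (x : ℂ)))
    have e2 : ∫ ω, (h.right c ω).re ^ 2 ∂P = ∫ ω, Y ω ^ 2 ∂P :=
      integral_congr_ae (hre.fun_comp fun x => x ^ 2)
    simp only
    rw [e1, e2]
    have hG : HasGaussianLaw Y P := by
      have h1 := (hX.hasGaussianLaw c.support).map_fun (∑ i : c.support,
        (Complex.reCLM.comp (ContinuousLinearMap.mul ℝ ℂ (c i))).comp
          (ContinuousLinearMap.proj (φ := fun _ : c.support => ℂ) i))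
      refine h1.congr (Eventually.of_forall fun ω => ?_)
      simp only [hY, Finsupp.sum, sum_apply, Complex.re_sum]
      exact Finset.sum_coe_sort c.support fun k => (c k * X k ω).re
    have hm : ∫ ω, Y ω ∂P = 0 := by
      have h1 : ∫ ω, h.right c ω ∂P = 0 :=
        h.integral_eq_zero h0 (q := (h.left c, h.right c))
          (Submodule.le_topologicalClosure _ ⟨c, rfl⟩)
      rw [← integral_congr_ae hre]
      have h2 : ∫ ω, (h.right c ω).re ∂P = (∫ ω, h.right c ω ∂P).re :=
        integral_re (integrable_Lp_two (h.right c))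
      rw [h2, h1, Complex.zero_re]
    have h1 := hG.charFun_map_eq 1
    rw [charFun_apply_real, integral_map hG.aemeasurable (by fun_prop)] at h1
    simp only [Complex.ofReal_one, one_mul, Real.inner_apply] at h1
    rw [variance_eq_integral hG.aemeasurable] at h1
    simp only [hm, sub_zero, Complex.ofReal_zero, zero_mul, zero_sub] at h1
    simp_rw [mul_comm Complex.I]
    rw [h1]
    ring_nf

end IsIsometricFamily

end GaussianLimits

/-! ### The spectral representation -/

lemma character_zero_left (s : ℝ) : character 0 s = 1 := by simp [character]

lemma continuous_character (x : ℝ) : Continuous (character x) := by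
  unfold character; fun_prop

lemma norm_character (x s : ℝ) : ‖character x s‖ = 1 := by
  have : Complex.I * s * x = ((s * x : ℝ) : ℂ) * Complex.I := by push_cast; ring
  rw [character, this, Complex.norm_exp_ofReal_mul_I]

lemma character_mul_conj (x y s : ℝ) :
    character x s * (starRingEnd ℂ) (character y s) = character (x - y) s := by
  rw [character, character, character, ← Complex.exp_conj, ← Complex.exp_add]
  simp only [map_mul, Complex.conj_I, Complex.conj_ofReal]
  push_cast
  ring_nf

lemma toL2_of_memLp {Ω : Type*} [MeasurableSpace Ω] {P : Measure Ω} {X : Ω → ℝ}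
    (hX : MemLp X 2 P) : toL2 P X = hX.toLp X := by
  rw [toL2, dif_pos hX]

/-- The complexification of real square-integrable random variables. -/
def complexify {Ω : Type*} [MeasurableSpace Ω] (P : Measure Ω) : Lp ℝ 2 P →L[ℝ] Lp ℂ 2 P :=
  Complex.ofRealCLM.compLpL 2 P

lemma complexify_toL2 {Ω : Type*} [MeasurableSpace Ω] {P : Measure Ω} {X : Ω → ℝ}
    (hX : MemLp X 2 P) (hX' : MemLp (fun ω => (X ω : ℂ)) 2 P) :
    complexify P (toL2 P X) = hX'.toLp fun ω => (X ω : ℂ) := by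
  rw [toL2_of_memLp hX]
  refine Lp.ext ?_
  filter_upwards [Complex.ofRealCLM.coeFn_compLpL (hX.toLp X), hX.coeFn_toLp, hX'.coeFn_toLp]
    with ω h1 h2 h3
  rw [h3]
  refine h1.trans ?_
  rw [h2]
  rfl

lemma memLp_of_memLp_ofReal {Ω : Type*} [MeasurableSpace Ω] {P : Measure Ω} {X : Ω → ℝ}
    (hX : MemLp (fun ω => (X ω : ℂ)) 2 P) : MemLp X 2 P := by
  simpa using hX.re

namespace HasSpectralDensity

variable {Ω : Type*} [MeasurableSpace Ω] {P : Measure Ω} {ξ : ℝ → Ω → ℝ} {f : ℝ → ℝ}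

lemma isFiniteMeasure (h : HasSpectralDensity P ξ f) : IsFiniteMeasure (spectralMeasure f) :=
  isFiniteMeasure_withDensity_ofReal h.integrable.2

lemma integral_spectralMeasure (h : HasSpectralDensity P ξ f) (g : ℝ → ℂ) :
    ∫ s, g s ∂(spectralMeasure f) = ∫ s, (f s : ℂ) * g s := by
  rw [spectralMeasure, integral_withDensity_eq_integral_toReal_smul₀
    h.integrable.1.aemeasurable.ennreal_ofReal (by simp)]
  refine integral_congr_ae (h.nonneg.mono fun s hs => ?_)
  simp only [ENNReal.toReal_ofReal hs, Complex.real_smul]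

lemma isIsometricFamily [IsProbabilityMeasure P] (h : HasSpectralDensity P ξ f)
    (hξ : IsGaussianProcess ξ P) (hξ0 : ∀ x, ∫ ω, ξ x ω ∂P = 0) :
    IsIsometricFamily P (spectralMeasure f) character (fun x ω => (ξ x ω : ℂ)) where
  memLp_left x := by
    have := h.isFiniteMeasure
    exact MemLp.of_bound (continuous_character x).aestronglyMeasurable 1
      (Eventually.of_forall fun s => (norm_character x s).le)
  memLp_right x := (hξ.hasGaussianLaw_eval x).memLp_two.ofReal
  integral_eq x y := by
    have h1 := h.covariance x y
    rw [covariance_eq_sub (hξ.hasGaussianLaw_eval x).memLp_two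
      (hξ.hasGaussianLaw_eval y).memLp_two, hξ0, hξ0, mul_zero, sub_zero] at h1
    rw [h.integral_spectralMeasure]
    simp_rw [character_mul_conj, Complex.conj_ofReal, mul_comm (f _ : ℂ)]
    rw [← h1, ← integral_complex_ofReal]
    simp

end HasSpectralDensity

/-! ### Identification of mean-square solutions -/

/-- This turns the equation in mean square into scalar equations. -/
lemma HasFractionalDerivAt.clm_comp {E F : Type*} [NormedAddCommGroup E] [NormedSpace ℝ E]
    [NormedAddCommGroup F] [NormedSpace ℝ F] [CompleteSpace E] [CompleteSpace F]
    (Λ : E →L[ℝ] F) {β : ℝ} {v : ℝ → E}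
    {d : E} {t : ℝ} (hv : ContinuousOn v (Set.Ici 0)) (ht : 0 < t)
    (h : HasFractionalDerivAt β v d t) : HasFractionalDerivAt β (fun s => Λ (v s)) (Λ d) t := by
  rcases h with ⟨h1, h2⟩ | ⟨h1, d', h2, h3⟩
  · exact Or.inl ⟨h1, Λ.hasFDerivAt.comp_hasDerivAt t h2⟩
  · refine Or.inr ⟨h1, Λ d', ?_, by rw [h3]; simp⟩
    refine (Λ.hasFDerivAt.comp_hasDerivAt t h2).congr_of_eventuallyEq ?_
    filter_upwards [lt_mem_nhds ht] with s hs
    have hi : IntervalIntegrable (fun τ => (s - τ) ^ (-β) • v τ) volume 0 s := by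
      have h4 := intervalIntegrable_sub_rpow (a := 1 - β) (by linarith) s 0 s
      rw [show 1 - β - 1 = -β by ring] at h4
      rw [intervalIntegrable_iff_integrableOn_Icc_of_le hs.le] at h4 ⊢
      exact h4.smul_continuousOn (hv.mono Set.Icc_subset_Ici_self) isCompact_Icc
    simp only [Function.comp]
    rw [← Λ.intervalIntegral_comp_comm hi]
    simp

lemma symbol_nonneg (α γ s : ℝ) : 0 ≤ symbol α γ s := by
  unfold symbol; positivity

lemma measurable_symbol (α γ : ℝ) : Measurable (symbol α γ) := by
  unfold symbol; fun_prop

lemma symbol_le_symbol {α γ s R : ℝ} (hα : 0 ≤ α) (hγ : 0 ≤ γ) (hs : |s| ≤ R) :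
    symbol α γ s ≤ symbol α γ R := by
  have h2 : s ^ 2 ≤ R ^ 2 := sq_le_sq' (abs_le.1 hs).1 (abs_le.1 hs).2
  unfold symbol
  have : |s| ≤ |R| := hs.trans (le_abs_self R)
  gcongr

lemma abs_mittagLefflerE_neg_le_one {β : ℝ} (hβ0 : 0 < β) (hβ1 : β ≤ 1) {s : ℝ} (hs : 0 ≤ s) :
    |mittagLefflerE β (-s)| ≤ 1 := by
  rw [abs_of_pos (mittagLefflerE_neg_pos hβ0 hβ1 hs)]
  have := Real.Gamma_pos_of_pos (by linarith : 0 < 1 + β)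
  refine (mittagLefflerE_neg_le hβ0 hβ1 hs).trans ((div_le_one (by positivity)).2 ?_)
  have : 0 ≤ s / Real.Gamma (1 + β) := by positivity
  linarith

/-- The symbol of the solution operator of the fractional Riesz-Bessel equation. -/
def solutionSymbol (α β γ μ t s : ℝ) : ℝ := mittagLefflerE β (-(μ * symbol α γ s * t ^ β))

section SolutionSymbol

variable {α β γ μ t : ℝ}

lemma measurable_solutionSymbol (hβ0 : 0 < β) : Measurable (solutionSymbol α β γ μ t) := by
  have := measurable_symbol α γ
  exact (continuous_mittagLefflerE hβ0).measurable.comp (by fun_prop)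

lemma abs_solutionSymbol_le_one (hβ0 : 0 < β) (hβ1 : β ≤ 1) (hμ : 0 ≤ μ) (ht : 0 ≤ t) (s : ℝ) :
    |solutionSymbol α β γ μ t s| ≤ 1 :=
  abs_mittagLefflerE_neg_le_one hβ0 hβ1
    (mul_nonneg (mul_nonneg hμ (symbol_nonneg α γ s)) (Real.rpow_nonneg ht β))

lemma memLp_character_mul_solutionSymbol (hβ0 : 0 < β) (hβ1 : β ≤ 1) (hμ : 0 ≤ μ) (ht : 0 ≤ t)
    {ν : Measure ℝ} [IsFiniteMeasure ν] (x : ℝ) :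
    MemLp (fun s => character x s * (solutionSymbol α β γ μ t s : ℂ)) 2 ν := by
  have hm := (measurable_solutionSymbol (α := α) (γ := γ) (μ := μ) (t := t) hβ0)
  refine MemLp.of_bound ((continuous_character x).measurable.mul
    (Complex.measurable_ofReal.comp hm)).aestronglyMeasurable 1 (Eventually.of_forall fun s => ?_)
  rw [norm_mul, norm_character, one_mul, Complex.norm_real]
  exact abs_solutionSymbol_le_one hβ0 hβ1 hμ ht s

end SolutionSymbol

/-- Integration of the Mittag-Leffler series against an integrable function. -/
lemma hasSum_integral_mittagLefflerE_mul {β c M : ℝ} (hβ : 0 < β) {ν : Measure ℝ} {σ ρ : ℝ → ℝ}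
    (hσ : Measurable σ) (hρ : Integrable ρ ν) (hb : ∀ s, ρ s = 0 ∨ |σ s| ≤ M) :
    HasSum (fun j : ℕ => c ^ j / Real.Gamma (1 + β * j) * ∫ s, σ s ^ j * ρ s ∂ν)
      (∫ s, mittagLefflerE β (c * σ s) * ρ s ∂ν) := by
  have hle : ∀ (j : ℕ) s, ‖σ s ^ j * ρ s‖ ≤ |M| ^ j * ‖ρ s‖ := fun j s => by
    rw [norm_mul, norm_pow, Real.norm_eq_abs, Real.norm_eq_abs]
    rcases hb s with h | h
    · simp [h]
    · have := h.trans (le_abs_self M)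
      gcongr
  have hint : ∀ j : ℕ, Integrable (fun s => σ s ^ j * ρ s) ν := fun j =>
    Integrable.mono' (hρ.norm.const_mul (|M| ^ j))
      ((hσ.pow_const j).aestronglyMeasurable.mul hρ.1) (Eventually.of_forall (hle j))
  have h1 := hasSum_integral_of_summable_integral_norm
    (F := fun (j : ℕ) s => c ^ j / Real.Gamma (1 + β * j) * (σ s ^ j * ρ s)) (μ := ν)
    (fun j => (hint j).const_mul _) ?_
  · simp_rw [integral_const_mul] at h1
    have h3 : ∀ s, ∑' j : ℕ, c ^ j / Real.Gamma (1 + β * j) * (σ s ^ j * ρ s) =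
        mittagLefflerE β (c * σ s) * ρ s := fun s => ?_
    · simpa only [h3] using h1
    have h2 := (hasSum_mittagLefflerE hβ (c * σ s)).mul_right (ρ s)
    refine Eq.trans (tsum_congr fun j => ?_) h2.tsum_eq
    rw [mul_pow]
    ring
  · refine Summable.of_nonneg_of_le (fun j => integral_nonneg fun s => norm_nonneg _) (fun j => ?_)
      ((summable_mittagLeffler hβ (|c| * |M|)).mul_right (∫ s, ‖ρ s‖ ∂ν))
    rw [← integral_const_mul]
    refine integral_mono ((hint j).const_mul _).norm (hρ.norm.const_mul _) fun s => ?_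
    have h3 := Gamma_one_add_pos hβ j
    simp only
    rw [norm_mul, norm_div, norm_pow, Real.norm_of_nonneg h3.le, mul_pow, Real.norm_eq_abs c,
      mul_div_right_comm, mul_assoc]
    exact mul_le_mul_of_nonneg_left (hle j s) (by positivity)

/-- The solution of the equation in the spectral domain, tested against a function on which the
symbol is bounded. -/
lemma IsMeanSquareSolution.integral_mul_conj_eq {Ω : Type*} [MeasurableSpace Ω] {P : Measure Ω}
    [IsProbabilityMeasure P] {ξ : ℝ → Ω → ℝ} {f : ℝ → ℝ} {α β γ μ : ℝ} {u : ℝ → ℝ → Ω → ℝ}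
    (hβ0 : 0 < β) (hμ : 0 ≤ μ) (hξ : IsGaussianProcess ξ P)
    (hξ0 : ∀ x, ∫ ω, ξ x ω ∂P = 0) (hf : HasSpectralDensity P ξ f)
    (hu : IsMeanSquareSolution P ξ f α β γ μ u) {φ : ℝ → ℂ} {M : ℝ}
    (hφ : MemLp φ 2 (spectralMeasure f)) (hM : ∀ s, φ s = 0 ∨ symbol α γ s ≤ M)
    {t : ℝ} (ht : 0 < t) {g : ℝ → ℂ} (hg : IsSpectralIntegral P ξ f g (u t 0)) :
    (∫ s, g s * (starRingEnd ℂ) (φ s) ∂(spectralMeasure f)).re =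
      ∫ s, solutionSymbol α β γ μ t s * (φ s).re ∂(spectralMeasure f) := by
  have hfin := hf.isFiniteMeasure
  set ν := spectralMeasure f with hν
  have hI := hf.isIsometricFamily hξ hξ0
  have hMem : ∀ k : ℕ, MemLp (fun s => (symbol α γ s : ℂ) ^ k * φ s) 2 ν := fun k => by
    refine MemLp.of_le_mul (c := |M| ^ k) hφ
      (((Complex.measurable_ofReal.comp (measurable_symbol α γ)).pow_const
        k).aestronglyMeasurable.mul hφ.1) (Eventually.of_forall fun s => ?_)
    rw [norm_mul, norm_pow, Complex.norm_real, Real.norm_of_nonneg (symbol_nonneg _ _ _)]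
    rcases hM s with h | h
    · simp [h]
    · have := h.trans (le_abs_self M)
      have := symbol_nonneg α γ s
      gcongr
  -- The test functions `σ^k φ` let multiplication by the symbol be moved from the solution to the
  -- test function. They grow at most like `|M|^k` because `σ ≤ M` where `φ ≠ 0`.
  set Φ : ℕ → Lp ℂ 2 ν := fun k => (hMem k).toLp _ with hΦ
  have hΦn : ∀ k, ‖Φ k‖ ≤ |M| ^ k * ‖Φ 0‖ := fun k => by
    refine Lp.norm_le_mul_norm_of_ae_le_mul ?_
    filter_upwards [(hMem k).coeFn_toLp, (hMem 0).coeFn_toLp] with s h1 h2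
    rw [hΦ]
    simp only
    rw [h1, h2, pow_zero, one_mul, norm_mul, norm_pow, Complex.norm_real,
      Real.norm_of_nonneg (symbol_nonneg _ _ _)]
    rcases hM s with h | h
    · simp [h]
    · have := h.trans (le_abs_self M)
      have := symbol_nonneg α γ s
      gcongr
  -- The pairing with `Φ k` is realized as a continuous functional on random variables, to which the
  -- time derivative in mean square can be transferred.
  choose ℓ hℓ using fun k => hI.exists_dual (Φ k)
  set Λ : ℕ → Lp ℝ 2 P →L[ℝ] ℝ := fun k =>
    Complex.reCLM.comp (((ℓ k).restrictScalars ℝ).comp (complexify P)) with hΛ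
  have hΛval : ∀ k (g : ℝ → ℂ) (η : Ω → ℝ) (h : IsSpectralIntegral P ξ f g η),
      Λ k (toL2 P η) = (inner ℂ (Φ k) (h.1.toLp g)).re := fun k g η h => by
    have h1 := hℓ k _ (hI.mem_graph h)
    change (ℓ k (complexify P (toL2 P η))).re = _
    rw [complexify_toL2 (memLp_of_memLp_ofReal h.2.1) h.2.1, h1]
  have hinit : IsSpectralIntegral P ξ f (fun _ => 1) (u 0 0) := by
    refine ⟨memLp_const _, (hu.memLp 0 0 le_rfl).ofReal, fun δ hδ => ⟨Finsupp.single 0 1, ?_, ?_⟩⟩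
    · simp [character_zero_left, hδ]
    · rw [eLpNorm_congr_ae (g := fun _ => (0 : ℂ))]
      · simpa using hδ
      · filter_upwards [hu.initial 0] with ω hω
        simp [hω]
  have hrep : ∀ s, 0 ≤ s → ∃ g, IsSpectralIntegral P ξ f g (u s 0) := fun s hs => by
    rcases hs.eq_or_lt with rfl | hs
    · exact ⟨_, hinit⟩
    · obtain ⟨ζ, ⟨g, hg⟩, -⟩ := hu.equation s hs
      exact ⟨_, (hg 0).1⟩
  have hcont := hu.continuous 0
  -- The symbol is real, so pairing `Φ k` with `σ g_s` is pairing `Φ (k+1)` with `g_s`: the `k`-th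
  -- equation has the `(k+1)`-st pairing on its right-hand side.
  have hode : ∀ k s, 0 < s → HasFractionalDerivAt β (fun τ => Λ k (toL2 P (u τ 0)))
      (-μ * Λ (k + 1) (toL2 P (u s 0))) s := fun k s hs => by
    obtain ⟨ζ, ⟨g, hg⟩, hd⟩ := hu.equation s hs
    have h1 := (hd 0).clm_comp (Λ k) hcont hs
    obtain ⟨hg1, hg2⟩ := hg 0
    rw [map_smul, smul_eq_mul, hΛval k _ _ hg2, inner_toLp] at h1
    rw [hΛval (k + 1) _ _ hg1, inner_toLp]
    convert h1 using 4
    ext r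
    simp only [map_mul, map_pow, Complex.conj_ofReal]
    ring
  have hbdd : ∀ T, ∃ C, ∀ k, ∀ s ∈ Set.Icc 0 T, |Λ k (toL2 P (u s 0))| ≤ C * |M| ^ k := by
    intro T
    obtain ⟨C, hC⟩ := (isCompact_Icc (a := 0) (b := T)).exists_bound_of_continuousOn
      (((complexify P).continuous.comp_continuousOn hcont).mono Set.Icc_subset_Ici_self)
    refine ⟨‖Φ 0‖ * C, fun k s hs => ?_⟩
    obtain ⟨g, hg⟩ := hrep s hs.1
    have h1 := hC s hs
    simp only [Function.comp] at h1
    rw [complexify_toL2 (memLp_of_memLp_ofReal hg.2.1) hg.2.1] at h1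
    have h2 := hI.norm_eq (hI.mem_graph hg)
    rw [hΛval k _ _ hg]
    calc |(inner ℂ (Φ k) (hg.1.toLp g)).re| ≤ ‖inner ℂ (Φ k) (hg.1.toLp g)‖ :=
          Complex.abs_re_le_norm _
      _ ≤ ‖Φ k‖ * ‖hg.1.toLp g‖ := norm_inner_le_norm _ _
      _ ≤ (|M| ^ k * ‖Φ 0‖) * C := by
          rw [← h2]
          gcongr
          exact hΦn k
      _ = _ := by ring
  have hsum := hasSum_of_hasFractionalDerivAt hβ0 hμ
    (fun k => (Λ k).continuous.comp_continuousOn hcont) hode hbdd ht.le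
  simp only [Function.comp] at hsum
  have hsum2 := hasSum_integral_mittagLefflerE_mul (c := -(μ * t ^ β)) (M := M) hβ0 (ν := ν)
    (measurable_symbol α γ) (hφ.integrable (by norm_num)).re (fun s => by
      rcases hM s with h | h
      · left; simp [h]
      · right; rwa [abs_of_nonneg (symbol_nonneg _ _ _)])
  have h0 := hΛval 0 _ _ hg
  rw [inner_toLp] at h0
  simp only [pow_zero, one_mul] at h0
  rw [← h0]
  refine hsum.unique ?_
  -- The initial integrand is the constant `1`, so the initial values of the hierarchy are the
  -- moments `∫ σ^j Re φ`, and both series coincide term by term.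
  convert hsum2 using 1
  · ext j
    have hj := hΛval j _ _ hinit
    rw [inner_toLp] at hj
    rw [hj]
    have h3 : (∫ s, (1 : ℂ) * (starRingEnd ℂ) ((symbol α γ s : ℂ) ^ j * φ s) ∂ν).re =
        ∫ s, symbol α γ s ^ j * RCLike.re (φ s) ∂ν := by
      have h4 : ∫ s, RCLike.re ((1 : ℂ) * (starRingEnd ℂ) ((symbol α γ s : ℂ) ^ j * φ s)) ∂ν =
          RCLike.re (∫ s, (1 : ℂ) * (starRingEnd ℂ) ((symbol α γ s : ℂ) ^ j * φ s) ∂ν) := by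
        refine integral_re ?_
        simp only [one_mul]
        exact (LinearIsometryEquiv.integrable_comp_iff Complex.conjLIE).2
          ((hMem j).integrable (by norm_num))
      refine h4.symm.trans (integral_congr_ae (Eventually.of_forall fun s => ?_))
      simp [← Complex.ofReal_pow]
    rw [h3, neg_pow, neg_pow (μ * t ^ β), mul_pow, Real.rpow_mul ht.le, Real.rpow_natCast]
    ring
  · refine integral_congr_ae (Eventually.of_forall fun s => ?_)
    simp only [solutionSymbol, RCLike.re_to_complex]
    congr 2
    ring

/-- Mean-square solutions have the expected spectral representation. -/
lemma IsMeanSquareSolution.mem_graph {Ω : Type*} [MeasurableSpace Ω] {P : Measure Ω}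
    [IsProbabilityMeasure P] {ξ : ℝ → Ω → ℝ} {f : ℝ → ℝ} {α β γ μ : ℝ} {u : ℝ → ℝ → Ω → ℝ}
    (hα : 0 ≤ α) (hγ : 0 ≤ γ) (hβ0 : 0 < β) (hβ1 : β ≤ 1) (hμ : 0 ≤ μ)
    (hI : IsIsometricFamily P (spectralMeasure f) character (fun x ω => (ξ x ω : ℂ)))
    (hξ : IsGaussianProcess ξ P) (hξ0 : ∀ x, ∫ ω, ξ x ω ∂P = 0) (hf : HasSpectralDensity P ξ f)
    (hu : IsMeanSquareSolution P ξ f α β γ μ u) {t : ℝ} (ht : 0 < t) (x : ℝ)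
    (hG : MemLp (fun s => character x s * (solutionSymbol α β γ μ t s : ℂ)) 2 (spectralMeasure f))
    (hU : MemLp (fun ω => (u t x ω : ℂ)) 2 P) : (hG.toLp _, hU.toLp _) ∈ hI.graph := by
  have hfin := hf.isFiniteMeasure
  set ν := spectralMeasure f with hν
  obtain ⟨ζ, ⟨g, hg⟩, -⟩ := hu.equation t ht
  have hg0 : IsSpectralIntegral P ξ f g (u t 0) := by
    have := (hg 0).1
    simpa only [character_zero_left, one_mul] using this
  have hE : MemLp (fun s => (solutionSymbol α β γ μ t s : ℂ)) 2 ν := by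
    have := memLp_character_mul_solutionSymbol (α := α) (γ := γ) hβ0 hβ1 hμ ht.le (ν := ν) 0
    simpa only [character_zero_left, one_mul] using this
  -- Testing with the difference `D` itself, truncated to `|s| ≤ R` so that the symbol is bounded,
  -- gives `∫ |D|² = 0` on each ball. The point `x = 0` suffices because `g` does not depend on `x`.
  have hae : g =ᵐ[ν] fun s => (solutionSymbol α β γ μ t s : ℂ) := by
    set D : ℝ → ℂ := fun s => g s - (solutionSymbol α β γ μ t s : ℂ) with hD
    have hDm : MemLp D 2 ν := hg0.1.sub hE
    have key : ∀ R : ℕ, ∀ᵐ s ∂ν, |s| ≤ (R : ℝ) → D s = 0 := by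
      intro R
      set B : Set ℝ := {s | |s| ≤ R} with hB
      have hBm : MeasurableSet B := measurableSet_le (by fun_prop) measurable_const
      set φ : ℝ → ℂ := B.indicator D with hφdef
      have hφ : MemLp φ 2 ν := hDm.indicator hBm
      have h1 := hu.integral_mul_conj_eq hβ0 hμ hξ hξ0 hf (M := symbol α γ R) hφ (fun s => by
        by_cases hs : s ∈ B
        · exact Or.inr (symbol_le_symbol hα hγ hs)
        · exact Or.inl (Set.indicator_of_notMem hs D)) ht hg0
      have hi1 : Integrable (fun s => g s * (starRingEnd ℂ) (φ s)) ν :=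
        hg0.1.integrable_mul hφ.star
      have hi2 : Integrable (fun s => (solutionSymbol α β γ μ t s : ℂ) *
          (starRingEnd ℂ) (φ s)) ν := hE.integrable_mul hφ.star
      have h2 : ∫ s, solutionSymbol α β γ μ t s * (φ s).re ∂ν =
          (∫ s, (solutionSymbol α β γ μ t s : ℂ) * (starRingEnd ℂ) (φ s) ∂ν).re := by
        refine Eq.trans ?_ (integral_re hi2)
        refine integral_congr_ae (Eventually.of_forall fun s => ?_)
        simp
      rw [h2, ← sub_eq_zero, ← Complex.sub_re, ← integral_sub hi1 hi2] at h1
      have h3 : ∀ s, g s * (starRingEnd ℂ) (φ s) - (solutionSymbol α β γ μ t s : ℂ) *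
          (starRingEnd ℂ) (φ s) = ((‖φ s‖ ^ 2 : ℝ) : ℂ) := fun s => by
        rw [← sub_mul]
        by_cases hs : s ∈ B
        · rw [hφdef, Set.indicator_of_mem hs, Complex.mul_conj, Complex.normSq_eq_norm_sq]
        · rw [hφdef, Set.indicator_of_notMem hs]; simp
      simp_rw [h3] at h1
      rw [integral_complex_ofReal, Complex.ofReal_re, integral_eq_zero_iff_of_nonneg
        (fun s => by positivity) hφ.integrable_norm_pow'] at h1
      filter_upwards [h1] with s hs hsR
      have h4 : ‖φ s‖ ^ 2 = 0 := hs
      rw [hφdef, Set.indicator_of_mem (show s ∈ B from hsR)] at h4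
      simpa using h4
    filter_upwards [ae_all_iff.2 key] with s hs
    obtain ⟨R, hR⟩ := exists_nat_ge |s|
    exact sub_eq_zero.1 (hs R hR)
  have h1 := hI.mem_graph (hg x).1
  have h2 : (hg x).1.1.toLp _ = hG.toLp _ := by
    refine (MemLp.toLp_eq_toLp_iff _ _).2 ?_
    filter_upwards [hae] with s hs
    rw [hs]
  rwa [h2] at h1

/-! ### The limit of the covariances -/

/-- The product of two relaxation factors with rates `a₁`, `a₂`. -/
def relaxProd (β a₁ a₂ y : ℝ) : ℝ := mittagLefflerE β (-(a₁ * y)) * mittagLefflerE β (-(a₂ * y))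

section RelaxProd

variable {β a₁ a₂ : ℝ}

lemma continuous_relaxProd (hβ0 : 0 < β) : Continuous (relaxProd β a₁ a₂) := by
  have := continuous_mittagLefflerE hβ0
  unfold relaxProd
  fun_prop

lemma relaxProd_pos (hβ0 : 0 < β) (hβ1 : β ≤ 1) (h1 : 0 ≤ a₁) (h2 : 0 ≤ a₂) {y : ℝ} (hy : 0 ≤ y) :
    0 < relaxProd β a₁ a₂ y :=
  mul_pos (mittagLefflerE_neg_pos hβ0 hβ1 (by positivity))
    (mittagLefflerE_neg_pos hβ0 hβ1 (by positivity))

lemma relaxProd_le_one (hβ0 : 0 < β) (hβ1 : β ≤ 1) (h1 : 0 ≤ a₁) (h2 : 0 ≤ a₂) {y : ℝ}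
    (hy : 0 ≤ y) : relaxProd β a₁ a₂ y ≤ 1 :=
  mul_le_one₀ ((le_abs_self _).trans (abs_mittagLefflerE_neg_le_one hβ0 hβ1 (by positivity)))
    (mittagLefflerE_neg_pos hβ0 hβ1 (by positivity)).le
    ((le_abs_self _).trans (abs_mittagLefflerE_neg_le_one hβ0 hβ1 (by positivity)))

/-- The hyperbolic bound is combined with `r^q ≤ 1 + r^α ≤ 1 + y`; the exponent `q` may be any value
up to `α`. -/
lemma mittagLefflerE_neg_le_rpow (hβ0 : 0 < β) (hβ1 : β ≤ 1) {a α q r y : ℝ} (ha : 0 < a)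
    (hq : 0 ≤ q) (hqα : q ≤ α) (hr : 0 < r) (hy : r ^ α ≤ y) :
    mittagLefflerE β (-(a * y)) ≤ (1 + Real.Gamma (1 + β) / a) * r ^ (-q) := by
  have hG := Real.Gamma_pos_of_pos (by linarith : 0 < 1 + β)
  have hrα : 0 < r ^ α := Real.rpow_pos_of_pos hr _
  have hy0 : 0 < y := hrα.trans_le hy
  refine (mittagLefflerE_neg_le hβ0 hβ1 (by positivity)).trans ?_
  set G := Real.Gamma (1 + β)
  rw [Real.rpow_neg hr.le, ← div_eq_mul_inv, div_le_div_iff₀ (by positivity) (by positivity),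
    one_mul]
  have h0 : r ^ q ≤ 1 + y := by
    rcases le_total r 1 with h | h
    · linarith [Real.rpow_le_one hr.le h hq]
    · linarith [Real.rpow_le_rpow_of_exponent_le h hqα]
  have h1 : (1 + G / a) * (1 + a * y / G) = 1 + y + G / a + a * y / G := by field_simp; ring
  rw [h1]
  have : 0 ≤ G / a + a * y / G := by positivity
  linarith

lemma relaxProd_le_rpow (hβ0 : 0 < β) (hβ1 : β ≤ 1) {α p r y : ℝ} (h1 : 0 < a₁) (h2 : 0 < a₂)
    (hp : 0 ≤ p) (hpα : p ≤ 2 * α) (hr : 0 < r) (hy : r ^ α ≤ y) :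
    relaxProd β a₁ a₂ y ≤
      (1 + Real.Gamma (1 + β) / a₁) * (1 + Real.Gamma (1 + β) / a₂) * r ^ (-p) := by
  have hG := Real.Gamma_pos_of_pos (by linarith : 0 < 1 + β)
  have hy0 : 0 ≤ y := (Real.rpow_nonneg hr.le _).trans hy
  have e1 := mittagLefflerE_neg_le_rpow hβ0 hβ1 h1 (q := p / 2) (by linarith)
    (by linarith) hr hy
  have e2 := mittagLefflerE_neg_le_rpow hβ0 hβ1 h2 (q := p / 2) (by linarith) (by linarith) hr hy
  calc relaxProd β a₁ a₂ y ≤ ((1 + Real.Gamma (1 + β) / a₁) * r ^ (-(p / 2))) *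
        ((1 + Real.Gamma (1 + β) / a₂) * r ^ (-(p / 2))) :=
        mul_le_mul e1 e2 (mittagLefflerE_neg_pos hβ0 hβ1 (by positivity)).le (by positivity)
    _ = (1 + Real.Gamma (1 + β) / a₁) * (1 + Real.Gamma (1 + β) / a₂) *
        (r ^ (-(p / 2)) * r ^ (-(p / 2))) := by ring
    _ = _ := by rw [← Real.rpow_add hr]; ring_nf

end RelaxProd

lemma integrable_comp_abs {g : ℝ → ℝ} (hg : IntegrableOn g (Set.Ioi 0)) :
    Integrable fun s => g |s| := by
  have h1 : IntegrableOn (fun s => g |s|) (Set.Ioi 0) :=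
    hg.congr_fun (fun s hs => by rw [abs_of_pos hs]) measurableSet_Ioi
  have h2 : IntegrableOn (fun s => g |s|) (Set.Iic 0) := by
    rw [integrableOn_Iic_iff_integrableOn_Iio]
    have h3 := h1.comp_neg
    simpa using h3
  rw [← integrableOn_univ, ← Set.Iic_union_Ioi (a := (0 : ℝ))]
  exact h2.union h1

/-- A function with different powers near zero and near infinity. -/
def twoPower (a b r : ℝ) : ℝ := if r ≤ 1 then r ^ a else r ^ b

lemma integrable_twoPower_abs {a b : ℝ} (ha : -1 < a) (hb : b < -1) :
    Integrable fun s => twoPower a b |s| := by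
  refine integrable_comp_abs ?_
  rw [← Set.Ioc_union_Ioi_eq_Ioi (zero_le_one' ℝ)]
  refine IntegrableOn.union ?_ ?_
  · have h1 : IntegrableOn (fun r : ℝ => r ^ a) (Set.Ioc 0 1) :=
      (intervalIntegral.intervalIntegrable_rpow' ha (a := 0) (b := 1)).1
    exact h1.congr_fun (fun r hr => by simp [twoPower, hr.2]) measurableSet_Ioc
  · exact (integrableOn_Ioi_rpow_of_lt hb one_pos).congr_fun
      (fun r hr => by simp [twoPower, not_le.2 (show (1 : ℝ) < r from hr)]) measurableSet_Ioi

/-- This is the shape of the majorant: Potter's factor costs `η` in the exponent at both ends, and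
`M ≤ 1` is used near zero, `M ≤ K r^{-p}` near infinity. -/
lemma rpow_mul_add_mul_le_twoPower {κ η p r M K : ℝ} (hη : 0 ≤ η) (hr : 0 < r) (hM0 : 0 ≤ M)
    (hK : 1 ≤ K) (hM1 : M ≤ 1) (hM : M ≤ K * r ^ (-p)) :
    r ^ (κ - 1) * (r ^ η + r ^ (-η)) * M ≤ 2 * K * twoPower (κ - 1 - η) (κ - 1 + η - p) r := by
  have hr0 := hr.le
  unfold twoPower
  split_ifs with h
  · have h1 : r ^ η ≤ r ^ (-η) := Real.rpow_le_rpow_of_exponent_ge hr h (by linarith)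
    calc r ^ (κ - 1) * (r ^ η + r ^ (-η)) * M ≤ r ^ (κ - 1) * (r ^ (-η) + r ^ (-η)) * K := by
          gcongr
          exact hM1.trans hK
      _ = 2 * K * (r ^ (κ - 1) * r ^ (-η)) := by ring
      _ = _ := by rw [← Real.rpow_add hr, sub_eq_add_neg _ η]
  · have h1 : r ^ (-η) ≤ r ^ η := Real.rpow_le_rpow_of_exponent_le (not_le.1 h).le (by linarith)
    calc r ^ (κ - 1) * (r ^ η + r ^ (-η)) * M
        ≤ r ^ (κ - 1) * (r ^ η + r ^ η) * (K * r ^ (-p)) := by gcongr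
      _ = 2 * K * (r ^ (κ - 1) * r ^ η * r ^ (-p)) := by ring
      _ = _ := by rw [← Real.rpow_add hr, ← Real.rpow_add hr, sub_eq_add_neg _ p]

lemma rpow_abs_div_le_symbol {α γ δ s : ℝ} (hγ : 0 ≤ γ) (hδ : 0 < δ) :
    (|s| / δ) ^ α ≤ symbol α γ s * δ ^ (-α) := by
  have h1 : 1 ≤ (1 + s ^ 2) ^ (γ / 2) :=
    Real.one_le_rpow (by linarith [sq_nonneg s]) (by linarith)
  rw [Real.div_rpow (abs_nonneg s) hδ.le, Real.rpow_neg hδ.le, div_eq_mul_inv, symbol]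
  have : 0 ≤ |s| ^ α := by positivity
  gcongr
  exact le_mul_of_one_le_right this h1

lemma symbol_mul_scaled {α γ δ r : ℝ} (hδ : 0 < δ) :
    symbol α γ (δ * r) * δ ^ (-α) = |r| ^ α * (1 + (δ * r) ^ 2) ^ (γ / 2) := by
  rw [symbol, abs_mul, abs_of_pos hδ, Real.mul_rpow hδ.le (abs_nonneg r), Real.rpow_neg hδ.le]
  have := (Real.rpow_pos_of_pos hδ α).ne'
  field_simp

/-- A slowly varying function decays slower than any power. -/
lemma IsSlowlyVarying.tendsto_rpow_div {L : ℝ → ℝ} (hL : IsSlowlyVarying L) {q : ℝ} (hq : 0 < q) :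
    Tendsto (fun δ : ℝ => δ ^ q / L δ⁻¹) (𝓝[>] 0) (𝓝 0) := by
  -- Comparing `L(1/δ)` with the fixed value `L X` at exponent `q/2` bounds `1 / L(1/δ)` by a
  -- multiple of `δ^{-q/2}` up to smaller terms.
  obtain ⟨X, hX, hpos, -, hpot⟩ := hL.potter (half_pos hq)
  have hbound : ∀ᶠ δ : ℝ in 𝓝[>] 0, X ≤ δ⁻¹ ∧ 0 < δ := by
    refine (tendsto_inv_nhdsGT_zero.eventually_ge_atTop X).and self_mem_nhdsWithin
  have hlim : Tendsto (fun δ : ℝ => Real.exp (q / 2) / L X *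
      (δ ^ (q + q / 2) * X ^ (q / 2) + δ ^ (q / 2) * X ^ (-(q / 2)))) (𝓝[>] 0) (𝓝 0) := by
    have hc : Continuous (fun δ : ℝ => Real.exp (q / 2) / L X *
      (δ ^ (q + q / 2) * X ^ (q / 2) + δ ^ (q / 2) * X ^ (-(q / 2)))) :=
      continuous_const.mul (((Real.continuous_rpow_const (by linarith)).mul continuous_const).add
        ((Real.continuous_rpow_const (by linarith)).mul continuous_const))
    have := (hc.tendsto 0).mono_left (nhdsWithin_le_nhds (s := Set.Ioi 0))
    simpa [Real.zero_rpow (by linarith : q + q / 2 ≠ 0), Real.zero_rpow (by linarith : q / 2 ≠ 0)]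
      using this
  refine tendsto_of_tendsto_of_tendsto_of_le_of_le' tendsto_const_nhds hlim ?_ ?_
  · filter_upwards [hbound] with δ hδ
    have := hpos _ hδ.1
    have := hδ.2
    positivity
  · filter_upwards [hbound] with δ ⟨h1, h2⟩
    have hLδ := hpos _ h1
    have hLX := hpos X le_rfl
    have h3 := hpot _ _ h1 le_rfl
    rw [div_inv_eq_mul, Real.mul_rpow hX.le h2.le, Real.mul_rpow hX.le h2.le,
      div_le_iff₀ hLδ] at h3
    rw [div_le_iff₀ hLδ]
    have h4 : δ ^ q ≤ δ ^ q * ((Real.exp (q / 2) * (X ^ (q / 2) * δ ^ (q / 2) +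
        X ^ (-(q / 2)) * δ ^ (-(q / 2))) * L δ⁻¹) / L X) :=
      le_mul_of_one_le_right (by positivity) ((one_le_div hLX).2 h3)
    refine h4.trans_eq ?_
    have h5 : δ ^ q * δ ^ (-(q / 2)) = δ ^ (q / 2) := by
      rw [← Real.rpow_add h2]; ring_nf
    rw [Real.rpow_add h2, ← h5]
    ring

/-- The oscillating product of two relaxation factors at scale `δ`. -/
def scaledFactor (α β γ a₁ a₂ x δ s : ℝ) : ℂ :=
  character (x / δ) s * (relaxProd β a₁ a₂ (symbol α γ s * δ ^ (-α)) : ℂ)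

section CovarianceLimit

variable {α β γ κ a₁ a₂ : ℝ}

lemma measurable_scaledFactor (hβ0 : 0 < β) (x δ : ℝ) :
    Measurable (scaledFactor α β γ a₁ a₂ x δ) := by
  have h1 := measurable_symbol α γ
  refine (continuous_character _).measurable.mul (Complex.measurable_ofReal.comp ?_)
  exact (continuous_relaxProd hβ0).measurable.comp (h1.mul_const _)

lemma norm_scaledFactor (hβ0 : 0 < β) (hβ1 : β ≤ 1) (h1 : 0 ≤ a₁) (h2 : 0 ≤ a₂) (x : ℝ) {δ : ℝ}
    (hδ : 0 < δ) (s : ℝ) : ‖scaledFactor α β γ a₁ a₂ x δ s‖ =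
      relaxProd β a₁ a₂ (symbol α γ s * δ ^ (-α)) := by
  have := symbol_nonneg α γ s
  rw [scaledFactor, norm_mul, norm_character, one_mul, Complex.norm_real,
    Real.norm_of_nonneg (relaxProd_pos hβ0 hβ1 h1 h2 (by positivity)).le]

lemma norm_scaledFactor_le_rpow (hβ0 : 0 < β) (hβ1 : β ≤ 1) (hγ : 0 ≤ γ) (h1 : 0 < a₁)
    (h2 : 0 < a₂) {p : ℝ} (hp : 0 ≤ p) (hpα : p ≤ 2 * α) (x : ℝ) {δ : ℝ} (hδ : 0 < δ) {s : ℝ}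
    (hs : s ≠ 0) : ‖scaledFactor α β γ a₁ a₂ x δ s‖ ≤
      (1 + Real.Gamma (1 + β) / a₁) * (1 + Real.Gamma (1 + β) / a₂) * (|s| ^ (-p) * δ ^ p) := by
  rw [norm_scaledFactor hβ0 hβ1 h1.le h2.le x hδ]
  have h3 := relaxProd_le_rpow (r := |s| / δ) hβ0 hβ1 h1 h2 hp hpα
    (div_pos (abs_pos.2 hs) hδ) (rpow_abs_div_le_symbol (α := α) (s := s) hγ hδ)
  rwa [Real.div_rpow (abs_nonneg s) hδ.le, Real.rpow_neg hδ.le p, div_inv_eq_mul] at h3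

lemma ae_ne_zero : ∀ᵐ s : ℝ, s ≠ 0 := by
  simp [ae_iff, measure_singleton]

/-- The part of the spectral density without the main singularity does not contribute. -/
lemma tendsto_remainder {L R : ℝ → ℝ} (hL : IsSlowlyVarying L) (hβ0 : 0 < β) (hβ1 : β ≤ 1)
    (hγ : 0 ≤ γ) (h1 : 0 < a₁) (h2 : 0 < a₂) {p : ℝ} (hp : 0 ≤ p) (hκp : κ < p) (hpα : p ≤ 2 * α)
    (x : ℝ) (hR : Integrable fun s => |s| ^ (-p) * R s) :
    Tendsto (fun δ : ℝ => ((δ ^ (-κ) / L δ⁻¹ : ℝ) : ℂ) *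
      ∫ s, (R s : ℂ) * scaledFactor α β γ a₁ a₂ x δ s) (𝓝[>] 0) (𝓝 0) := by
  set K := (1 + Real.Gamma (1 + β) / a₁) * (1 + Real.Gamma (1 + β) / a₂)
  set I := ∫ s, ‖|s| ^ (-p) * R s‖
  have hlim := ((hL.tendsto_rpow_div (sub_pos.2 hκp)).norm.mul_const (K * I))
  rw [norm_zero, zero_mul] at hlim
  refine squeeze_zero_norm' ?_ hlim
  filter_upwards [self_mem_nhdsWithin] with δ hδ
  have hδ : 0 < δ := hδ
  have hb : ‖∫ s, (R s : ℂ) * scaledFactor α β γ a₁ a₂ x δ s‖ ≤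
      ∫ s, K * δ ^ p * ‖|s| ^ (-p) * R s‖ := by
    refine norm_integral_le_of_norm_le (hR.norm.const_mul _) (ae_ne_zero.mono fun s hs => ?_)
    have h3 := norm_scaledFactor_le_rpow (s := s) hβ0 hβ1 hγ h1 h2 hp hpα x hδ hs
    rw [norm_mul, Complex.norm_real, norm_mul,
      Real.norm_of_nonneg (Real.rpow_nonneg (abs_nonneg s) (-p))]
    calc ‖R s‖ * ‖scaledFactor α β γ a₁ a₂ x δ s‖ ≤ ‖R s‖ * (K * (|s| ^ (-p) * δ ^ p)) := by gcongr
      _ = _ := by ring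
  rw [integral_const_mul] at hb
  rw [norm_mul, Complex.norm_real]
  calc ‖δ ^ (-κ) / L δ⁻¹‖ * ‖∫ s, (R s : ℂ) * scaledFactor α β γ a₁ a₂ x δ s‖
      ≤ ‖δ ^ (-κ) / L δ⁻¹‖ * (K * δ ^ p * I) := by gcongr
    _ = _ := by
        rw [norm_div, norm_div, Real.norm_of_nonneg (Real.rpow_nonneg hδ.le _),
          Real.norm_of_nonneg (Real.rpow_nonneg hδ.le _), sub_eq_add_neg, Real.rpow_add hδ]
        ring

/-- The singular part of the spectral density, localized at distance less than `ρ` of zero. -/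
def singularPart (C₀ κ ρ X : ℝ) (B L : ℝ → ℝ) : ℝ → ℝ :=
  {s : ℝ | 0 < |s| ∧ |s| < ρ}.indicator
    fun s => C₀ * (B s * |s| ^ (κ - 1) * (Set.Ici X).indicator L (1 / |s|))

lemma measurable_singularPart {C₀ ρ X : ℝ} {B L : ℝ → ℝ} (hB : Continuous B)
    (hL : Measurable ((Set.Ici X).indicator L)) : Measurable (singularPart C₀ κ ρ X B L) := by
  refine Measurable.indicator (((hB.measurable.mul ?_).mul (hL.comp ?_)).const_mul _) ?_
  · exact Measurable.pow_const measurable_abs _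
  · exact measurable_const.div measurable_abs
  · exact (measurableSet_lt measurable_const measurable_abs).inter
      (measurableSet_lt measurable_abs measurable_const)

/-- The truncation of `L`, present for measurability, is invisible here: `|s| < ρ ≤ 1/X` forces
`1/|s| ≥ X`. -/
lemma singularPart_apply {C₀ ρ X s : ℝ} {B L : ℝ → ℝ} (hX : 0 < X) (hρ : ρ ≤ 1 / X) (h0 : 0 < |s|)
    (h1 : |s| < ρ) :
    singularPart C₀ κ ρ X B L s = C₀ * (B s * |s| ^ (κ - 1) * L (1 / |s|)) := by
  rw [singularPart, Set.indicator_of_mem (show s ∈ {s : ℝ | 0 < |s| ∧ |s| < ρ} from ⟨h0, h1⟩),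
    Set.indicator_of_mem]
  rw [Set.mem_Ici, le_one_div hX h0]
  exact h1.le.trans hρ

lemma singularPart_apply_of_not {C₀ ρ X s : ℝ} {B L : ℝ → ℝ} (h : ¬ (0 < |s| ∧ |s| < ρ)) :
    singularPart C₀ κ ρ X B L s = 0 :=
  Set.indicator_of_notMem (s := {s : ℝ | 0 < |s| ∧ |s| < ρ}) h _

lemma scaled_singularPart {C₀ ρ X δ r x : ℝ} {B L : ℝ → ℝ} (hX : 0 < X) (hρ : ρ ≤ 1 / X)
    (hδ : 0 < δ) (h0 : 0 < |δ * r|) (h1 : |δ * r| < ρ) :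
    ((δ ^ (-κ) / L δ⁻¹ * δ : ℝ) : ℂ) * ((singularPart C₀ κ ρ X B L (δ * r) : ℂ) *
      scaledFactor α β γ a₁ a₂ x δ (δ * r)) =
    ((C₀ * B (δ * r) * |r| ^ (κ - 1) * (L (|r|⁻¹ * δ⁻¹) / L δ⁻¹) *
      relaxProd β a₁ a₂ (|r| ^ α * (1 + (δ * r) ^ 2) ^ (γ / 2)) : ℝ) : ℂ) * character x r := by
  have hc : character (x / δ) (δ * r) = character x r := by
    rw [character, character]
    congr 1
    push_cast
    have : (δ : ℂ) ≠ 0 := Complex.ofReal_ne_zero.2 hδ.ne'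
    field_simp
  rw [singularPart_apply hX hρ h0 h1, scaledFactor, symbol_mul_scaled hδ, hc, abs_mul,
    abs_of_pos hδ, Real.mul_rpow hδ.le (abs_nonneg r), Real.rpow_sub_one hδ.ne', Real.rpow_neg hδ.le,
    show 1 / (δ * |r|) = |r|⁻¹ * δ⁻¹ by rw [one_div, mul_inv, mul_comm]]
  set M := relaxProd β a₁ a₂ (|r| ^ α * (1 + (δ * r) ^ 2) ^ (γ / 2))
  have h2 : (δ ^ κ)⁻¹ / L δ⁻¹ * δ *
      (C₀ * (B (δ * r) * (δ ^ κ / δ * |r| ^ (κ - 1)) * L (|r|⁻¹ * δ⁻¹))) * M =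
      C₀ * B (δ * r) * |r| ^ (κ - 1) * (L (|r|⁻¹ * δ⁻¹) / L δ⁻¹) * M := by
    have := (Real.rpow_pos_of_pos hδ κ).ne'
    field_simp
  rw [← h2]
  push_cast
  ring

/-- The contribution of the singular part of the spectral density. -/
lemma tendsto_singularPart {L B : ℝ → ℝ} (hL : IsSlowlyVarying L) (hβ0 : 0 < β) (hβ1 : β ≤ 1)
    (hγ : 0 ≤ γ) (h1 : 0 < a₁) (h2 : 0 < a₂) {p η : ℝ} (hp : 0 ≤ p) (hpα : p ≤ 2 * α)
    (hη0 : 0 < η) (hηκ : η < κ) (hηp : κ + η < p)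
    {C₀ ρ X : ℝ} (hρ0 : 0 < ρ) (hX : 0 < X) (hρ : ρ ≤ 1 / X) (hpos : ∀ y, X ≤ y → 0 < L y)
    (hmeas : Measurable ((Set.Ici X).indicator L))
    (hpot : ∀ y z, X ≤ y → X ≤ z → L z / L y ≤ Real.exp η * ((z / y) ^ η + (z / y) ^ (-η)))
    (hB : Continuous B) (hB0 : B 0 = 1) (hB1 : ∀ s, |B s| ≤ 1) (x : ℝ) :
    Tendsto (fun δ : ℝ => ((δ ^ (-κ) / L δ⁻¹ : ℝ) : ℂ) *
      ∫ s, (singularPart C₀ κ ρ X B L s : ℂ) * scaledFactor α β γ a₁ a₂ x δ s) (𝓝[>] 0)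
      (𝓝 (∫ r, ((C₀ * |r| ^ (κ - 1) * relaxProd β a₁ a₂ (|r| ^ α) : ℝ) : ℂ) * character x r)) := by
  -- The integrand after `s = δ r`, with the Jacobian `δ` absorbed into the prefactor.
  set F : ℝ → ℝ → ℂ := fun δ r => ((δ ^ (-κ) / L δ⁻¹ * δ : ℝ) : ℂ) *
    ((singularPart C₀ κ ρ X B L (δ * r) : ℂ) * scaledFactor α β γ a₁ a₂ x δ (δ * r)) with hF
  set K := (1 + Real.Gamma (1 + β) / a₁) * (1 + Real.Gamma (1 + β) / a₂) with hK
  have hG := Real.Gamma_pos_of_pos (by linarith : 0 < 1 + β)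
  have hK1 : 1 ≤ K := by
    have e1 : 1 ≤ 1 + Real.Gamma (1 + β) / a₁ := by
      have : 0 < Real.Gamma (1 + β) / a₁ := by positivity
      linarith
    have e2 : 1 ≤ 1 + Real.Gamma (1 + β) / a₂ := by
      have : 0 < Real.Gamma (1 + β) / a₂ := by positivity
      linarith
    exact one_le_mul_of_one_le_of_one_le e1 e2
  have hsmall : ∀ᶠ δ : ℝ in 𝓝[>] 0, X ≤ δ⁻¹ ∧ 0 < δ :=
    (tendsto_inv_nhdsGT_zero.eventually_ge_atTop X).and self_mem_nhdsWithin
  have hmain : Tendsto (fun δ => ∫ r, F δ r) (𝓝[>] 0)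
      (𝓝 (∫ r, ((C₀ * |r| ^ (κ - 1) * relaxProd β a₁ a₂ (|r| ^ α) : ℝ) : ℂ) *
        character x r)) := by
    refine tendsto_integral_filter_of_dominated_convergence
      (fun r => |C₀| * Real.exp η * (2 * K * twoPower (κ - 1 - η) (κ - 1 + η - p) |r|)) ?_ ?_ ?_ ?_
    · refine Eventually.of_forall fun δ => Measurable.aestronglyMeasurable ?_
      have m1 := measurable_singularPart (κ := κ) (C₀ := C₀) (ρ := ρ) hB hmeas
      have m2 := measurable_scaledFactor (α := α) (γ := γ) (a₁ := a₁) (a₂ := a₂) hβ0 x δ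
      have m3 : Measurable fun r : ℝ => δ * r := by fun_prop
      exact ((Complex.measurable_ofReal.comp (m1.comp m3)).mul (m2.comp m3)).const_mul _
    · filter_upwards [hsmall] with δ ⟨hXδ, hδ⟩
      refine ae_ne_zero.mono fun r hr => ?_
      have hr0 : 0 < |r| := abs_pos.2 hr
      have htp : 0 ≤ twoPower (κ - 1 - η) (κ - 1 + η - p) |r| := by
        unfold twoPower; split_ifs <;> positivity
      by_cases hmem : 0 < |δ * r| ∧ |δ * r| < ρ
      · have hy1 : 1 ≤ (1 + (δ * r) ^ 2) ^ (γ / 2) :=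
          Real.one_le_rpow (by linarith [sq_nonneg (δ * r)]) (by linarith)
        have hy2 : |r| ^ α ≤ |r| ^ α * (1 + (δ * r) ^ 2) ^ (γ / 2) :=
          le_mul_of_one_le_right (by positivity) hy1
        have hy0 : 0 ≤ |r| ^ α * (1 + (δ * r) ^ 2) ^ (γ / 2) := by positivity
        have hM0 := (relaxProd_pos hβ0 hβ1 h1.le h2.le hy0).le
        have hM1 := relaxProd_le_one hβ0 hβ1 h1.le h2.le hy0
        have hM2 := relaxProd_le_rpow hβ0 hβ1 h1 h2 hp hpα hr0 hy2
        have hdr : X ≤ |r|⁻¹ * δ⁻¹ := by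
          rw [← mul_inv, mul_comm, ← abs_of_pos hδ, ← abs_mul, ← one_div, le_one_div hX hmem.1]
          exact hmem.2.le.trans hρ
        have hpt := hpot _ _ hXδ hdr
        rw [mul_div_cancel_right₀ _ (inv_pos.2 hδ).ne', Real.inv_rpow hr0.le,
          ← Real.rpow_neg hr0.le, Real.inv_rpow hr0.le, ← Real.rpow_neg hr0.le, neg_neg] at hpt
        have hL0 : 0 ≤ L (|r|⁻¹ * δ⁻¹) / L δ⁻¹ := (div_pos (hpos _ hdr) (hpos _ hXδ)).le
        rw [hF]
        simp only
        rw [scaled_singularPart hX hρ hδ hmem.1 hmem.2, norm_mul, norm_character, mul_one,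
          Complex.norm_real]
        set M := relaxProd β a₁ a₂ (|r| ^ α * (1 + (δ * r) ^ 2) ^ (γ / 2))
        have hfin := rpow_mul_add_mul_le_twoPower (κ := κ) hη0.le hr0 hM0 hK1 hM1 hM2
        rw [norm_mul, norm_mul, norm_mul, norm_mul, Real.norm_of_nonneg hM0,
          Real.norm_of_nonneg hL0, Real.norm_of_nonneg (Real.rpow_nonneg hr0.le _),
          Real.norm_eq_abs, Real.norm_eq_abs]
        have hBr := hB1 (δ * r)
        calc |C₀| * |B (δ * r)| * |r| ^ (κ - 1) * (L (|r|⁻¹ * δ⁻¹) / L δ⁻¹) * M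
            ≤ |C₀| * 1 * |r| ^ (κ - 1) * (Real.exp η * (|r| ^ (-η) + |r| ^ η)) * M := by gcongr
          _ = |C₀| * Real.exp η * (|r| ^ (κ - 1) * (|r| ^ η + |r| ^ (-η)) * M) := by ring
          _ ≤ _ := by gcongr
      · rw [hF]
        simp only
        rw [singularPart_apply_of_not hmem, Complex.ofReal_zero, zero_mul, mul_zero, norm_zero]
        positivity
    -- Integrability at zero needs `η < κ`, at infinity `κ + η < p`.
    · exact ((integrable_twoPower_abs (by linarith) (by linarith)).const_mul _).const_mul _
    · refine ae_ne_zero.mono fun r hr => ?_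
      have hr0 : 0 < |r| := abs_pos.2 hr
      have hid : Tendsto (fun δ : ℝ => δ) (𝓝[>] 0) (𝓝 0) := nhdsWithin_le_nhds
      have hdr : Tendsto (fun δ : ℝ => δ * r) (𝓝[>] 0) (𝓝 0) := by simpa using hid.mul_const r
      have hmem : ∀ᶠ δ : ℝ in 𝓝[>] 0, 0 < |δ * r| ∧ |δ * r| < ρ := by
        filter_upwards [self_mem_nhdsWithin,
          hdr.abs.eventually (gt_mem_nhds (show |(0 : ℝ)| < ρ by simpa using hρ0))] with δ hδ h3
        exact ⟨abs_pos.2 (mul_ne_zero (ne_of_gt hδ) hr), h3⟩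
      have hlim : Tendsto (fun δ : ℝ =>
          ((C₀ * B (δ * r) * |r| ^ (κ - 1) * (L (|r|⁻¹ * δ⁻¹) / L δ⁻¹) *
            relaxProd β a₁ a₂ (|r| ^ α * (1 + (δ * r) ^ 2) ^ (γ / 2)) : ℝ) : ℂ) * character x r)
          (𝓝[>] 0) (𝓝 (((C₀ * 1 * |r| ^ (κ - 1) * 1 * relaxProd β a₁ a₂ (|r| ^ α * 1) : ℝ) : ℂ) *
            character x r)) := by
        have l1 : Tendsto (fun δ : ℝ => B (δ * r)) (𝓝[>] 0) (𝓝 1) := by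
          rw [← hB0]; exact (hB.tendsto 0).comp hdr
        have l2 : Tendsto (fun δ : ℝ => L (|r|⁻¹ * δ⁻¹) / L δ⁻¹) (𝓝[>] 0) (𝓝 1) :=
          (hL.2 _ (inv_pos.2 hr0)).comp tendsto_inv_nhdsGT_zero
        have l3 : Tendsto (fun δ : ℝ => (1 + (δ * r) ^ 2) ^ (γ / 2)) (𝓝[>] 0) (𝓝 1) := by
          have hc : Continuous fun y : ℝ => (1 + y ^ 2) ^ (γ / 2) :=
            Continuous.rpow_const (by fun_prop) fun y => Or.inl (by positivity)
          have := (hc.tendsto 0).comp hdr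
          simpa [Function.comp_def] using this
        have l4 := ((continuous_relaxProd (a₁ := a₁) (a₂ := a₂) hβ0).tendsto _).comp
          (l3.const_mul (|r| ^ α))
        exact ((Complex.continuous_ofReal.tendsto _).comp
          ((((l1.const_mul C₀).mul_const _).mul l2).mul l4)).mul_const _
      simp only [mul_one] at hlim
      refine hlim.congr' ?_
      filter_upwards [hmem, self_mem_nhdsWithin] with δ h3 hδ
      exact (scaled_singularPart hX hρ hδ h3.1 h3.2).symm
  refine hmain.congr' ?_
  filter_upwards [self_mem_nhdsWithin] with δ hδ
  have hδ : 0 < δ := hδ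
  have h3 := Measure.integral_comp_mul_left (fun s => (singularPart C₀ κ ρ X B L s : ℂ) *
    scaledFactor α β γ a₁ a₂ x δ s) δ
  simp only [hF]
  rw [integral_const_mul, h3, abs_of_pos (inv_pos.2 hδ), Complex.real_smul, ← mul_assoc,
    ← Complex.ofReal_mul, mul_assoc _ δ, mul_inv_cancel₀ hδ.ne', mul_one]

/-- The scaling limit of the covariances of the solution. -/
theorem tendsto_scaled_integral {f L B : ℝ → ℝ} (hf : Integrable f) (hL : IsSlowlyVarying L)
    (hβ0 : 0 < β) (hβ1 : β ≤ 1) (hγ : 0 ≤ γ) (h1 : 0 < a₁) (h2 : 0 < a₂) (hκ0 : 0 < κ)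
    (hκ1 : κ < 1) (hα : κ / 2 < α) {C₀ : ℝ} (hB : Continuous B) (hB0 : B 0 = 1)
    (hB1 : ∀ s, |B s| ≤ 1)
    (hloc : ∃ C, ∀ᶠ s in 𝓝 (0 : ℝ), s ≠ 0 →
      |f s - C₀ * (B s * |s| ^ (κ - 1) * L (1 / |s|))| ≤ C) (x : ℝ) :
    Tendsto (fun δ : ℝ => ((δ ^ (-κ) / L δ⁻¹ : ℝ) : ℂ) *
      ∫ s, (f s : ℂ) * scaledFactor α β γ a₁ a₂ x δ s) (𝓝[>] 0)
      (𝓝 (∫ r, ((C₀ * |r| ^ (κ - 1) * relaxProd β a₁ a₂ (|r| ^ α) : ℝ) : ℂ) * character x r)) := by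
  -- The decay exponent satisfies `κ < p` so that the remainder is negligible, `p < 1` so that
  -- `|s|^{-p}` is locally integrable, and `p < 2α` so that two relaxation factors provide it.
  obtain ⟨p, hp1, hp2⟩ := exists_between (show κ < min 1 (2 * α) from
    lt_min hκ1 (by linarith))
  have hp3 := hp2.trans_le (min_le_left _ _)
  have hp4 := hp2.trans_le (min_le_right _ _)
  have hp0 : 0 < p := hκ0.trans hp1
  obtain ⟨η, hη0, hη1⟩ := exists_between (show 0 < min κ (p - κ) from lt_min hκ0 (sub_pos.2 hp1))
  have hη2 := hη1.trans_le (min_le_left _ _)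
  have hη3 := hη1.trans_le (min_le_right _ _)
  obtain ⟨X, hX, hpos, hmeas, hpot⟩ := hL.potter hη0
  obtain ⟨C, hC⟩ := hloc
  obtain ⟨ρ₁, hρ₁, hC⟩ := Metric.eventually_nhds_iff.1 hC
  set ρ := min ρ₁ (1 / X) with hρdef
  have hρ0 : 0 < ρ := lt_min hρ₁ (by positivity)
  have hρX : ρ ≤ 1 / X := min_le_right _ _
  set g := singularPart C₀ κ ρ X B L with hg
  have hgm : Measurable g := measurable_singularPart hB hmeas
  -- Within `ρ` of zero `f - g` is bounded by `C`; further out `g = 0` and `|s|^{-p} ≤ ρ^{-p}`, so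
  -- integrability of `f` suffices.
  have hR : Integrable fun s => |s| ^ (-p) * (f s - g s) := by
    have hi : Integrable fun s : ℝ => (Set.Ioo 0 ρ).indicator (fun r => r ^ (-p)) |s| := by
      refine integrable_comp_abs (Integrable.integrableOn ?_)
      rw [integrable_indicator_iff measurableSet_Ioo]
      exact (intervalIntegral.intervalIntegrable_rpow' (a := 0) (b := ρ) (r := -p)
        (by linarith)).1.mono_set Set.Ioo_subset_Ioc_self
    refine Integrable.mono' ((hi.const_mul C).add (hf.norm.const_mul (ρ ^ (-p)))) ?_ ?_
    · have : Measurable fun s : ℝ => |s| ^ (-p) := by fun_prop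
      exact this.aestronglyMeasurable.mul (hf.1.sub hgm.aestronglyMeasurable)
    · refine ae_ne_zero.mono fun s hs => ?_
      have hs0 : 0 < |s| := abs_pos.2 hs
      rw [norm_mul, Real.norm_of_nonneg (Real.rpow_nonneg hs0.le _), Pi.add_apply]
      by_cases hsρ : |s| < ρ
      · have h3 := hC (y := s) (by simpa using hsρ.trans_le (min_le_left _ _)) hs
        rw [hg, singularPart_apply hX hρX hs0 hsρ,
          Set.indicator_of_mem (show |s| ∈ Set.Ioo 0 ρ from ⟨hs0, hsρ⟩), mul_comm, Real.norm_eq_abs]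
        have h4 : 0 ≤ ρ ^ (-p) * ‖f s‖ := by positivity
        have h5 := mul_le_mul_of_nonneg_right h3 (Real.rpow_nonneg hs0.le (-p))
        linarith
      · rw [hg, singularPart_apply_of_not (fun h => hsρ h.2),
          Set.indicator_of_notMem (fun h => hsρ h.2), mul_zero, zero_add, sub_zero]
        refine mul_le_mul_of_nonneg_right ?_ (norm_nonneg _)
        exact Real.rpow_le_rpow_of_nonpos hρ0 (not_lt.1 hsρ) (by linarith)
  have t1 := tendsto_remainder (κ := κ) hL hβ0 hβ1 hγ h1 h2 hp0.le hp1 hp4.le x hR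
  have t2 := tendsto_singularPart (C₀ := C₀) hL hβ0 hβ1 hγ h1 h2 hp0.le hp4.le hη0 hη2
    (by linarith) hρ0 hX hρX hpos hmeas hpot hB hB0 hB1 x
  have t3 := t1.add t2
  rw [zero_add] at t3
  refine t3.congr' ?_
  filter_upwards [self_mem_nhdsWithin] with δ hδ
  have hδ : 0 < δ := hδ
  have hms := measurable_scaledFactor (α := α) (γ := γ) (a₁ := a₁) (a₂ := a₂) hβ0 x δ
  have i1 : Integrable fun s => (f s : ℂ) * scaledFactor α β γ a₁ a₂ x δ s := by
    refine hf.ofReal.mul_bdd (c := 1) hms.aestronglyMeasurable (Eventually.of_forall fun s => ?_)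
    rw [norm_scaledFactor hβ0 hβ1 h1.le h2.le x hδ]
    have := symbol_nonneg α γ s
    exact relaxProd_le_one hβ0 hβ1 h1.le h2.le (by positivity)
  have i2 : Integrable fun s => ((f s - g s : ℝ) : ℂ) * scaledFactor α β γ a₁ a₂ x δ s := by
    refine Integrable.mono' (hR.norm.const_mul ((1 + Real.Gamma (1 + β) / a₁) *
      (1 + Real.Gamma (1 + β) / a₂) * δ ^ p)) ?_ (ae_ne_zero.mono fun s hs => ?_)
    · exact (Complex.continuous_ofReal.comp_aestronglyMeasurable
        (hf.1.sub hgm.aestronglyMeasurable)).mul hms.aestronglyMeasurable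
    · have h3 := norm_scaledFactor_le_rpow (s := s) hβ0 hβ1 hγ h1 h2 hp0.le hp4.le x hδ hs
      rw [norm_mul, Complex.norm_real, norm_mul,
        Real.norm_of_nonneg (Real.rpow_nonneg (abs_nonneg s) (-p))]
      calc ‖f s - g s‖ * ‖scaledFactor α β γ a₁ a₂ x δ s‖ ≤
          ‖f s - g s‖ * ((1 + Real.Gamma (1 + β) / a₁) * (1 + Real.Gamma (1 + β) / a₂) *
            (|s| ^ (-p) * δ ^ p)) := by gcongr
        _ = _ := by ring
  have i3 : Integrable fun s => (g s : ℂ) * scaledFactor α β γ a₁ a₂ x δ s := by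
    refine (i1.sub i2).congr (Eventually.of_forall fun s => ?_)
    simp only [Pi.sub_apply, Complex.ofReal_sub]
    ring
  rw [← mul_add, ← integral_add i2 i3]
  congr 2
  ext s
  push_cast
  ring

end CovarianceLimit

/-! ### The spectral density near the origin -/

section LocalDensity

/-- A component of the spectral density is bounded away from its singularity. -/
lemma eventually_abs_component_le {κ a : ℝ} (h0 : 0 < κ) (h1 : κ < 1) (ha : a ≠ 0) (c : ℝ) (j : ℤ)
    {L : ℝ → ℝ} (hL : ∀ b : ℝ, ∃ C : ℝ, ∀ x ∈ Set.Ioc 0 b, |L x| ≤ C) :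
    ∃ C, ∀ᶠ s in 𝓝 (0 : ℝ),
      |c * ((1 - theta j κ |s + a|) / |s + a| ^ (1 - κ)) * L (1 / |s + a|)| ≤ C := by
  have ha0 : 0 < |a| := abs_pos.2 ha
  -- For `s` near zero `|s + a| > |a|/2`, so the argument of `L` stays in `(0, 2/|a|]`, where `L` is
  -- bounded.
  obtain ⟨C, hC⟩ := hL (1 / (|a| / 2))
  refine ⟨|c| * (1 / (|a| / 2) ^ (1 - κ)) * C, ?_⟩
  have hcont : Tendsto (fun s : ℝ => |s + a|) (𝓝 0) (𝓝 |0 + a|) :=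
    Continuous.tendsto (by fun_prop) 0
  rw [zero_add] at hcont
  filter_upwards [hcont.eventually (lt_mem_nhds (half_lt_self ha0))] with s hs
  have hs0 : 0 < |s + a| := (half_pos ha0).trans hs
  have hL1 := hC (1 / |s + a|) ⟨by positivity, one_div_le_one_div_of_le (half_pos ha0) hs.le⟩
  have hpow : (|a| / 2) ^ (1 - κ) ≤ |s + a| ^ (1 - κ) :=
    Real.rpow_le_rpow (half_pos ha0).le hs.le (by linarith)
  have hpos : 0 < (|a| / 2) ^ (1 - κ) := Real.rpow_pos_of_pos (half_pos ha0) _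
  rw [one_sub_theta h0 h1 j hs0, abs_mul, abs_mul, abs_div, abs_of_nonneg (besselRatio_nonneg h1 _),
    abs_of_pos (hpos.trans_le hpow)]
  have := besselRatio_le_one h1 |s + a|
  gcongr

/-- Near the origin, the modulated spectral density is its central component up to a bounded
function. -/
lemma modulatedDensity_local {n : ℕ} {A κ w : ℕ → ℝ} {L : ℤ → ℝ → ℝ}
    (hκ : ∀ j, j ≤ n → 0 < κ j ∧ κ j < 1) (hw : ∀ j, 1 ≤ j → j ≤ n → 0 < w j)
    (hLbdd : ∀ j ∈ Finset.Icc (-(n : ℤ)) n, ∀ a : ℝ, ∃ C : ℝ, ∀ x ∈ Set.Ioc 0 a, |L j x| ≤ C) :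
    ∃ C, ∀ᶠ s in 𝓝 (0 : ℝ), s ≠ 0 →
      |modulatedDensity n A κ w L s - c2 0 (κ 0) / 2 * A 0 *
        (besselRatio (κ 0) |s| * |s| ^ (κ 0 - 1) * L 0 (1 / |s|))| ≤ C := by
  set S := (Finset.Icc (-(n : ℤ)) n).erase 0
  set T : ℤ → ℝ → ℝ := fun j s => c2 j (κ j.natAbs) / 2 * A j.natAbs *
      ((1 - theta j (κ j.natAbs) |s + location w j|) /
        |s + location w j| ^ (1 - κ j.natAbs)) * L j (1 / |s + location w j|) with hT
  have hb : ∀ j ∈ S, ∃ C, ∀ᶠ s in 𝓝 (0 : ℝ), |T j s| ≤ C := fun j hj => by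
    obtain ⟨hj0, hj⟩ := Finset.mem_erase.1 hj
    have hjI := Finset.mem_Icc.1 hj
    have hjn : j.natAbs ≤ n := by omega
    have hloc : location w j ≠ 0 := by
      refine mul_ne_zero ?_ (hw _ (by omega) hjn).ne'
      exact_mod_cast mt Int.sign_eq_zero_iff_zero.1 hj0
    exact eventually_abs_component_le (hκ _ hjn).1 (hκ _ hjn).2 hloc _ j (hLbdd j hj)
  choose! C hC using hb
  refine ⟨∑ j ∈ S, C j, ?_⟩
  filter_upwards [(Filter.eventually_all_finset S).2 hC] with s hs hs0
  have h00 : (0 : ℤ) ∈ Finset.Icc (-(n : ℤ)) n := by simp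
  have hsum : modulatedDensity n A κ w L s = T 0 s + ∑ j ∈ S, T j s :=
    (Finset.add_sum_erase _ (fun j => T j s) h00).symm
  have hT0 : T 0 s = c2 0 (κ 0) / 2 * A 0 *
      (besselRatio (κ 0) |s| * |s| ^ (κ 0 - 1) * L 0 (1 / |s|)) := by
    have hk := hκ 0 (Nat.zero_le n)
    have hsp : 0 < |s| := abs_pos.2 hs0
    simp only [hT, location, Int.sign_zero, Int.cast_zero, zero_mul, add_zero, Int.natAbs_zero]
    rw [one_sub_theta hk.1 hk.2 0 hsp, div_eq_mul_inv _ (|s| ^ (1 - κ 0)), ← Real.rpow_neg hsp.le,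
      neg_sub]
    ring
  rw [hsum, hT0, add_sub_cancel_left]
  exact (Finset.abs_sum_le_sum_abs _ _).trans (Finset.sum_le_sum hs)

end LocalDensity

/-! ### Gaussian vectors of mean-square integrals -/

lemma coeFn_sum_smul_toLp {Ω ι : Type*} [MeasurableSpace Ω] {P : Measure Ω} {η : ι → Ω → ℝ}
    (hη : ∀ k, MemLp (fun ω => (η k ω : ℂ)) 2 P) (θ : ι → ℝ) (s : Finset ι) :
    (∑ k ∈ s, (θ k : ℂ) • (hη k).toLp _ : Lp ℂ 2 P) =ᵐ[P]
      fun ω => ((∑ k ∈ s, θ k * η k ω : ℝ) : ℂ) := by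
  classical
  induction s using Finset.induction_on with
  | empty => exact (Lp.coeFn_zero ℂ 2 P).trans (by simp; rfl)
  | insert k s hk ih =>
    rw [Finset.sum_insert hk]
    filter_upwards [Lp.coeFn_add ((θ k : ℂ) • (hη k).toLp _) (∑ k ∈ s, (θ k : ℂ) • (hη k).toLp _),
      Lp.coeFn_smul (θ k : ℂ) ((hη k).toLp _), (hη k).coeFn_toLp, ih] with ω h1 h2 h3 h4
    rw [h1, Pi.add_apply, h2, h4, Pi.smul_apply, h3, Finset.sum_insert hk]
    push_cast
    rfl

lemma integral_sum_mul_sq {Ω ι : Type*} [MeasurableSpace Ω] {P : Measure Ω} [Fintype ι]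
    {η : ι → Ω → ℝ} (hη : ∀ k, MemLp (η k) 2 P) (θ : ι → ℝ) :
    ∫ ω, (∑ k, θ k * η k ω) ^ 2 ∂P = ∑ k, ∑ l, θ k * θ l * ∫ ω, η k ω * η l ω ∂P := by
  have hi : ∀ k l, Integrable (fun ω => θ k * θ l * (η k ω * η l ω)) P := fun k l =>
    ((hη k).integrable_mul (hη l)).const_mul _
  calc ∫ ω, (∑ k, θ k * η k ω) ^ 2 ∂P = ∫ ω, ∑ k, ∑ l, θ k * θ l * (η k ω * η l ω) ∂P := by
        refine integral_congr_ae (Eventually.of_forall fun ω => ?_)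
        simp only [sq, Finset.sum_mul_sum]
        exact Finset.sum_congr rfl fun k _ => Finset.sum_congr rfl fun l _ => by ring
    _ = ∑ k, ∫ ω, ∑ l, θ k * θ l * (η k ω * η l ω) ∂P :=
        integral_finsetSum _ fun k _ => integrable_finsetSum _ fun l _ => hi k l
    _ = _ := Finset.sum_congr rfl fun k _ => by
        rw [integral_finsetSum _ fun l _ => hi k l]
        simp_rw [integral_const_mul]

lemma charFun_map_toLp {Ω ι : Type*} [MeasurableSpace Ω] {P : Measure Ω} [Fintype ι]
    {η : ι → Ω → ℝ} (hη : ∀ k, AEMeasurable (η k) P) (θ : EuclideanSpace ℝ ι) :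
    charFun (P.map fun ω => WithLp.toLp 2 fun k => η k ω) θ =
      ∫ ω, Complex.exp (Complex.I * ((∑ k, θ k * η k ω : ℝ) : ℂ)) ∂P := by
  have hm : AEMeasurable (fun ω => WithLp.toLp 2 fun k => η k ω) P :=
    (by fun_prop : Measurable (WithLp.toLp 2 : (ι → ℝ) → EuclideanSpace ℝ ι)).comp_aemeasurable
      (aemeasurable_pi_lambda _ hη)
  rw [charFun_apply, integral_map hm (by fun_prop)]
  refine integral_congr_ae (Eventually.of_forall fun ω => ?_)
  simp only [PiLp.inner_apply, Real.inner_apply]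
  simp only [mul_comm Complex.I, mul_comm (η _ _)]

/-- A process is Gaussian and centered if its linear combinations have the characteristic functions
of centered Gaussian variables. -/
lemma isGaussianProcess_of_integral_exp {Ω S : Type*} [MeasurableSpace Ω] {P : Measure Ω}
    [IsProbabilityMeasure P] {η : S → Ω → ℝ} (hη : ∀ k, MemLp (η k) 2 P)
    (h0 : ∀ k, ∫ ω, η k ω ∂P = 0)
    (hexp : ∀ (I : Finset S) (θ : I → ℝ),
      ∫ ω, Complex.exp (Complex.I * ((∑ k, θ k * η k ω : ℝ) : ℂ)) ∂P =
        Complex.exp (-((∫ ω, (∑ k, θ k * η k ω) ^ 2 ∂P : ℝ) : ℂ) / 2)) :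
    IsGaussianProcess η P where
  hasGaussianLaw I := by
    have hm : AEMeasurable (fun ω => (WithLp.toLp 2 fun k : I => η k ω : EuclideanSpace ℝ I)) P :=
      (by fun_prop : Measurable (WithLp.toLp 2 : (I → ℝ) → EuclideanSpace ℝ I)).comp_aemeasurable
        (aemeasurable_pi_lambda _ fun k => (hη k).1.aemeasurable)
    have hG : HasGaussianLaw (fun ω => (WithLp.toLp 2 fun k : I => η k ω : EuclideanSpace ℝ I)) P := by
      refine (hasGaussianLaw_iff_charFun_map_eq hm).2 fun θ => ?_
      have hin : (fun ω => inner ℝ θ (WithLp.toLp 2 fun k : I => η k ω : EuclideanSpace ℝ I)) =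
          fun ω => ∑ k, θ k * η k ω := by
        ext ω
        simp only [PiLp.inner_apply, Real.inner_apply]
      have hs0 : ∀ θ : I → ℝ, ∫ ω, ∑ k : I, θ k * η k ω ∂P = 0 := fun θ => by
        rw [integral_finsetSum _ fun (k : I) _ => ((hη k).integrable (by norm_num)).const_mul (θ k)]
        simp [integral_const_mul, h0]
      have hsm : AEMeasurable (fun ω => ∑ k : I, θ k * η k ω) P :=
        Finset.aemeasurable_fun_sum _ fun k _ => (hη k).1.aemeasurable.const_mul _
      rw [charFun_map_toLp (fun k : I => (hη k).1.aemeasurable), hexp, hin, hs0,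
        variance_eq_integral hsm, hs0]
      simp [neg_div]
    exact hG.map_fun (EuclideanSpace.equiv I ℝ : EuclideanSpace ℝ I →L[ℝ] (I → ℝ))

/-- Lévy's continuity theorem for random vectors with real coordinates. -/
lemma tendstoInDistribution_of_tendsto_integral_exp {Ω Ω' J ι : Type*} [MeasurableSpace Ω]
    [MeasurableSpace Ω'] {P : Measure Ω} [IsProbabilityMeasure P] {P' : Measure Ω'}
    [IsProbabilityMeasure P'] [Fintype ι] {l : Filter J} [l.IsCountablyGenerated]
    {X : J → ι → Ω → ℝ} {Z : ι → Ω' → ℝ} (hX : ∀ j k, AEMeasurable (X j k) P)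
    (hZ : ∀ k, AEMeasurable (Z k) P')
    (h : ∀ θ : ι → ℝ,
      Tendsto (fun j => ∫ ω, Complex.exp (Complex.I * ((∑ k, θ k * X j k ω : ℝ) : ℂ)) ∂P) l
        (𝓝 (∫ ω, Complex.exp (Complex.I * ((∑ k, θ k * Z k ω : ℝ) : ℂ)) ∂P'))) :
    TendstoInDistribution (fun j ω k => X j k ω) l (fun ω k => Z k ω) (fun _ => P) P' := by
  have hc : Measurable (WithLp.toLp 2 : (ι → ℝ) → EuclideanSpace ℝ ι) := by fun_prop
  have h1 : TendstoInDistribution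
      (fun j ω => (WithLp.toLp 2 fun k => X j k ω : EuclideanSpace ℝ ι)) l
      (fun ω => WithLp.toLp 2 fun k => Z k ω) (fun _ => P) P' := by
    refine ⟨fun j => hc.comp_aemeasurable (aemeasurable_pi_lambda _ (hX j)),
      hc.comp_aemeasurable (aemeasurable_pi_lambda _ hZ), ?_⟩
    -- The filter is countably generated, so convergence may be tested along sequences, where Lévy's
    -- theorem applies.
    refine tendsto_iff_seq_tendsto.2 fun x hx => ?_
    refine ProbabilityMeasure.tendsto_of_tendsto_charFun fun θ => ?_
    simp only [Function.comp, ProbabilityMeasure.coe_mk]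
    rw [charFun_map_toLp hZ]
    simp_rw [fun n => charFun_map_toLp (hX (x n)) θ]
    exact (h θ).comp hx
  exact h1.continuous_comp (g := (WithLp.ofLp : EuclideanSpace ℝ ι → ι → ℝ)) (by fun_prop)

namespace IsIsometricFamily

variable {Ω T : Type*} [MeasurableSpace Ω] {P : Measure Ω} {ν : Measure ℝ}
  {e : T → ℝ → ℂ} {X : T → Ω → ℂ}

lemma integral_mul_eq (h : IsIsometricFamily P ν e X) {g₁ g₂ : ℝ → ℂ} {η₁ η₂ : Ω → ℝ}
    (hg₁ : MemLp g₁ 2 ν) (hg₂ : MemLp g₂ 2 ν) (hη₁ : MemLp (fun ω => (η₁ ω : ℂ)) 2 P)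
    (hη₂ : MemLp (fun ω => (η₂ ω : ℂ)) 2 P) (h₁ : (hg₁.toLp g₁, hη₁.toLp _) ∈ h.graph)
    (h₂ : (hg₂.toLp g₂, hη₂.toLp _) ∈ h.graph) :
    ((∫ ω, η₁ ω * η₂ ω ∂P : ℝ) : ℂ) = ∫ s, g₁ s * (starRingEnd ℂ) (g₂ s) ∂ν := by
  have h3 := h.inner_eq h₂ h₁
  simp only [inner_toLp] at h3
  rw [← h3, ← integral_complex_ofReal]
  simp

lemma integral_exp_sum [IsProbabilityMeasure P] (h : IsIsometricFamily P ν e X)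
    (hX : IsGaussianProcess X P) (h0 : ∀ k, ∫ ω, X k ω ∂P = 0) {ι : Type*} [Fintype ι]
    {q : ι → Lp ℂ 2 ν} {η : ι → Ω → ℝ} (hη : ∀ k, MemLp (fun ω => (η k ω : ℂ)) 2 P)
    (hq : ∀ k, (q k, (hη k).toLp _) ∈ h.graph) (θ : ι → ℝ) :
    ∫ ω, Complex.exp (Complex.I * ((∑ k, θ k * η k ω : ℝ) : ℂ)) ∂P =
      Complex.exp (-((∫ ω, (∑ k, θ k * η k ω) ^ 2 ∂P : ℝ) : ℂ) / 2) := by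
  have hmem : ∑ k, (θ k : ℂ) • ((q k, (hη k).toLp _) : Lp ℂ 2 ν × Lp ℂ 2 P) ∈ h.graph :=
    Submodule.sum_mem _ fun k _ => Submodule.smul_mem _ _ (hq k)
  have h1 := h.integral_exp_re hX h0 hmem
  simp only [Prod.snd_sum, Prod.smul_snd] at h1
  have hae : (fun ω => ((∑ k, (θ k : ℂ) • (hη k).toLp _ : Lp ℂ 2 P) ω).re) =ᵐ[P]
      fun ω => ∑ k, θ k * η k ω :=
    (coeFn_sum_smul_toLp hη θ Finset.univ).fun_comp Complex.re
  have e1 := integral_congr_ae (hae.fun_comp fun y => Complex.exp (Complex.I * (y : ℂ)))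
  have e2 := integral_congr_ae (hae.fun_comp fun y => y ^ 2)
  simp only [Function.comp_def] at e1 e2
  rw [← e1, ← e2, h1]

lemma integral_toLp_eq_zero [IsProbabilityMeasure P] (h : IsIsometricFamily P ν e X)
    (h0 : ∀ k, ∫ ω, X k ω ∂P = 0) {q : Lp ℂ 2 ν} {η : Ω → ℝ}
    (hη : MemLp (fun ω => (η ω : ℂ)) 2 P) (hq : (q, hη.toLp _) ∈ h.graph) : ∫ ω, η ω ∂P = 0 := by
  have h1 := h.integral_eq_zero h0 hq
  rw [integral_congr_ae hη.coeFn_toLp, integral_complex_ofReal] at h1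
  exact_mod_cast h1

end IsIsometricFamily

/-! ### Covariances of the rescaled solution and of the limit field -/

section Sign

variable {α β γ κ : ℝ}

/-- The coefficient of the main singularity of a spectral density is nonnegative. -/
lemma coeff_nonneg_of_local {f L B : ℝ → ℝ} (hf : Integrable f) (hf0 : ∀ᵐ s, 0 ≤ f s)
    (hL : IsSlowlyVarying L) (hβ0 : 0 < β) (hβ1 : β ≤ 1) (hκ0 : 0 < κ)
    (hκ1 : κ < 1) (hα : κ / 2 < α) {C₀ : ℝ} (hB : Continuous B) (hB0 : B 0 = 1)
    (hB1 : ∀ s, |B s| ≤ 1)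
    (hloc : ∃ C, ∀ᶠ s in 𝓝 (0 : ℝ), s ≠ 0 →
      |f s - C₀ * (B s * |s| ^ (κ - 1) * L (1 / |s|))| ≤ C) : 0 ≤ C₀ := by
  -- At `x = 0` the scaled integrals of the nonnegative `f` are eventually nonnegative, and their
  -- limit is `C₀` times a positive integral. Any admissible rates and Bessel exponent serve; `1`,
  -- `1` and `0` are used.
  have ht := (Complex.continuous_re.tendsto _).comp (tendsto_scaled_integral (γ := 0) hf hL hβ0 hβ1
    le_rfl one_pos one_pos hκ0 hκ1 hα hB hB0 hB1 hloc 0)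
  have hch : ∀ r : ℝ, character 0 r = 1 := character_zero_left
  simp only [hch, mul_one] at ht
  rw [integral_complex_ofReal, Complex.ofReal_re] at ht
  have hnn : 0 ≤ ∫ r : ℝ, C₀ * |r| ^ (κ - 1) * relaxProd β 1 1 (|r| ^ α) := by
    refine ge_of_tendsto ht ?_
    obtain ⟨a, -, hpos, -⟩ := hL.1
    filter_upwards [tendsto_inv_nhdsGT_zero.eventually_ge_atTop a, self_mem_nhdsWithin] with δ h1 h2
    have h2 : 0 < δ := h2
    have hpt : ∀ s, (f s : ℂ) * scaledFactor α β 0 1 1 0 δ s =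
        ((f s * relaxProd β 1 1 (symbol α 0 s * δ ^ (-α)) : ℝ) : ℂ) := fun s => by
      rw [scaledFactor, zero_div, hch, one_mul, Complex.ofReal_mul]
    simp only [Function.comp, hpt]
    rw [integral_complex_ofReal, ← Complex.ofReal_mul, Complex.ofReal_re]
    refine mul_nonneg (div_nonneg (by positivity) (hpos _ h1).le) (integral_nonneg_of_ae ?_)
    filter_upwards [hf0] with s hs
    have := symbol_nonneg α 0 s
    exact mul_nonneg hs (relaxProd_pos hβ0 hβ1 zero_le_one zero_le_one (by positivity)).le
  have hα0 : 0 < α := by linarith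
  have hG := Real.Gamma_pos_of_pos (by linarith : 0 < 1 + β)
  have hle : ∀ᵐ r : ℝ, 0 < |r| ^ (κ - 1) * relaxProd β 1 1 (|r| ^ α) := by
    refine ae_ne_zero.mono fun r hr => mul_pos (Real.rpow_pos_of_pos (abs_pos.2 hr) _)
      (relaxProd_pos hβ0 hβ1 zero_le_one zero_le_one (by positivity))
  have hint : Integrable fun r : ℝ => |r| ^ (κ - 1) * relaxProd β 1 1 (|r| ^ α) := by
    set K := (1 + Real.Gamma (1 + β) / 1) * (1 + Real.Gamma (1 + β) / 1)
    refine Integrable.mono' ((integrable_twoPower_abs (a := κ - 1 - 0)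
      (b := κ - 1 + 0 - 2 * α) (by linarith) (by linarith)).const_mul (2 * K)) ?_ ?_
    · have hm := (continuous_relaxProd (a₁ := 1) (a₂ := 1) hβ0).measurable
      have h1 : Measurable fun r : ℝ => |r| ^ (κ - 1) := measurable_abs.pow_const _
      have h2 : Measurable fun r : ℝ => |r| ^ α := measurable_abs.pow_const _
      exact (h1.mul (hm.comp h2)).aestronglyMeasurable
    · filter_upwards [ae_ne_zero, hle] with r hr hpos
      have hr0 : 0 < |r| := abs_pos.2 hr
      have hy : 0 ≤ |r| ^ α := by positivity
      have hK : 1 ≤ K := by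
        have : 0 < Real.Gamma (1 + β) / 1 := by positivity
        exact one_le_mul_of_one_le_of_one_le (by linarith) (by linarith)
      have h3 := rpow_mul_add_mul_le_twoPower (κ := κ) le_rfl hr0
        (relaxProd_pos hβ0 hβ1 zero_le_one zero_le_one hy).le hK
        (relaxProd_le_one hβ0 hβ1 zero_le_one zero_le_one hy)
        (relaxProd_le_rpow hβ0 hβ1 one_pos one_pos (by linarith) le_rfl hr0 le_rfl)
      rw [neg_zero, Real.rpow_zero] at h3
      rw [Real.norm_of_nonneg hpos.le]
      linarith
  have hJ : 0 < ∫ r : ℝ, |r| ^ (κ - 1) * relaxProd β 1 1 (|r| ^ α) := by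
    rw [integral_pos_iff_support_of_nonneg_ae (hle.mono fun r h => h.le) hint]
    have : ∀ᵐ r : ℝ, r ∈ Function.support
        fun r : ℝ => |r| ^ (κ - 1) * relaxProd β 1 1 (|r| ^ α) := hle.mono fun r h => h.ne'
    rw [measure_congr ((eventuallyEq_univ (s := Function.support _)).2 this)]
    simp
  simp_rw [mul_assoc] at hnn
  rw [integral_const_mul] at hnn
  exact nonneg_of_mul_nonneg_left hnn hJ

end Sign

section Covariance

variable {Ω : Type*} [MeasurableSpace Ω] {P : Measure Ω}

lemma IsSymmetricWhiteNoise.isIsometricFamily {W : FiniteBorel → Ω → ℂ}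
    (hW : IsSymmetricWhiteNoise P W) :
    IsIsometricFamily P volume
      (fun B : FiniteBorel => (B : Set ℝ).indicator fun _ => (1 : ℂ)) W where
  memLp_left B := memLp_indicator_const 2 B.2.1 1 (Or.inr B.2.2.ne)
  memLp_right B := (hW.gaussian.hasGaussianLaw_eval B).memLp_two
  integral_eq B C := by
    have h1 : (fun s => (B : Set ℝ).indicator (fun _ => (1 : ℂ)) s *
        (starRingEnd ℂ) ((C : Set ℝ).indicator (fun _ => (1 : ℂ)) s)) =
        ((B : Set ℝ) ∩ (C : Set ℝ)).indicator fun _ => (1 : ℂ) := by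
      ext s
      by_cases hB : s ∈ (B : Set ℝ) <;> by_cases hC : s ∈ (C : Set ℝ) <;> simp [hB, hC]
    rw [hW.covariance, h1, integral_indicator (B.2.1.inter C.2.1)]
    simp [Measure.real]

variable {ξ : ℝ → Ω → ℝ} {f : ℝ → ℝ} {α β γ μ κ₀ : ℝ} {u : ℝ → ℝ → Ω → ℝ}

lemma memLp_rescaled (hu : IsMeanSquareSolution P ξ f α β γ μ u) {L₀ : ℝ → ℝ} {ε t : ℝ}
    (hε : 0 < ε) (ht : 0 < t) (x : ℝ) :
    MemLp (fun ω => (rescaled α β κ₀ L₀ u ε t x ω : ℂ)) 2 P :=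
  ((hu.memLp (t / ε) (x / ε ^ (β / α)) (by positivity)).const_mul _).ofReal

lemma exists_rescaled_mem_graph [IsProbabilityMeasure P] (hα : 0 ≤ α) (hγ : 0 ≤ γ) (hβ0 : 0 < β) (hβ1 : β ≤ 1) (hμ : 0 ≤ μ)
    (hI : IsIsometricFamily P (spectralMeasure f) character (fun x ω => (ξ x ω : ℂ)))
    (hξ : IsGaussianProcess ξ P) (hξ0 : ∀ x, ∫ ω, ξ x ω ∂P = 0) (hf : HasSpectralDensity P ξ f)
    (hu : IsMeanSquareSolution P ξ f α β γ μ u) {L₀ : ℝ → ℝ} {ε t : ℝ} (hε : 0 < ε) (ht : 0 < t)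
    (x : ℝ) (hU : MemLp (fun ω => (rescaled α β κ₀ L₀ u ε t x ω : ℂ)) 2 P) :
    ∃ q, (q, hU.toLp _) ∈ hI.graph := by
  have := hf.isFiniteMeasure
  have hG := memLp_character_mul_solutionSymbol (α := α) (γ := γ) (t := t / ε) hβ0 hβ1 hμ
    (by positivity) (ν := spectralMeasure f) (x / ε ^ (β / α))
  have hV : MemLp (fun ω => (u (t / ε) (x / ε ^ (β / α)) ω : ℂ)) 2 P :=
    (hu.memLp _ _ (by positivity)).ofReal
  have hm := hu.mem_graph hα hγ hβ0 hβ1 hμ hI hξ hξ0 hf (div_pos ht hε) _ hG hV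
  set c : ℝ := ε ^ (-(κ₀ * β / (2 * α))) / √(L₀ (ε ^ (-(β / α)))) with hc
  refine ⟨(c : ℂ) • hG.toLp _, ?_⟩
  have hs := Submodule.smul_mem _ (c : ℂ) hm
  have he : hU.toLp _ = (c : ℂ) • hV.toLp _ := by
    rw [← MemLp.toLp_const_smul]
    congr 1
    ext ω
    simp [rescaled, hc]
  rw [he]
  exact hs

/-- With `δ = ε^{β/α}` one has `ε^{-β} = δ^{-α}` and the squared normalization is `δ^{-κ₀} /
L₀(1/δ)`; the rest is the isometry. -/
lemma integral_rescaled_mul [IsProbabilityMeasure P] (hα : 0 < α) (hγ : 0 ≤ γ) (hβ0 : 0 < β) (hβ1 : β ≤ 1) (hμ : 0 ≤ μ)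
    (hI : IsIsometricFamily P (spectralMeasure f) character (fun x ω => (ξ x ω : ℂ)))
    (hξ : IsGaussianProcess ξ P) (hξ0 : ∀ x, ∫ ω, ξ x ω ∂P = 0) (hf : HasSpectralDensity P ξ f)
    (hu : IsMeanSquareSolution P ξ f α β γ μ u) {L₀ : ℝ → ℝ} {ε t₁ t₂ : ℝ} (hε : 0 < ε)
    (h1 : 0 < t₁) (h2 : 0 < t₂) (hL : 0 ≤ L₀ (ε ^ (β / α))⁻¹) (x₁ x₂ : ℝ) :
    ((∫ ω, rescaled α β κ₀ L₀ u ε t₁ x₁ ω * rescaled α β κ₀ L₀ u ε t₂ x₂ ω ∂P : ℝ) : ℂ) =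
      (((ε ^ (β / α)) ^ (-κ₀) / L₀ (ε ^ (β / α))⁻¹ : ℝ) : ℂ) *
        ∫ s, (f s : ℂ) *
          scaledFactor α β γ (μ * t₁ ^ β) (μ * t₂ ^ β) (x₁ - x₂) (ε ^ (β / α)) s := by
  have := hf.isFiniteMeasure
  set δ := ε ^ (β / α) with hδ
  have hδα : δ ^ (-α) = (ε ^ β)⁻¹ := by
    rw [hδ, ← Real.rpow_mul hε.le, ← Real.rpow_neg hε.le]
    congr 1
    field_simp
  have hG := fun {t : ℝ} (ht : 0 < t) => memLp_character_mul_solutionSymbol (α := α) (γ := γ)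
    (t := t / ε) hβ0 hβ1 hμ (by positivity) (ν := spectralMeasure f)
  have hV := fun {t : ℝ} (ht : 0 < t) (x : ℝ) =>
    (hu.memLp (t / ε) (x / δ) (by positivity)).ofReal (K := ℂ)
  have hm := fun {t : ℝ} (ht : 0 < t) (x : ℝ) =>
    hu.mem_graph hα.le hγ hβ0 hβ1 hμ hI hξ hξ0 hf (div_pos ht hε) (x / δ) (hG ht _) (hV ht x)
  have hcov := hI.integral_mul_eq _ _ _ _ (hm h1 x₁) (hm h2 x₂)
  rw [hf.integral_spectralMeasure] at hcov
  have hpt : ∀ s, character (x₁ / δ) s * (solutionSymbol α β γ μ (t₁ / ε) s : ℂ) *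
      (starRingEnd ℂ) (character (x₂ / δ) s * (solutionSymbol α β γ μ (t₂ / ε) s : ℂ)) =
      scaledFactor α β γ (μ * t₁ ^ β) (μ * t₂ ^ β) (x₁ - x₂) δ s := fun s => by
    have hsol : ∀ {t : ℝ}, 0 < t → solutionSymbol α β γ μ (t / ε) s =
        mittagLefflerE β (-(μ * t ^ β * (symbol α γ s * δ ^ (-α)))) := fun {t} ht => by
      rw [solutionSymbol, hδα, Real.div_rpow ht.le hε.le]
      congr 1
      ring
    rw [scaledFactor, sub_div, ← character_mul_conj, relaxProd, ← hsol h1, ← hsol h2, map_mul,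
      Complex.conj_ofReal]
    push_cast
    ring
  simp_rw [hpt] at hcov
  rw [← hcov, ← Complex.ofReal_mul]
  congr 1
  have hsq : (ε ^ (-(κ₀ * β / (2 * α))) / √(L₀ (ε ^ (-(β / α))))) *
      (ε ^ (-(κ₀ * β / (2 * α))) / √(L₀ (ε ^ (-(β / α))))) = δ ^ (-κ₀) / L₀ δ⁻¹ := by
    rw [div_mul_div_comm, Real.rpow_neg hε.le (β / α), Real.mul_self_sqrt hL, ← Real.rpow_add hε,
      hδ, ← Real.rpow_mul hε.le]
    congr 2
    field_simp
    ring
  rw [← hsq, ← integral_const_mul]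
  refine integral_congr_ae (Eventually.of_forall fun ω => ?_)
  simp only [rescaled]
  ring

/-- Nonnegativity of the coefficient is needed for its square root to square back. -/
lemma integral_limit_mul {W : FiniteBorel → Ω → ℂ} (hW : IsSymmetricWhiteNoise P W) {A₀ : ℝ}
    {U₀ : ℝ → ℝ → Ω → ℝ}
    (hU₀ : ∀ t x, 0 < t → IsWienerIntegral P W (limitKernel α β μ κ₀ A₀ t x) (U₀ t x))
    (hA : 0 ≤ c2 0 κ₀ / 2 * A₀) {t₁ t₂ : ℝ} (h1 : 0 < t₁) (h2 : 0 < t₂) (x₁ x₂ : ℝ) :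
    ((∫ ω, U₀ t₁ x₁ ω * U₀ t₂ x₂ ω ∂P : ℝ) : ℂ) =
      ∫ r : ℝ, ((c2 0 κ₀ / 2 * A₀ * |r| ^ (κ₀ - 1) *
        relaxProd β (μ * t₁ ^ β) (μ * t₂ ^ β) (|r| ^ α) : ℝ) : ℂ) * character (x₁ - x₂) r := by
  have hI := hW.isIsometricFamily
  rw [hI.integral_mul_eq _ _ _ _ (hI.mem_graph (hU₀ t₁ x₁ h1)) (hI.mem_graph (hU₀ t₂ x₂ h2))]
  refine integral_congr_ae (ae_ne_zero.mono fun r hr => ?_)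
  have hr0 : 0 < |r| := abs_pos.2 hr
  simp only [limitKernel, map_mul, Complex.conj_ofReal]
  rw [← character_mul_conj, relaxProd, show -(μ * t₁ ^ β * |r| ^ α) = -μ * |r| ^ α * t₁ ^ β by ring,
    show -(μ * t₂ ^ β * |r| ^ α) = -μ * |r| ^ α * t₂ ^ β by ring]
  set e₁ := mittagLefflerE β (-μ * |r| ^ α * t₁ ^ β)
  set e₂ := mittagLefflerE β (-μ * |r| ^ α * t₂ ^ β)
  have hreal : √(c2 0 κ₀ * A₀ / 2) * (e₁ / |r| ^ ((1 - κ₀) / 2)) *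
      (√(c2 0 κ₀ * A₀ / 2) * (e₂ / |r| ^ ((1 - κ₀) / 2))) =
      c2 0 κ₀ / 2 * A₀ * |r| ^ (κ₀ - 1) * (e₁ * e₂) := by
    have hs : √(c2 0 κ₀ * A₀ / 2) * √(c2 0 κ₀ * A₀ / 2) = c2 0 κ₀ / 2 * A₀ := by
      rw [Real.mul_self_sqrt (by linarith)]
      ring
    have hp : |r| ^ (κ₀ - 1) = (|r| ^ ((1 - κ₀) / 2))⁻¹ * (|r| ^ ((1 - κ₀) / 2))⁻¹ := by
      rw [← Real.rpow_neg hr0.le, ← Real.rpow_add hr0]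
      congr 1
      ring
    rw [hp, ← hs]
    ring
  rw [← hreal]
  push_cast
  ring

end Covariance

lemma tendsto_coe_rpow_comap {b : ℝ} (hb : 0 < b) :
    Tendsto (fun ε : Set.Ioi (0 : ℝ) => (ε : ℝ) ^ b)
      (comap (fun ε : Set.Ioi (0 : ℝ) => (ε : ℝ)) (𝓝 0)) (𝓝[>] 0) := by
  refine tendsto_nhdsWithin_iff.2 ⟨?_, Eventually.of_forall fun ε => Real.rpow_pos_of_pos ε.2 b⟩
  have h1 := (Real.continuousAt_rpow_const 0 b (Or.inr hb.le)).tendsto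
  rw [Real.zero_rpow hb.ne'] at h1
  exact h1.comp tendsto_comap

end RieszBessel

end

/-! ### Convergence of the finite-dimensional distributions -/

theorem mainTheorem3
    {Ω Ω' : Type*} [MeasurableSpace Ω] [MeasurableSpace Ω']
    (P : Measure Ω) [IsProbabilityMeasure P] (P' : Measure Ω') [IsProbabilityMeasure P']
    (α β γ μ : ℝ) (hβ0 : 0 < β) (hβ1 : β ≤ 1) (hγ : 0 < γ) (hμ : 0 < μ)
    (n : ℕ) (A κ w : ℕ → ℝ) (L : ℤ → ℝ → ℝ)
    (hAsum : ∑ j ∈ Finset.range (n + 1), A j = 1)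
    (hκ : ∀ j, j ≤ n → 0 < κ j ∧ κ j < 1)
    (hw : ∀ j, 1 ≤ j → j ≤ n → 0 < w j)
    (hL : ∀ j ∈ Finset.Icc (-(n : ℤ)) n, RieszBessel.IsSlowlyVarying (L j))
    (hLbdd : ∀ j ∈ Finset.Icc (-(n : ℤ)) n, ∀ a : ℝ, ∃ C : ℝ, ∀ x ∈ Set.Ioc 0 a, |L j x| ≤ C)
    (hA0 : A 0 ≠ 0) (hα : κ 0 / 2 < α)
    (ξ : ℝ → Ω → ℝ) (hξ : IsGaussianProcess ξ P) (hξ0 : ∀ x, ∫ ω, ξ x ω ∂P = 0)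
    (hξf : RieszBessel.HasSpectralDensity P ξ (RieszBessel.modulatedDensity n A κ w L))
    (u : ℝ → ℝ → Ω → ℝ)
    (hu : RieszBessel.IsMeanSquareSolution P ξ (RieszBessel.modulatedDensity n A κ w L) α β γ μ u)
    (W : RieszBessel.FiniteBorel → Ω' → ℂ) (hW : RieszBessel.IsSymmetricWhiteNoise P' W)
    (U₀ : ℝ → ℝ → Ω' → ℝ)
    (hU₀ : ∀ t x, 0 < t →
      RieszBessel.IsWienerIntegral P' W (RieszBessel.limitKernel α β μ (κ 0) (A 0) t x) (U₀ t x)) :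
    IsGaussianProcess (fun (p : Set.Ioi (0 : ℝ) × ℝ) ω => U₀ p.1 p.2 ω) P' ∧
    (∀ t x, 0 < t → ∫ ω, U₀ t x ω ∂P' = 0) ∧
    ∀ (N : ℕ) (t x : Fin N → ℝ), (∀ k, 0 < t k) →
      TendstoInDistribution
        (fun (ε : Set.Ioi (0 : ℝ)) ω (k : Fin N) =>
          RieszBessel.rescaled α β (κ 0) (L 0) u ε (t k) (x k) ω)
        (comap (fun ε : Set.Ioi (0 : ℝ) => (ε : ℝ)) (𝓝 0))
        (fun ω (k : Fin N) => U₀ (t k) (x k) ω)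
        (fun _ => P) P' := by
  have hα0 : 0 < α := by linarith [(hκ 0 (Nat.zero_le n)).1]
  have hκ₀ := hκ 0 (Nat.zero_le n)
  have h00 : (0 : ℤ) ∈ Finset.Icc (-(n : ℤ)) n := by simp
  have hL0 := hL 0 h00
  have hloc := RieszBessel.modulatedDensity_local (A := A) hκ hw hLbdd
  have hBc : Continuous fun s : ℝ => RieszBessel.besselRatio (κ 0) |s| :=
    (RieszBessel.continuous_besselRatio hκ₀.2).comp continuous_abs
  have hB0 : (fun s : ℝ => RieszBessel.besselRatio (κ 0) |s|) 0 = 1 := by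
    simpa using RieszBessel.besselRatio_zero hκ₀.2
  have hB1 : ∀ s : ℝ, |RieszBessel.besselRatio (κ 0) (|s|)| ≤ 1 := fun s => by
    rw [abs_of_nonneg (RieszBessel.besselRatio_nonneg hκ₀.2 _)]
    exact RieszBessel.besselRatio_le_one hκ₀.2 _
  -- The sign of `A 0` is forced by the nonnegativity of the spectral density.
  have hA : 0 ≤ RieszBessel.c2 0 (κ 0) / 2 * A 0 :=
    RieszBessel.coeff_nonneg_of_local hξf.integrable hξf.nonneg hL0 hβ0 hβ1 hκ₀.1 hκ₀.2 hα hBc hB0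
      hB1 hloc
  have hI := hξf.isIsometricFamily hξ hξ0
  have hJ := hW.isIsometricFamily
  have hξ0' : ∀ x, ∫ ω, (ξ x ω : ℂ) ∂P = 0 := fun x => by
    rw [integral_complex_ofReal, hξ0, Complex.ofReal_zero]
  have hξG : IsGaussianProcess (fun x ω => (ξ x ω : ℂ)) P := ⟨fun I =>
    (hξ.hasGaussianLaw I).map_fun
      (ContinuousLinearMap.piMap fun _ : I => Complex.ofRealCLM)⟩
  have hUm : ∀ t x, 0 < t → MemLp (fun ω => (U₀ t x ω : ℂ)) 2 P' := fun t x ht => (hU₀ t x ht).2.1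
  have hUg := fun t x (ht : 0 < t) => hJ.mem_graph (hU₀ t x ht)
  have hU0 : ∀ t x, 0 < t → ∫ ω, U₀ t x ω ∂P' = 0 := fun t x ht =>
    hJ.integral_toLp_eq_zero hW.mean_zero (hUm t x ht) (hUg t x ht)
  refine ⟨?_, hU0, fun N t x ht => ?_⟩
  · refine RieszBessel.isGaussianProcess_of_integral_exp
      (fun p => RieszBessel.memLp_of_memLp_ofReal (hUm p.1 p.2 p.1.2)) (fun p => hU0 p.1 p.2 p.1.2)
      fun I θ => ?_
    exact hJ.integral_exp_sum hW.gaussian hW.mean_zero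
      (η := fun (p : I) ω => U₀ p.1.1 p.1.2 ω) (fun p => hUm _ _ p.1.1.2)
      (fun p => hUg _ _ p.1.1.2) θ
  · have hRm := fun (ε : Set.Ioi (0 : ℝ)) (k : Fin N) =>
      RieszBessel.memLp_rescaled (κ₀ := κ 0) (L₀ := L 0) hu ε.2 (ht k) (x k)
    have hRg := fun (ε : Set.Ioi (0 : ℝ)) (k : Fin N) =>
      RieszBessel.exists_rescaled_mem_graph hα0.le hγ.le hβ0 hβ1 hμ.le hI hξ hξ0 hξf hu ε.2 (ht k)
        (x k) (hRm ε k)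
    choose q hq using hRg
    have hRm' := fun ε k => RieszBessel.memLp_of_memLp_ofReal (hRm ε k)
    have hUm' := fun k => RieszBessel.memLp_of_memLp_ofReal (hUm (t k) (x k) (ht k))
    refine RieszBessel.tendstoInDistribution_of_tendsto_integral_exp
      (X := fun (ε : Set.Ioi (0 : ℝ)) k => RieszBessel.rescaled α β (κ 0) (L 0) u ε (t k) (x k))
      (Z := fun k => U₀ (t k) (x k)) (fun ε k => (hRm' ε k).1.aemeasurable)
      (fun k => (hUm' k).1.aemeasurable) fun θ => ?_
    -- Both characteristic functions are exponentials of minus half a quadratic form in `θ`, so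
    -- convergence reduces to the individual covariances.
    rw [hJ.integral_exp_sum hW.gaussian hW.mean_zero (fun k => hUm _ _ (ht k))
      (fun k => hUg _ _ (ht k)) θ, RieszBessel.integral_sum_mul_sq hUm' θ]
    simp_rw [fun ε => hI.integral_exp_sum hξG hξ0' (hRm ε) (hq ε) θ,
      fun ε => RieszBessel.integral_sum_mul_sq (hRm' ε) θ]
    have hcov : ∀ k l, Tendsto
        (fun ε : Set.Ioi (0 : ℝ) => ∫ ω, RieszBessel.rescaled α β (κ 0) (L 0) u ε (t k) (x k) ω *
          RieszBessel.rescaled α β (κ 0) (L 0) u ε (t l) (x l) ω ∂P)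
        (comap (fun ε : Set.Ioi (0 : ℝ) => (ε : ℝ)) (𝓝 0))
        (𝓝 (∫ ω, U₀ (t k) (x k) ω * U₀ (t l) (x l) ω ∂P')) := fun k l => by
      have hδ := RieszBessel.tendsto_coe_rpow_comap (div_pos hβ0 hα0)
      have h1 := (RieszBessel.tendsto_scaled_integral hξf.integrable hL0 hβ0 hβ1 hγ.le
        (mul_pos hμ (Real.rpow_pos_of_pos (ht k) β)) (mul_pos hμ (Real.rpow_pos_of_pos (ht l) β))
        hκ₀.1 hκ₀.2 hα hBc hB0 hB1 hloc (x k - x l)).comp hδ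
      rw [← RieszBessel.integral_limit_mul hW hU₀ hA (ht k) (ht l)] at h1
      have h2 := (Complex.continuous_re.tendsto _).comp h1
      rw [Complex.ofReal_re] at h2
      refine h2.congr' ?_
      obtain ⟨a, -, hpos, -⟩ := hL0.1
      filter_upwards [(tendsto_inv_nhdsGT_zero.comp hδ).eventually_ge_atTop a] with ε hε
      simp only [Function.comp]
      rw [← RieszBessel.integral_rescaled_mul hα0 hγ.le hβ0 hβ1 hμ.le hI hξ hξ0 hξf hu ε.2 (ht k)
        (ht l) (hpos _ hε).le, Complex.ofReal_re]
    refine (Complex.continuous_exp.tendsto _).comp (Tendsto.div_const (Tendsto.neg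
      ((Complex.continuous_ofReal.tendsto _).comp ?_)) 2)
    exact tendsto_finsetSum _ fun k _ => tendsto_finsetSum _ fun l _ => (hcov k l).const_mul _
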